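/- Let $\Gamma=\Gamma_0(4)$, let $k,l,\nu\ge 0$ be integers and let $\chi_2$ be a Dirichlet character modulo $4$. For a half-integral weight $k+\frac12$ and $\gamma=\begin{pmatrix}a&b\\c&d\end{pmatrix}\in\Gamma$ put $$(f\,\tilde|_{k+\frac12}\gamma)(z)=\left(\tfrac{c}{d}\right)\left(\tfrac{-4}{d}\right)^{k+\frac12}(cz+d)^{-k-\frac12}f(\gamma z)$$ (Kronecker symbols, principal branches), and let $M_{k+\frac12}(\Gamma,\chi)\supseteq S_{k+\frac12}(\Gamma,\chi)$ be the spaces of holomorphic functions $f$ on the upper half-plane $\mathbb H$ with $f\,\tilde|_{k+\frac12}\gamma=\chi(d)f$ for all $\gamma\in\Gamma$ which are holomorphic, respectively vanish, at all cusps. For an integer $K\ge 0$ let $S_K(\Gamma,\chi)$ be the usual space of cusp forms of weight $K$ and character $\chi$ on $\Gamma$. Write $S_{k+\frac12}(\Gamma)$ for the trivial character. In each weight $\kappa$ the cusp forms carry the Petersson product $\langle f,h\rangle=\int_{\Gamma\backslash\mathbb H}f(z)\overline{h(z)}\,y^{\kappa}\,\frac{dx\,dy}{y^2}$, where $z=x+iy$.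 For real $\kappa,\lambda>0$ put $C_r(\kappa,\lambda;\nu)=(-1)^{\nu-r}\binom{\nu}{r}\frac{\Gamma(\kappa+\nu)\Gamma(\lambda+\nu)}{\Gamma(\kappa+r)\Gamma(\lambda+\nu-r)}$, and define the Rankin–Cohen bracket of a form $h$ of weight $\kappa$ and a form $g$ of weight $\lambda$ by $[h,g]_\nu=\sum_{r=0}^{\nu}C_r(\kappa,\lambda;\nu)\,D^rh\,D^{\nu-r}g$, where $D=\frac1{2\pi i}\frac{d}{dz}$. Let $g=\sum_{m\ge0}b(m)q^m\in M_{l+\frac12}(\Gamma,\chi_2)$, $q=e^{2\pi iz}$, and suppose that either (a) $g$ is a cusp form and $k>2$, or (b) $g$ is not a cusp form and $l<k-\frac32$. Let $\chi=\chi_{-4}^{\,k+l+1}$, where $\chi_{-4}(d)=\left(\frac{-4}{d}\right)$. Then $T_{g,\nu}(h)=[h,g]_\nu$ defines a linear map $$T_{g,\nu}:S_{k+\frac12}(\Gamma)\to S_{k+l+2\nu+1}(\Gamma,\chi_2\chi),$$ it has a unique adjoint $T_{g,\nu}^*$, that is, a unique linear map $T_{g,\nu}^*:S_{k+l+2\nu+1}(\Gamma,\chi_2\chi)\to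 S_{k+\frac12}(\Gamma)$ with $\langle f,T_{g,\nu}(h)\rangle=\langle T_{g,\nu}^*(f),h\rangle$ for all $f$ and $h$, and for every $f=\sum_{m\ge1}a(m)q^m\in S_{k+l+2\nu+1}(\Gamma,\chi_2\chi)$ we have $$T_{g,\nu}^*(f)=\sum_{n\ge1}c(n)q^n,\qquad c(n)=\beta(k,l,\nu;n)\,L_{f,g,\nu,n}(k+l+2\nu),$$ where $$\beta(k,l,\nu;n)=\frac{\Gamma(k+l+2\nu)\,n^{k-\frac12}}{\Gamma(k-\frac12)\,(4\pi)^{l+2\nu+\frac12}},\qquad L_{f,g,\nu,n}(s)=\sum_{m=0}^\infty\frac{a(n+m)\,\overline{b(m)}\,\alpha(n,m)}{(n+m)^s},$$ $$\alpha(n,m)=\sum_{r=0}^{\nu}C_r\!\left(k+\tfrac12,\,l+\tfrac12;\nu\right)n^r m^{\nu-r},$$ with $0^0=1$. The series $L_{f,g,\nu,n}(s)$ converges absolutely at $s=k+l+2\nu$ for every $n\ge1$. -/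

import Mathlib

open UpperHalfPlane hiding I
open scoped MatrixGroups ModularForm Manifold ComplexConjugate

noncomputable section

namespace HalfIntegralWeight

/-- The (extended) quadratic residue symbol `(c/d)` for odd `d`:
for `d > 0` the Jacobi symbol, for `d < 0` it is `(c/|d|)` if `c ≥ 0` and `-(c/|d|)` if `c < 0`
(in particular `(0/±1) = 1`). This is the Kronecker symbol at odd `d`. -/
def kronecker (c d : ℤ) : ℤ :=
  (if c < 0 ∧ d < 0 then -1 else 1) * jacobiSym c d.natAbs

/-- The slash operator of weight `k + 1/2` for a matrix in `Γ₀(4)`,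
`(c/d) (-4/d)^(k+1/2) (cz+d)^(-k-1/2) f(γz)`; all powers are principal branches. -/
def halfSlash (k : ℕ) (f : ℍ → ℂ) (γ : SL(2, ℤ)) (z : ℍ) : ℂ :=
  (kronecker (γ 1 0) (γ 1 1) : ℂ) * (kronecker (-4) (γ 1 1) : ℂ) ^ ((k : ℂ) + 1 / 2) *
    (((γ 1 0 : ℤ) : ℂ) * (z : ℂ) + ((γ 1 1 : ℤ) : ℂ)) ^ (-(k : ℂ) - 1 / 2) * f (γ • z)

/-- `(cz+d)^(-k-1/2) f(γz)` for an arbitrary `γ ∈ SL₂(ℤ)`: the expansion of `f` at the cusp `γ∞`,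
determined up to a constant of modulus one. -/
def cuspTranslate (k : ℕ) (f : ℍ → ℂ) (γ : SL(2, ℤ)) (z : ℍ) : ℂ :=
  (((γ 1 0 : ℤ) : ℂ) * (z : ℂ) + ((γ 1 1 : ℤ) : ℂ)) ^ (-(k : ℂ) - 1 / 2) * f (γ • z)

lemma halfSlash_add (k : ℕ) (f g : ℍ → ℂ) (γ : SL(2, ℤ)) :
    halfSlash k (f + g) γ = halfSlash k f γ + halfSlash k g γ := by
  ext z; simp only [halfSlash, Pi.add_apply]; ring

lemma halfSlash_smul (k : ℕ) (c : ℂ) (f : ℍ → ℂ) (γ : SL(2, ℤ)) :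
    halfSlash k (c • f) γ = c • halfSlash k f γ := by
  ext z; simp only [halfSlash, Pi.smul_apply, smul_eq_mul]; ring

lemma cuspTranslate_add (k : ℕ) (f g : ℍ → ℂ) (γ : SL(2, ℤ)) :
    cuspTranslate k (f + g) γ = cuspTranslate k f γ + cuspTranslate k g γ := by
  ext z; simp only [cuspTranslate, Pi.add_apply]; ring

lemma cuspTranslate_smul (k : ℕ) (c : ℂ) (f : ℍ → ℂ) (γ : SL(2, ℤ)) :
    cuspTranslate k (c • f) γ = c • cuspTranslate k f γ := by
  ext z; simp only [cuspTranslate, Pi.smul_apply, smul_eq_mul]; ring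

/-- The space `M_{k+1/2}(Γ₀(4), χ)`. Holomorphy at the cusps is boundedness of every
`cuspTranslate` at `i∞`. -/
def halfModularForms (k : ℕ) (χ : DirichletCharacter ℂ 4) : Submodule ℂ (ℍ → ℂ) where
  carrier := {f | MDifferentiable 𝓘(ℂ) 𝓘(ℂ) f ∧
    (∀ γ ∈ CongruenceSubgroup.Gamma0 4,
      halfSlash k f γ = χ ((γ 1 1 : ℤ) : ZMod 4) • f) ∧
    ∀ γ : SL(2, ℤ), IsBoundedAtImInfty (cuspTranslate k f γ)}
  zero_mem' := by
    refine ⟨mdifferentiable_const, fun γ _ => ?_, fun γ => ?_⟩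
    · ext z; simp [halfSlash]
    · have h : cuspTranslate k 0 γ = 0 := by ext z; simp [cuspTranslate]
      rw [h]; exact zero_form_isBoundedAtImInfty
  add_mem' := by
    rintro f g ⟨hf, hf', hf''⟩ ⟨hg, hg', hg''⟩
    refine ⟨hf.add hg, fun γ hγ => ?_, fun γ => ?_⟩
    · rw [halfSlash_add, hf' γ hγ, hg' γ hγ, smul_add]
    · rw [cuspTranslate_add]; exact (hf'' γ).add (hg'' γ)
  smul_mem' := by
    rintro c f ⟨hf, hf', hf''⟩
    refine ⟨hf.const_smul c, fun γ hγ => ?_, fun γ => ?_⟩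
    · rw [halfSlash_smul, hf' γ hγ, smul_comm]
    · rw [cuspTranslate_smul]; exact (hf'' γ).const_smul_left c

/-- The space `S_{k+1/2}(Γ₀(4), χ)` of cusp forms of weight `k + 1/2`. -/
def halfCuspForms (k : ℕ) (χ : DirichletCharacter ℂ 4) : Submodule ℂ (ℍ → ℂ) where
  carrier := {f | MDifferentiable 𝓘(ℂ) 𝓘(ℂ) f ∧
    (∀ γ ∈ CongruenceSubgroup.Gamma0 4,
      halfSlash k f γ = χ ((γ 1 1 : ℤ) : ZMod 4) • f) ∧
    ∀ γ : SL(2, ℤ), IsZeroAtImInfty (cuspTranslate k f γ)}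
  zero_mem' := by
    refine ⟨mdifferentiable_const, fun γ _ => ?_, fun γ => ?_⟩
    · ext z; simp [halfSlash]
    · have h : cuspTranslate k 0 γ = 0 := by ext z; simp [cuspTranslate]
      rw [h]; exact tendsto_const_nhds
  add_mem' := by
    rintro f g ⟨hf, hf', hf''⟩ ⟨hg, hg', hg''⟩
    refine ⟨hf.add hg, fun γ hγ => ?_, fun γ => ?_⟩
    · rw [halfSlash_add, hf' γ hγ, hg' γ hγ, smul_add]
    · rw [cuspTranslate_add]; exact (hf'' γ).add (hg'' γ)
  smul_mem' := by
    rintro c f ⟨hf, hf', hf''⟩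
    refine ⟨hf.const_smul c, fun γ hγ => ?_, fun γ => ?_⟩
    · rw [halfSlash_smul, hf' γ hγ, smul_comm]
    · rw [cuspTranslate_smul]; exact (hf'' γ).smul c

/-- The space `S_K(Γ₀(4), χ)` of cusp forms of integral weight `K` with character `χ`. -/
def integralCuspForms (K : ℕ) (χ : DirichletCharacter ℂ 4) : Submodule ℂ (ℍ → ℂ) where
  carrier := {f | MDifferentiable 𝓘(ℂ) 𝓘(ℂ) f ∧
    (∀ γ ∈ CongruenceSubgroup.Gamma0 4,
      f ∣[(K : ℤ)] γ = χ ((γ 1 1 : ℤ) : ZMod 4) • f) ∧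
    ∀ γ : SL(2, ℤ), IsZeroAtImInfty (f ∣[(K : ℤ)] γ)}
  zero_mem' := by
    refine ⟨mdifferentiable_const, fun γ _ => ?_, fun γ => ?_⟩
    · rw [SlashAction.zero_slash, smul_zero]
    · rw [SlashAction.zero_slash]; exact tendsto_const_nhds
  add_mem' := by
    rintro f g ⟨hf, hf', hf''⟩ ⟨hg, hg', hg''⟩
    refine ⟨hf.add hg, fun γ hγ => ?_, fun γ => ?_⟩
    · rw [SlashAction.add_slash, hf' γ hγ, hg' γ hγ, smul_add]
    · rw [SlashAction.add_slash]; exact (hf'' γ).add (hg'' γ)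
  smul_mem' := by
    rintro c f ⟨hf, hf', hf''⟩
    refine ⟨hf.const_smul c, fun γ hγ => ?_, fun γ => ?_⟩
    · rw [ModularForm.SL_smul_slash, hf' γ hγ, smul_comm]
    · rw [ModularForm.SL_smul_slash]; exact (hf'' γ).smul c

/-- The character `χ₋₄(d) = (-4/d)` modulo `4`, with complex values. -/
def chiNegFour : DirichletCharacter ℂ 4 :=
  ZMod.χ₄.ringHomComp (Int.castRingHom ℂ)

/-- The Petersson scalar product `∫_{Γ₀(4)\ℍ} f(z) conj(g(z)) Im(z)^κ dx dy / y²` (not normalised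
by the volume). The integral over `Γ₀(4)\ℍ` is the sum, over representatives `δ = q.out⁻¹` of
`Γ₀(4)\SL₂(ℤ)`, of the integrals over the translates `δ𝒟` of the standard fundamental
domain `𝒟` of `SL₂(ℤ)`; `volume` on `ℍ` is the invariant measure `dx dy / y²`. -/
def peterssonProduct (κ : ℝ) (f g : ℍ → ℂ) : ℂ :=
  ∑ᶠ q : SL(2, ℤ) ⧸ CongruenceSubgroup.Gamma0 4,
    ∫ z in ModularGroup.fd,
      f (q.out⁻¹ • z) * conj (g (q.out⁻¹ • z)) * (((q.out⁻¹ • z).im ^ κ : ℝ) : ℂ)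

/-- `U` is the adjoint of `T` for the Petersson products of weights `κV`, `κW`:
`⟨f, T h⟩ = ⟨U f, h⟩` for all `f`, `h`. -/
def IsPeterssonAdjoint (κV κW : ℝ) {V W : Submodule ℂ (ℍ → ℂ)}
    (T : V →ₗ[ℂ] W) (U : W →ₗ[ℂ] V) : Prop :=
  ∀ (f : W) (h : V), peterssonProduct κW f (T h) = peterssonProduct κV (U f) h

/-- The coefficient `C_r(κ, lam; ν)` of the Rankin–Cohen bracket. -/
def rcCoeff (κ lam : ℝ) (ν r : ℕ) : ℝ :=
  (-1) ^ (ν - r) * (ν.choose r : ℝ) *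
    (Real.Gamma (κ + ν) * Real.Gamma (lam + ν)) /
      (Real.Gamma (κ + r) * Real.Gamma (lam + (ν - r : ℕ)))

/-- The `ν`-th Rankin–Cohen bracket `∑_r C_r(κ, lam; ν) D^r f D^(ν-r) g`,
`D = (2πi)⁻¹ d/dz`, of `f` (of weight `κ`) and `g` (of weight `lam`). -/
def rankinCohen (κ lam : ℝ) (ν : ℕ) (f g : ℍ → ℂ) (z : ℍ) : ℂ :=
  ∑ r ∈ Finset.range (ν + 1), (rcCoeff κ lam ν r : ℂ) *
    (Derivative.normalizedDerivOfComplex^[r] f) z *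
    (Derivative.normalizedDerivOfComplex^[ν - r] g) z

/-- `α(κ, lam, ν, n, m) = ∑_r C_r(κ, lam; ν) n^r m^(ν-r)`. -/
def rcAlpha (κ lam : ℝ) (ν n m : ℕ) : ℝ :=
  ∑ r ∈ Finset.range (ν + 1), rcCoeff κ lam ν r * (n : ℝ) ^ r * (m : ℝ) ^ (ν - r)

/-- The `m`-th term of the shifted Rankin–Selberg series of two forms of weights `κ`-bracket-`lam`
with Fourier coefficients `a` and `b`. -/
def shiftedLTerm (κ lam : ℝ) (ν : ℕ) (a b : ℕ → ℂ) (n : ℕ) (s : ℂ) (m : ℕ) : ℂ :=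
  a (n + m) * conj (b m) * (rcAlpha κ lam ν n m : ℂ) / ((n + m : ℕ) : ℂ) ^ s

/-- The shifted Rankin–Selberg series
`∑_{m ≥ 0} a(n+m) conj(b(m)) α(κ, lam, ν, n, m) / (n+m)^s`. -/
def shiftedL (κ lam : ℝ) (ν : ℕ) (a b : ℕ → ℂ) (n : ℕ) (s : ℂ) : ℂ :=
  ∑' m : ℕ, shiftedLTerm κ lam ν a b n s m

/-- `β(k, l, ν; n) = Γ(k+l+2ν) n^(k-1/2) / (Γ(k-1/2) (4π)^(l+2ν+1/2))`. -/
def beta (k l ν n : ℕ) : ℝ :=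
  Real.Gamma ((k : ℝ) + l + 2 * ν) * (n : ℝ) ^ ((k : ℝ) - 1 / 2) /
    (Real.Gamma ((k : ℝ) - 1 / 2) * (4 * Real.pi) ^ ((l : ℝ) + 2 * ν + 1 / 2))

/-- `q = e^(2πiz)`. -/
def qOf (z : ℍ) : ℂ := Complex.exp (2 * Real.pi * Complex.I * (z : ℂ))

end HalfIntegralWeight

end

noncomputable section

namespace HalfIntegralWeight

section

open Derivative

/-! ### Automorphy factors and translates of arbitrary real weight -/

/-! Existence and uniqueness of the adjoint are linear algebra: `halfCuspForms` is finite
dimensional and the Petersson form is definite on it, so Riesz representation applies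
(`existsUnique_adjoint`). The content is the formula for the coefficients, and it comes from testing
the adjoint relation on Poincaré series. Let P_n be the sum of the translates of q^n over the bottom
rows of Γ₀(4). Unfolding gives ⟨u, P_n⟩ = 2 c(n) Γ(k-1/2) / (4πn)^(k-1/2) for a cusp form u with
coefficients c (`peterssonProduct_poincare`). The Rankin–Cohen bracket commutes with translation
(`rankinCohen_weightTranslate`), so [P_n, g] is the sum of the translates of [q^n, g], and ⟨f, [P_n,
g]⟩ unfolds to an integral of f against [q^n, g] over a strip. Parseval on horizontal lines and a
Gamma integral in y turn it into the shifted Dirichlet series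
(`peterssonProduct_rankinCohen_poincare`). With u = T*f the two sides agree, and β is the quotient
of the constants. Rows p and -p are both counted, which puts the same factor 2 on each side.

The analytic question is absolute convergence on the strip. With K = k+l+2ν+1, f is O(y^(-K/2)), and
the root mean square of [q^n, g] at height y is O(e^(-2πny)(1 + y^(-(ν+e/2)))) if the mean square of
g is O(1 + y^(-e)). The integral converges near y = 0 as soon as e < k+l-1. For cuspidal g, e =
l+1/2 suffices. Otherwise the pointwise bound gives only e = 2l+1, which just fails in the extreme
case l = k-2; the mean square bound `IsForm.exists_meanSquare_bound` saves 1/4, because g is that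
large only close to rationals of small denominator.

The multiplier of half-integral weight takes values in the fourth roots of unity, so fourth powers
of forms are integral weight modular forms on Γ₀(4) with trivial character. The growth of cusp forms
and the Sturm bound behind finite dimensionality are deduced from this. The cocycle relation of the
multiplier, needed for the modularity of P_n, is read off from g itself when g ≠ 0
(`halfSlash_mul`); the case g = 0 is separate and trivial. -/

/-- The automorphy factor `cz + d`. -/
def autFactor (γ : SL(2, ℤ)) (z : ℍ) : ℂ := ((γ 1 0 : ℤ) : ℂ) * (z : ℂ) + ((γ 1 1 : ℤ) : ℂ)

lemma denom_eq_autFactor (γ : SL(2, ℤ)) (z : ℍ) : denom γ z = autFactor γ z := by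
  simp [autFactor, ModularGroup.denom_apply]

lemma autFactor_ne_zero (γ : SL(2, ℤ)) (z : ℍ) : autFactor γ z ≠ 0 := by
  rw [← denom_eq_autFactor]; exact denom_ne_zero _ _

lemma autFactor_mul (γ δ : SL(2, ℤ)) (z : ℍ) :
    autFactor (γ * δ) z = autFactor γ (δ • z) * autFactor δ z := by
  simp only [← denom_eq_autFactor]
  have h := denom_cocycle_σ (γ : GL (Fin 2) ℝ) (δ : GL (Fin 2) ℝ) z
  -- The twist `σ` is conjugation only for negative determinant, so it disappears on SL₂(ℤ).
  have hσ : σ (δ : GL (Fin 2) ℝ) = ContinuousAlgEquiv.refl ℝ ℂ := by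
    simp [σ]
  rw [hσ] at h
  rw [map_mul, map_mul, h]
  rfl

lemma im_smul_eq (γ : SL(2, ℤ)) (z : ℍ) : (γ • z).im = z.im / ‖autFactor γ z‖ ^ 2 := by
  rw [ModularGroup.im_smul_eq_div_normSq, denom_eq_autFactor, Complex.normSq_eq_norm_sq]

/-- `(cz+d)^(-κ) f(γz)`. -/
def weightTranslate (κ : ℝ) (f : ℍ → ℂ) (γ : SL(2, ℤ)) (z : ℍ) : ℂ :=
  autFactor γ z ^ (-(κ : ℂ)) * f (γ • z)

lemma cuspTranslate_eq (k : ℕ) (f : ℍ → ℂ) (γ : SL(2, ℤ)) :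
    cuspTranslate k f γ = weightTranslate ((k : ℝ) + 1 / 2) f γ := by
  ext z
  simp only [cuspTranslate, weightTranslate, autFactor]
  congr 2
  push_cast
  ring

lemma slash_eq_weightTranslate (K : ℕ) (f : ℍ → ℂ) (γ : SL(2, ℤ)) :
    f ∣[(K : ℤ)] γ = weightTranslate (K : ℝ) f γ := by
  ext z
  rw [ModularForm.SL_slash_apply, denom_eq_autFactor, weightTranslate, mul_comm]
  simp [Complex.cpow_neg]

lemma norm_weightTranslate (κ : ℝ) (f : ℍ → ℂ) (γ : SL(2, ℤ)) (z : ℍ) :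
    ‖weightTranslate κ f γ z‖ = ‖autFactor γ z‖ ^ (-κ) * ‖f (γ • z)‖ := by
  rw [weightTranslate, norm_mul]
  congr 1
  rw [← Complex.ofReal_neg, Complex.norm_cpow_real]

/-- Since Im γz = y/|cz+d|², the factor |cz+d|^(-κ) is exactly what passes from y^(κ/2) to (Im
γz)^(κ/2). -/
lemma norm_weightTranslate_mul_im (κ : ℝ) (f : ℍ → ℂ) (γ : SL(2, ℤ)) (z : ℍ) :
    ‖weightTranslate κ f γ z‖ * z.im ^ (κ / 2) = ‖f (γ • z)‖ * (γ • z).im ^ (κ / 2) := by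
  have h := norm_pos_iff.2 (autFactor_ne_zero γ z)
  rw [norm_weightTranslate, im_smul_eq, Real.div_rpow z.im_pos.le (by positivity),
    ← Real.rpow_natCast, ← Real.rpow_mul h.le, Real.rpow_neg h.le]
  have : ((2 : ℕ) : ℝ) * (κ / 2) = κ := by push_cast; ring
  rw [this]
  ring

lemma hasDerivAt_autFactor_cpow (γ : SL(2, ℤ)) (s : ℂ) (z : ℍ) :
    HasDerivAt (fun w : ℂ => (((γ 1 0 : ℤ) : ℂ) * w + ((γ 1 1 : ℤ) : ℂ)) ^ s)
      (s * (γ 1 0 : ℤ) * (autFactor γ z ^ s / autFactor γ z)) z := by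
  -- For c = 0 the base is the constant d, which may lie on the branch cut, but then there is
  -- nothing to differentiate. For c ≠ 0 the base is not real and so stays in the slit plane.
  by_cases hc : γ 1 0 = 0
  · simpa [hc] using hasDerivAt_const (z : ℂ) ((((γ 1 1 : ℤ) : ℂ)) ^ s)
  have hlin : HasDerivAt (fun w : ℂ => ((γ 1 0 : ℤ) : ℂ) * w + ((γ 1 1 : ℤ) : ℂ))
      ((γ 1 0 : ℤ) : ℂ) z := by
    simpa using ((hasDerivAt_id (z : ℂ)).const_mul ((γ 1 0 : ℤ) : ℂ)).add_const ((γ 1 1 : ℤ) : ℂ)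
  have := hlin.cpow_const (c := s) (by
    right
    have : (γ 1 0 : ℝ) ≠ 0 := by exact_mod_cast hc
    simp [z.im_ne_zero, hc])
  convert this using 1
  change _ = s * autFactor γ z ^ (s - 1) * _
  rw [Complex.cpow_sub _ _ (autFactor_ne_zero γ z), Complex.cpow_one]
  ring

lemma hasDerivAt_autFactor_cpow_mul (γ : SL(2, ℤ)) (s : ℂ) {H : ℍ → ℂ} (hH : MDiff H) (z : ℍ) :
    HasDerivAt ((fun w : ℍ => autFactor γ w ^ s * H (γ • w)) ∘ ofComplex)
      (s * (γ 1 0 : ℤ) * (autFactor γ z ^ s / autFactor γ z) * H (γ • z) +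
        autFactor γ z ^ s * (deriv (H ∘ ofComplex) ((γ • z : ℍ) : ℂ) / autFactor γ z ^ 2)) z := by
  have h1 := hasDerivAt_autFactor_cpow γ s z
  have hg : 0 < ((γ : GL (Fin 2) ℝ)).val.det := by
    have : ((γ : GL (Fin 2) ℝ)).val.det = 1 := by
      rw [← Matrix.GeneralLinearGroup.val_det_apply]; simp
    rw [this]; exact one_pos
  have hdet : ((γ : GL (Fin 2) ℝ)).val.det = 1 := by
    rw [← Matrix.GeneralLinearGroup.val_det_apply]; simp
  have h_smul := (hasStrictDerivAt_smul hg z).hasDerivAt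
  have h_F : HasDerivAt (H ∘ ofComplex) (deriv (H ∘ ofComplex) ((γ • z : ℍ) : ℂ))
      (((γ : GL (Fin 2) ℝ) • ofComplex (z : ℂ) : ℍ) : ℂ) := by
    rw [ofComplex_apply]
    exact (mdifferentiableAt_iff.mp (hH (γ • z))).hasDerivAt
  have h2 := h_F.comp (z : ℂ) h_smul
  have h3 := h1.mul h2
  have hev : ((fun w : ℍ => autFactor γ w ^ s * H (γ • w)) ∘ ofComplex) =ᶠ[nhds (z : ℂ)]
      (fun w : ℂ => (((γ 1 0 : ℤ) : ℂ) * w + ((γ 1 1 : ℤ) : ℂ)) ^ s) *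
        ((H ∘ ofComplex) ∘ fun w : ℂ => (((γ : GL (Fin 2) ℝ) • ofComplex w : ℍ) : ℂ)) := by
    filter_upwards [isOpen_upperHalfPlaneSet.mem_nhds z.im_pos] with w hw
    simp only [Function.comp_apply, Pi.mul_apply, autFactor, ofComplex_apply]
    rw [ofComplex_apply_of_im_pos hw]
    rfl
  refine (h3.congr_of_eventuallyEq hev).congr_deriv ?_
  rw [hdet, denom_eq_autFactor]
  simp only [Function.comp_apply, ofComplex_apply, autFactor]
  push_cast
  have : (γ : GL (Fin 2) ℝ) • z = γ • z := rfl
  rw [this]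
  ring

lemma mdifferentiable_autFactor_cpow_mul (γ : SL(2, ℤ)) (s : ℂ) {H : ℍ → ℂ} (hH : MDiff H) :
    MDiff (fun w : ℍ => autFactor γ w ^ s * H (γ • w)) := fun z =>
  mdifferentiableAt_iff.mpr (hasDerivAt_autFactor_cpow_mul γ s hH z).differentiableAt

lemma mdifferentiable_weightTranslate (κ : ℝ) {f : ℍ → ℂ} (hf : MDiff f) (γ : SL(2, ℤ)) :
    MDiff (weightTranslate κ f γ) := mdifferentiable_autFactor_cpow_mul γ _ hf

/-- `c / (2πi)`. -/
def lowerLeft (γ : SL(2, ℤ)) : ℂ := (γ 1 0 : ℤ) * (2 * Real.pi * Complex.I)⁻¹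

lemma normalizedDeriv_autFactor_cpow_mul (γ : SL(2, ℤ)) (s : ℂ) {H : ℍ → ℂ} (hH : MDiff H) (z : ℍ) :
    normalizedDerivOfComplex (fun w : ℍ => autFactor γ w ^ s * H (γ • w)) z =
      s * lowerLeft γ * (autFactor γ z ^ s / autFactor γ z) * H (γ • z) +
        autFactor γ z ^ s / autFactor γ z ^ 2 * normalizedDerivOfComplex H (γ • z) := by
  simp only [normalizedDerivOfComplex]
  rw [(hasDerivAt_autFactor_cpow_mul γ s hH z).deriv, lowerLeft]
  ring

lemma mdifferentiable_iterate {f : ℍ → ℂ} (hf : MDiff f) (r : ℕ) :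
    MDiff (normalizedDerivOfComplex^[r] f) := by
  induction r with
  | zero => exact hf
  | succ r ih =>
    rw [Function.iterate_succ_apply']
    exact normalizedDerivOfComplex_mdifferentiable ih

end

section

open Derivative

/-! ### Covariance of the Rankin–Cohen bracket -/

lemma normalizedDeriv_sum {ι : Type*} (s : Finset ι) (c : ι → ℂ) (F : ι → ℍ → ℂ)
    (hF : ∀ i, MDiff (F i)) (z : ℍ) :
    normalizedDerivOfComplex (fun w => ∑ i ∈ s, c i * F i w) z =
      ∑ i ∈ s, c i * normalizedDerivOfComplex (F i) z := by
  have h : ∀ i, HasDerivAt (F i ∘ ofComplex) (deriv (F i ∘ ofComplex) z) z := fun i =>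
    (mdifferentiableAt_iff.mp (hF i z)).hasDerivAt
  have h2 := HasDerivAt.fun_sum (u := s) fun i _ => (h i).const_mul (c i)
  simp only [normalizedDerivOfComplex]
  have : ((fun w => ∑ i ∈ s, c i * F i w) ∘ ofComplex) =
    fun w => ∑ i ∈ s, c i * (F i ∘ ofComplex) w := rfl
  rw [this, h2.deriv, Finset.mul_sum]
  exact Finset.sum_congr rfl fun i _ => by ring

lemma autFactor_cpow_sub_natCast (γ : SL(2, ℤ)) (s : ℂ) (m : ℕ) (z : ℍ) :
    autFactor γ z ^ (s - m) = autFactor γ z ^ s / autFactor γ z ^ m := by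
  rw [Complex.cpow_sub _ _ (autFactor_ne_zero γ z), Complex.cpow_natCast]

/-- This is the induction step for the coefficients of the r-th derivative of a translate: the first
summand arises when the derivative falls on the automorphy factor, the second when it falls on h.
After the Gamma quotients are removed it amounts to (i+1)·C(r,i+1) = (r-i)·C(r,i). -/
lemma choose_mul_Gamma_recursion {κ : ℝ} (hκ : 0 < κ) (r i : ℕ) :
    ((r + 1).choose (i + 1) : ℝ) * (Real.Gamma (κ + (r + 1 : ℕ)) / Real.Gamma (κ + (i + 1 : ℕ))) =
      (κ + r + (i + 1 : ℕ)) * (r.choose (i + 1) *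
          (Real.Gamma (κ + r) / Real.Gamma (κ + (i + 1 : ℕ)))) +
        r.choose i * (Real.Gamma (κ + r) / Real.Gamma (κ + i)) := by
  have h1 : Real.Gamma (κ + (r + 1 : ℕ)) = (κ + r) * Real.Gamma (κ + r) := by
    rw [← Real.Gamma_add_one (by positivity)]; push_cast; ring_nf
  have h2 : Real.Gamma (κ + (i + 1 : ℕ)) = (κ + i) * Real.Gamma (κ + i) := by
    rw [← Real.Gamma_add_one (by positivity)]; push_cast; ring_nf
  have h3 : (r.choose (i + 1) : ℝ) * (i + 1) = r.choose i * (r - i) := by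
    rcases le_or_gt i r with h | h
    · have := Nat.choose_succ_right_eq r i
      rw [← Nat.cast_sub h]
      exact_mod_cast this
    · simp [Nat.choose_eq_zero_of_lt h, Nat.choose_eq_zero_of_lt (Nat.lt_succ_of_lt h)]
  have hΓ := (Real.Gamma_pos_of_pos (by positivity : 0 < κ + i)).ne'
  have hi : κ + i ≠ 0 := by positivity
  rw [h1, h2, Nat.choose_succ_succ]
  push_cast
  field_simp
  linear_combination (-1 : ℝ) * h3

/-- Each D either hits the power of J = cz+d, giving a factor c/(2πi) and one more power of J in the
denominator, or hits D^i h(γz), giving two more powers of J. The coefficients count these choices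
with their weights. -/
lemma iterate_normalizedDeriv_weightTranslate {κ : ℝ} (hκ : 0 < κ) {h : ℍ → ℂ} (hh : MDiff h)
    (γ : SL(2, ℤ)) (r : ℕ) (z : ℍ) :
    normalizedDerivOfComplex^[r] (weightTranslate κ h γ) z =
      ∑ i ∈ Finset.range (r + 1),
        ((r.choose i * (Real.Gamma (κ + r) / Real.Gamma (κ + i)) : ℝ) : ℂ) *
          (-lowerLeft γ) ^ (r - i) *
          (autFactor γ z ^ (-(κ : ℂ) - (r + i : ℕ)) *
            normalizedDerivOfComplex^[i] h (γ • z)) := by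
  induction r generalizing z with
  | zero =>
    have := (Real.Gamma_pos_of_pos hκ).ne'
    simp [weightTranslate, this]
  | succ r ih =>
    rw [Function.iterate_succ_apply']
    have heq := funext ih
    rw [show normalizedDerivOfComplex^[r] (weightTranslate κ h γ) = _ from heq]
    rw [normalizedDeriv_sum _ _ (fun i w => autFactor γ w ^ (-(κ : ℂ) - (r + i : ℕ)) *
            normalizedDerivOfComplex^[i] h (γ • w)) (fun i =>
      mdifferentiable_autFactor_cpow_mul γ _ (mdifferentiable_iterate hh i))]
    simp only [normalizedDeriv_autFactor_cpow_mul γ _ (mdifferentiable_iterate hh _),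
      ← Function.iterate_succ_apply' normalizedDerivOfComplex]
    have hJ := autFactor_ne_zero γ z
    set J := autFactor γ z
    set c := lowerLeft γ
    set A : ℕ → ℕ → ℝ := fun r i => r.choose i * (Real.Gamma (κ + r) / Real.Gamma (κ + i)) with hA
    set H : ℕ → ℂ := fun i => normalizedDerivOfComplex^[i] h (γ • z)
    set B := J ^ (-(κ : ℂ))
    have e : ∀ m : ℕ, J ^ (-(κ : ℂ) - (m : ℕ)) = B / J ^ m := fun m =>
      autFactor_cpow_sub_natCast γ _ m z
    simp only [e]
    change ∑ i ∈ Finset.range (r + 1), ((A r i : ℝ) : ℂ) * (-c) ^ (r - i) *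
      ((-(κ : ℂ) - (r + i : ℕ)) * c * (B / J ^ (r + i) / J) * H i +
        B / J ^ (r + i) / J ^ 2 * H (i + 1)) =
      ∑ i ∈ Finset.range (r + 1 + 1), ((A (r + 1) i : ℝ) : ℂ) * (-c) ^ (r + 1 - i) *
        (B / J ^ (r + 1 + i) * H i)
    have hrec : ∀ i, (A (r + 1) (i + 1) : ℂ) = ((κ : ℂ) + r + (i + 1 : ℕ)) * A r (i + 1) + A r i := by
      intro i
      have := choose_mul_Gamma_recursion hκ r i
      exact_mod_cast congrArg (fun x : ℝ => (x : ℂ)) this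
    have hzero : (A (r + 1) 0 : ℂ) = ((κ : ℂ) + r) * A r 0 := by
      have h1 : Real.Gamma (κ + (r + 1 : ℕ)) = (κ + r) * Real.Gamma (κ + r) := by
        rw [← Real.Gamma_add_one (by positivity)]; push_cast; ring_nf
      have : A (r + 1) 0 = (κ + r) * A r 0 := by
        simp only [hA, h1, Nat.choose_zero_right]
        ring
      exact_mod_cast congrArg (fun x : ℝ => (x : ℂ)) this
    have hlast : (A r (r + 1) : ℂ) = 0 := by simp [hA]
    rw [Finset.sum_range_succ' _ (r + 1), hzero]
    -- The terms from the automorphy factor are shifted by one index so that they line up with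
    -- D^(i+1) h; the new top term is zero because C(r, r+1) = 0.
    have hsplit : ∑ i ∈ Finset.range (r + 1), ((A r i : ℝ) : ℂ) * (-c) ^ (r - i) *
        ((-(κ : ℂ) - (r + i : ℕ)) * c * (B / J ^ (r + i) / J) * H i) =
        ∑ i ∈ Finset.range (r + 1), ((A r (i + 1) : ℝ) : ℂ) * (-c) ^ (r - i) *
        (((κ : ℂ) + r + (i + 1 : ℕ)) * (B / J ^ (r + i + 2)) * H (i + 1)) +
        ((A r 0 : ℝ) : ℂ) * (-c) ^ (r + 1) * ((κ + r) * (B / J ^ (r + 1)) * H 0) := by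
      rw [Finset.sum_range_succ', Finset.sum_range_succ _ r, hlast]
      simp only [zero_mul, add_zero]
      congr 1
      · refine Finset.sum_congr rfl fun i hi => ?_
        have : r - i = (r - (i + 1)) + 1 := by have := Finset.mem_range.1 hi; omega
        rw [this, pow_succ]
        push_cast
        field_simp
        ring
      · simp only [Nat.sub_zero, pow_succ]
        field_simp
        ring
    simp only [mul_add, Finset.sum_add_distrib]
    rw [hsplit, add_right_comm, ← Finset.sum_add_distrib]
    congr 1
    · refine Finset.sum_congr rfl fun i hi => ?_
      rw [hrec, show r + 1 - (i + 1) = r - i by omega]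
      field_simp
      ring
    · simp only [Nat.sub_zero, add_zero]
      ring

/-- The generating series `∑ D^r f(z) / (r! Γ(κ+r)) X^r`. -/
def derivSeries (κ : ℝ) (f : ℍ → ℂ) (z : ℍ) : PowerSeries ℂ :=
  PowerSeries.mk fun r => normalizedDerivOfComplex^[r] f z / (r.factorial * Real.Gamma (κ + r) : ℝ)

/-- The normalisation by r! Γ(κ+r) makes the derivative formula a convolution. The failure of
modularity is then one exponential in X that does not depend on the weight κ. -/
lemma derivSeries_weightTranslate {κ : ℝ} (hκ : 0 < κ) {h : ℍ → ℂ} (hh : MDiff h)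
    (γ : SL(2, ℤ)) (z : ℍ) :
    derivSeries κ (weightTranslate κ h γ) z =
      PowerSeries.C (autFactor γ z ^ (-(κ : ℂ))) *
        (PowerSeries.rescale (-lowerLeft γ / autFactor γ z) (PowerSeries.exp ℂ) *
        PowerSeries.rescale ((autFactor γ z ^ 2)⁻¹) (derivSeries κ h (γ • z))) := by
  ext r
  have hJ := autFactor_ne_zero γ z
  have hΓ : ∀ i : ℕ, (Real.Gamma (κ + i) : ℂ) ≠ 0 := fun i => by
    exact_mod_cast (Real.Gamma_pos_of_pos (by positivity : 0 < κ + i)).ne'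
  rw [PowerSeries.coeff_C_mul, PowerSeries.coeff_mul, derivSeries, PowerSeries.coeff_mk,
    iterate_normalizedDeriv_weightTranslate hκ hh,
    Finset.Nat.sum_antidiagonal_eq_sum_range_succ_mk, ← Finset.sum_range_reflect,
    Finset.mul_sum, Finset.sum_div]
  refine Finset.sum_congr rfl fun i hi => ?_
  have hi' : i ≤ r := by have := Finset.mem_range.1 hi; omega
  have e : r + 1 - 1 - i = r - i := by omega
  rw [e, Nat.sub_sub_self hi', autFactor_cpow_sub_natCast]
  simp only [PowerSeries.coeff_rescale, PowerSeries.coeff_exp, derivSeries, PowerSeries.coeff_mk]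
  have hch : (r.choose (r - i) : ℂ) = r.factorial / (i.factorial * (r - i).factorial) := by
    rw [Nat.choose_symm hi', Nat.cast_choose ℂ hi']
  have h1 := hΓ (r - i)
  have h2 := hΓ r
  have f1 : (r.factorial : ℂ) ≠ 0 := by exact_mod_cast r.factorial_ne_zero
  have f2 : (i.factorial : ℂ) ≠ 0 := by exact_mod_cast i.factorial_ne_zero
  have f3 : ((r - i).factorial : ℂ) ≠ 0 := by exact_mod_cast (r - i).factorial_ne_zero
  have hpow : autFactor γ z ^ (r + (r - i)) = autFactor γ z ^ i * (autFactor γ z ^ 2) ^ (r - i) := by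
    rw [← pow_mul, ← pow_add]; congr 1; omega
  push_cast
  rw [hch, hpow, div_pow, inv_pow]
  simp
  field_simp

lemma rankinCohen_eq_coeff {κ lam : ℝ} (ν : ℕ) (f g : ℍ → ℂ) (z : ℍ) :
    rankinCohen κ lam ν f g z =
      ((ν.factorial * Real.Gamma (κ + ν) * Real.Gamma (lam + ν) : ℝ) : ℂ) *
        PowerSeries.coeff ν (derivSeries κ f z *
          PowerSeries.rescale (-1) (derivSeries lam g z)) := by
  rw [rankinCohen, PowerSeries.coeff_mul, Finset.Nat.sum_antidiagonal_eq_sum_range_succ_mk,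
    Finset.mul_sum]
  refine Finset.sum_congr rfl fun r hr => ?_
  have hr' : r ≤ ν := by have := Finset.mem_range.1 hr; omega
  simp only [derivSeries, PowerSeries.coeff_rescale, PowerSeries.coeff_mk, rcCoeff]
  have hch : (ν.choose r : ℂ) = ν.factorial / (r.factorial * (ν - r).factorial) :=
    Nat.cast_choose ℂ hr'
  rw [Complex.ofReal_div, Complex.ofReal_mul, Complex.ofReal_mul, Complex.ofReal_mul,
    Complex.ofReal_natCast, hch]
  generalize normalizedDerivOfComplex^[r] f z = x
  generalize normalizedDerivOfComplex^[ν - r] g z = y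
  simp only [Complex.ofReal_mul, Complex.ofReal_natCast, Complex.ofReal_pow, Complex.ofReal_neg,
    Complex.ofReal_one]
  ring

/-- The bracket is a coefficient of the product of the series of f at X and of g at -X. The
exponentials in the two transformation laws are inverse to each other and cancel; the common
rescaling by J^(-2) contributes J^(-2ν) in degree ν. -/
lemma rankinCohen_weightTranslate {κ lam : ℝ} (hκ : 0 < κ) (hl : 0 < lam) (ν : ℕ) {f g : ℍ → ℂ}
    (hf : MDiff f) (hg : MDiff g) (γ : SL(2, ℤ)) :
    rankinCohen κ lam ν (weightTranslate κ f γ) (weightTranslate lam g γ) =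
      weightTranslate (κ + lam + 2 * ν) (rankinCohen κ lam ν f g) γ := by
  ext z
  have hJ := autFactor_ne_zero γ z
  rw [weightTranslate, rankinCohen_eq_coeff, rankinCohen_eq_coeff, derivSeries_weightTranslate hκ hf,
    derivSeries_weightTranslate hl hg]
  have h1 : ∀ (a b c x y : ℂ) (p q : PowerSeries ℂ), PowerSeries.C x *
      (PowerSeries.rescale (-a) (PowerSeries.exp ℂ) * PowerSeries.rescale b p) *
      PowerSeries.rescale (-1) (PowerSeries.C y *
        (PowerSeries.rescale (-a) (PowerSeries.exp ℂ) * PowerSeries.rescale b q)) =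
      PowerSeries.C (x * y) * PowerSeries.rescale b (p * PowerSeries.rescale (-1) q) := by
    intro a b c x y p q
    have h2 : PowerSeries.rescale (-a) (PowerSeries.exp ℂ) *
        PowerSeries.rescale (-1) (PowerSeries.rescale (-a) (PowerSeries.exp ℂ)) = 1 := by
      rw [PowerSeries.rescale_rescale, PowerSeries.exp_mul_exp_eq_exp_add]
      simp
    have h3 : PowerSeries.rescale (-1 : ℂ) (PowerSeries.C y) = PowerSeries.C y := by
      ext n
      rw [PowerSeries.coeff_rescale, PowerSeries.coeff_C]
      split_ifs with h <;> simp [h]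
    simp only [map_mul, PowerSeries.rescale_rescale] at h2 ⊢
    rw [h3, mul_comm b (-1)]
    linear_combination (PowerSeries.C x * PowerSeries.C y * PowerSeries.rescale b p *
      PowerSeries.rescale (-1 * b) q) * h2
  rw [neg_div, h1 _ _ 0, PowerSeries.coeff_C_mul, PowerSeries.coeff_rescale,
    show (-((κ + lam + 2 * ν : ℝ) : ℂ)) = -(κ : ℂ) + -(lam : ℂ) - (2 * ν : ℕ) by push_cast; ring,
    autFactor_cpow_sub_natCast, Complex.cpow_add _ _ hJ, inv_pow, ← pow_mul]
  ring

lemma rankinCohen_smul {κ lam : ℝ} (ν : ℕ) {f g : ℍ → ℂ} (hf : MDiff f) (hg : MDiff g) (c d : ℂ) :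
    rankinCohen κ lam ν (c • f) (d • g) = (c * d) • rankinCohen κ lam ν f g := by
  have h : ∀ (c : ℂ) {f : ℍ → ℂ} (_ : MDiff f) (r : ℕ),
      normalizedDerivOfComplex^[r] (c • f) = c • normalizedDerivOfComplex^[r] f := by
    intro c f hf r
    induction r with
    | zero => rfl
    | succ r ih =>
      rw [Function.iterate_succ_apply', ih, normalizedDerivOfComplex_smul _ _
        (mdifferentiable_iterate hf r), Function.iterate_succ_apply']
  ext z
  simp only [rankinCohen, h c hf, h d hg, Pi.smul_apply, smul_eq_mul, Finset.mul_sum]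
  exact Finset.sum_congr rfl fun _ _ => by ring

lemma iterate_normalizedDeriv_add {f g : ℍ → ℂ} (hf : MDiff f) (hg : MDiff g) (r : ℕ) :
    normalizedDerivOfComplex^[r] (f + g) =
      normalizedDerivOfComplex^[r] f + normalizedDerivOfComplex^[r] g := by
  induction r with
  | zero => rfl
  | succ r ih =>
    rw [Function.iterate_succ_apply', ih, normalizedDerivOfComplex_add _ _
      (mdifferentiable_iterate hf r) (mdifferentiable_iterate hg r),
      Function.iterate_succ_apply', Function.iterate_succ_apply']

lemma rankinCohen_add {κ lam : ℝ} (ν : ℕ) {f f' g : ℍ → ℂ} (hf : MDiff f) (hf' : MDiff f') :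
    rankinCohen κ lam ν (f + f') g = rankinCohen κ lam ν f g + rankinCohen κ lam ν f' g := by
  ext z
  simp only [rankinCohen, iterate_normalizedDeriv_add hf hf', Pi.add_apply, mul_add, add_mul,
    Finset.sum_add_distrib]

lemma mdifferentiable_rankinCohen {κ lam : ℝ} (ν : ℕ) {f g : ℍ → ℂ} (hf : MDiff f) (hg : MDiff g) :
    MDiff (rankinCohen κ lam ν f g) := by
  have : rankinCohen κ lam ν f g = ∑ r ∈ Finset.range (ν + 1), (rcCoeff κ lam ν r : ℂ) •
    (normalizedDerivOfComplex^[r] f * normalizedDerivOfComplex^[ν - r] g) := by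
    ext z
    simp only [rankinCohen, Finset.sum_apply, Pi.smul_apply, Pi.mul_apply, smul_eq_mul, mul_assoc]
  rw [this]
  refine MDifferentiable.sum fun r _ => MDifferentiable.const_smul _ ?_
  exact (mdifferentiable_iterate hf r).mul (mdifferentiable_iterate hg _)

end

section

open Derivative

/-! ### Cauchy estimates and termwise differentiation -/

/-- Cauchy's estimate on a disc inside ℍ; the factor 1/(2π) of D is simply bounded by 1. -/
lemma norm_normalizedDeriv_le {f : ℍ → ℂ} (hf : MDiff f) (z : ℍ) {ρ M : ℝ} (hρ : 0 < ρ)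
    (hρz : ρ < z.im) (hM : ∀ w : ℍ, dist (w : ℂ) z ≤ ρ → ‖f w‖ ≤ M) :
    ‖normalizedDerivOfComplex f z‖ ≤ M / ρ := by
  have him : ∀ w : ℂ, dist w z ≤ ρ → 0 < w.im := by
    intro w hw
    have h1 := Complex.abs_im_le_norm (w - z)
    rw [← dist_eq_norm] at h1
    have h2 := (abs_le.1 (h1.trans hw)).1
    simp only [Complex.sub_im, UpperHalfPlane.coe_im] at h2
    linarith
  have hd : DiffContOnCl ℂ (f ∘ ofComplex) (Metric.ball (z : ℂ) ρ) := by
    refine DifferentiableOn.diffContOnCl fun w hw => ?_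
    rw [closure_ball _ hρ.ne'] at hw
    exact ((UpperHalfPlane.mdifferentiable_iff.1 hf).differentiableAt
      (isOpen_upperHalfPlaneSet.mem_nhds (him w hw))).differentiableWithinAt
  have h := Complex.norm_deriv_le_of_forall_mem_sphere_norm_le hρ hd (C := M) (by
    intro w hw
    have hw' : dist w z ≤ ρ := (Metric.mem_sphere.1 hw).le
    have := hM ⟨w, him w hw'⟩ hw'
    simpa [ofComplex_apply_of_im_pos (him w hw')] using this)
  have hM0 : 0 ≤ M / ρ := (norm_nonneg _).trans h
  rw [normalizedDerivOfComplex, norm_mul]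
  have : ‖(2 * Real.pi * Complex.I : ℂ)⁻¹‖ ≤ 1 := by
    rw [norm_inv]
    refine inv_le_one_of_one_le₀ ?_
    simp only [norm_mul, Complex.norm_ofNat, Complex.norm_real, Complex.norm_I, mul_one,
      Real.norm_eq_abs, abs_of_pos Real.pi_pos]
    linarith [Real.pi_gt_three]
  calc _ ≤ 1 * (M / ρ) := mul_le_mul this h (norm_nonneg _) zero_le_one
    _ = _ := one_mul _

/-- A family of holomorphic functions on `ℍ` satisfying a Weierstrass majorant condition locally. -/
structure LocallyMajorized {ι : Type*} (F : ι → ℍ → ℂ) : Prop where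
  mdiff : ∀ i, MDiff (F i)
  major : ∀ z₀ : ℍ, ∃ ε > 0, ∃ u : ι → ℝ, Summable u ∧
    ∀ i, ∀ z : ℍ, dist (z : ℂ) z₀ < ε → ‖F i z‖ ≤ u i

namespace LocallyMajorized

variable {ι : Type*} {F : ι → ℍ → ℂ}

lemma normalizedDeriv (hF : LocallyMajorized F) :
    LocallyMajorized fun i => normalizedDerivOfComplex (F i) where
  mdiff i := normalizedDerivOfComplex_mdifferentiable (hF.mdiff i)
  major z₀ := by
    obtain ⟨ε, hε, u, hu, h⟩ := hF.major z₀
    -- The ρ-disc about any point within ρ of z₀ has to stay in ℍ and in the ball where the majorant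
    -- is valid.
    obtain ⟨ρ, hρ, hρ1, hρ2⟩ : ∃ ρ > 0, 2 * ρ < ε ∧ 2 * ρ < z₀.im :=
      ⟨min ε z₀.im / 4, by have := z₀.im_pos; positivity,
        by have := min_le_left ε z₀.im; linarith,
        by have := min_le_right ε z₀.im; have := z₀.im_pos; linarith⟩
    refine ⟨ρ, hρ, fun i => u i / ρ, hu.div_const _, fun i z hz => ?_⟩
    refine norm_normalizedDeriv_le (hF.mdiff i) z hρ ?_ fun w hw => h i w ?_
    · have h1 := Complex.abs_im_le_norm ((z : ℂ) - z₀)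
      rw [← dist_eq_norm] at h1
      have h2 := (abs_lt.1 (h1.trans_lt hz)).1
      simp only [Complex.sub_im, UpperHalfPlane.coe_im] at h2
      linarith
    · exact (dist_triangle _ (z : ℂ) _).trans_lt (by linarith)

lemma summable (hF : LocallyMajorized F) (z : ℍ) : Summable fun i => F i z := by
  obtain ⟨ε, hε, u, hu, h⟩ := hF.major z
  exact Summable.of_norm_bounded hu fun i => h i z (by simpa using hε)

lemma exists_ball (hF : LocallyMajorized F) (z₀ : ℍ) : ∃ U : Set ℂ, IsOpen U ∧ (z₀ : ℂ) ∈ U ∧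
    (∀ w ∈ U, 0 < w.im) ∧ ∃ u : ι → ℝ, Summable u ∧
      ∀ i, ∀ w ∈ U, ‖(F i ∘ ofComplex) w‖ ≤ u i := by
  obtain ⟨ε, hε, u, hu, h⟩ := hF.major z₀
  refine ⟨Metric.ball z₀ ε ∩ upperHalfPlaneSet, Metric.isOpen_ball.inter isOpen_upperHalfPlaneSet,
    ⟨Metric.mem_ball_self hε, z₀.im_pos⟩, fun w hw => hw.2, u, hu, fun i w hw => ?_⟩
  have := h i ⟨w, hw.2⟩ hw.1
  simpa [ofComplex_apply_of_im_pos hw.2] using this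

lemma mdifferentiable_tsum (hF : LocallyMajorized F) : MDiff fun z => ∑' i, F i z := by
  intro z₀
  obtain ⟨U, hU, hz, him, u, hu, h⟩ := hF.exists_ball z₀
  rw [mdifferentiableAt_iff]
  exact (Complex.differentiableOn_tsum_of_summable_norm hu (fun i w hw =>
    ((UpperHalfPlane.mdifferentiable_iff.1 (hF.mdiff i)).differentiableAt
      (isOpen_upperHalfPlaneSet.mem_nhds (him w hw))).differentiableWithinAt) hU h).differentiableAt
      (hU.mem_nhds hz)

lemma hasSum_normalizedDeriv (hF : LocallyMajorized F) (z₀ : ℍ) :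
    HasSum (fun i => normalizedDerivOfComplex (F i) z₀)
      (normalizedDerivOfComplex (fun z => ∑' i, F i z) z₀) := by
  obtain ⟨U, hU, hz, him, u, hu, h⟩ := hF.exists_ball z₀
  exact (Complex.hasSum_deriv_of_summable_norm hu (fun i w hw =>
    ((UpperHalfPlane.mdifferentiable_iff.1 (hF.mdiff i)).differentiableAt
      (isOpen_upperHalfPlaneSet.mem_nhds (him w hw))).differentiableWithinAt) hU h hz).mul_left _

lemma hasSum_iterate (hF : LocallyMajorized F) (r : ℕ) (z : ℍ) :
    HasSum (fun i => normalizedDerivOfComplex^[r] (F i) z)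
      (normalizedDerivOfComplex^[r] (fun z => ∑' i, F i z) z) := by
  induction r generalizing F with
  | zero => exact (hF.summable z).hasSum
  | succ r ih =>
    have h := ih hF.normalizedDeriv
    have h2 : (fun z => ∑' i, normalizedDerivOfComplex (F i) z) =
        normalizedDerivOfComplex (fun z => ∑' i, F i z) :=
      funext fun z => (hF.hasSum_normalizedDeriv z).tsum_eq
    simpa only [h2, Function.iterate_succ_apply] using h

end LocallyMajorized

/-- Cauchy's estimate with radius 1. No periodicity is involved, so it serves at every cusp,
whatever its width and multiplier. -/
lemma isBoundedAtImInfty_normalizedDeriv {f : ℍ → ℂ} (hf : MDiff f) (hb : IsBoundedAtImInfty f) :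
    IsBoundedAtImInfty (normalizedDerivOfComplex f) := by
  rw [isBoundedAtImInfty_iff] at hb ⊢
  obtain ⟨M, A, h⟩ := hb
  refine ⟨M, max A 0 + 2, fun z hz => ?_⟩
  have h1 := le_max_left A 0
  have h2 := le_max_right A 0
  have := norm_normalizedDeriv_le hf z one_pos (by linarith) (M := M) fun w hw => h w ?_
  · simpa using this
  · have h3 := Complex.abs_im_le_norm ((w : ℂ) - z)
    rw [← dist_eq_norm] at h3
    have h4 := (abs_le.1 (h3.trans hw)).1
    simp only [Complex.sub_im, UpperHalfPlane.coe_im] at h4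
    linarith

lemma isZeroAtImInfty_normalizedDeriv {f : ℍ → ℂ} (hf : MDiff f) (hb : IsZeroAtImInfty f) :
    IsZeroAtImInfty (normalizedDerivOfComplex f) := by
  rw [isZeroAtImInfty_iff] at hb ⊢
  intro ε hε
  obtain ⟨A, h⟩ := hb ε hε
  refine ⟨max A 0 + 2, fun z hz => ?_⟩
  have h1 := le_max_left A 0
  have h2 := le_max_right A 0
  have := norm_normalizedDeriv_le hf z one_pos (by linarith) (M := ε) fun w hw => h w ?_
  · simpa using this
  · have h3 := Complex.abs_im_le_norm ((w : ℂ) - z)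
    rw [← dist_eq_norm] at h3
    have h4 := (abs_le.1 (h3.trans hw)).1
    simp only [Complex.sub_im, UpperHalfPlane.coe_im] at h4
    linarith

lemma isBoundedAtImInfty_iterate {f : ℍ → ℂ} (hf : MDiff f) (hb : IsBoundedAtImInfty f) (r : ℕ) :
    IsBoundedAtImInfty (normalizedDerivOfComplex^[r] f) := by
  induction r with
  | zero => exact hb
  | succ r ih =>
    rw [Function.iterate_succ_apply']
    exact isBoundedAtImInfty_normalizedDeriv (mdifferentiable_iterate hf r) ih

lemma isZeroAtImInfty_iterate {f : ℍ → ℂ} (hf : MDiff f) (hb : IsZeroAtImInfty f) (r : ℕ) :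
    IsZeroAtImInfty (normalizedDerivOfComplex^[r] f) := by
  induction r with
  | zero => exact hb
  | succ r ih =>
    rw [Function.iterate_succ_apply']
    exact isZeroAtImInfty_normalizedDeriv (mdifferentiable_iterate hf r) ih

lemma isZeroAtImInfty_rankinCohen {κ lam : ℝ} (ν : ℕ) {f g : ℍ → ℂ} (hf : MDiff f) (hg : MDiff g)
    (hf0 : IsZeroAtImInfty f) (hgb : IsBoundedAtImInfty g) :
    IsZeroAtImInfty (rankinCohen κ lam ν f g) := by
  have : Filter.Tendsto (fun z => ∑ r ∈ Finset.range (ν + 1), (rcCoeff κ lam ν r : ℂ) *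
    (normalizedDerivOfComplex^[r] f) z * (normalizedDerivOfComplex^[ν - r] g) z) atImInfty
      (nhds (∑ r ∈ Finset.range (ν + 1), 0)) := by
    refine tendsto_finsetSum _ fun r _ => ?_
    have h1 : Filter.Tendsto (fun z => (rcCoeff κ lam ν r : ℂ) *
        (normalizedDerivOfComplex^[r] f) z) atImInfty (nhds 0) := by
      simpa using (isZeroAtImInfty_iterate hf hf0 r).const_mul (rcCoeff κ lam ν r : ℂ)
    have h2 := isBoundedAtImInfty_iterate hg hgb (ν - r)
    exact h1.zero_mul_isBoundedUnder_le (h2.isBoundedUnder_le)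
  rw [Finset.sum_const_zero] at this
  exact this

end

section

open Derivative CongruenceSubgroup

/-! ### The theta multiplier -/

lemma even_of_mem_Gamma0 {γ : SL(2, ℤ)} (hγ : γ ∈ Gamma0 4) : (4 : ℤ) ∣ γ 1 0 := by
  rw [Gamma0_mem] at hγ
  exact (ZMod.intCast_zmod_eq_zero_iff_dvd _ _).1 hγ

lemma isCoprime_bottom_row (γ : SL(2, ℤ)) : IsCoprime (γ 1 0) (γ 1 1) :=
  ModularGroup.bottom_row_coprime γ

lemma odd_of_mem_Gamma0 {γ : SL(2, ℤ)} (hγ : γ ∈ Gamma0 4) : Odd (γ 1 1) := by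
  by_contra h
  rw [Int.not_odd_iff_even] at h
  have h1 : (2 : ℤ) ∣ γ 1 0 := dvd_trans ⟨2, rfl⟩ (even_of_mem_Gamma0 hγ)
  have := (isCoprime_bottom_row γ).isUnit_of_dvd' h1 h.two_dvd
  exact absurd (Int.isUnit_iff.1 this) (by decide)

lemma kronecker_sq {c d : ℤ} (h : IsCoprime c d) : kronecker c d ^ 2 = 1 := by
  have h1 : jacobiSym c d.natAbs ^ 2 = 1 := by
    refine jacobiSym.sq_one ?_
    rw [show Int.gcd c (d.natAbs : ℤ) = Int.gcd c d by simp [Int.gcd, Int.natAbs_abs]]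
    exact Int.isCoprime_iff_gcd_eq_one.1 h
  rw [kronecker, mul_pow, h1]
  split_ifs <;> norm_num

/-- For positive odd n, (-4/n) = (-1/n)(2/n)² = χ₄(n). For negative d the sign built into
`kronecker` is the value χ₄(-1) = -1. -/
lemma kronecker_neg_four {d : ℤ} (hd : Odd d) : kronecker (-4) d = ZMod.χ₄ d := by
  have key : ∀ n : ℕ, Odd n → jacobiSym (-4) n = ZMod.χ₄ n := by
    intro n hn
    have h2 : jacobiSym (2 ^ 2) n = 1 := by
      refine jacobiSym.sq_one' ?_
      exact_mod_cast Nat.coprime_two_left.2 hn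
    rw [show (-4 : ℤ) = -(2 ^ 2) by norm_num, jacobiSym.neg _ hn, h2, mul_one]
  have hodd : Odd d.natAbs := Int.natAbs_odd.2 hd
  rw [kronecker, key _ hodd]
  rcases le_or_gt 0 d with h | h
  · lift d to ℕ using h
    simp
  · obtain ⟨n, rfl⟩ : ∃ n : ℕ, d = -(n : ℤ) := ⟨d.natAbs, by omega⟩
    have : (-(n : ℤ)) < 0 := h
    simp only [Int.natAbs_neg, Int.natAbs_natCast, this, and_true, Int.reduceNeg, Int.reduceLT,
      if_true]
    push_cast
    have : ∀ x : ZMod 4, -1 * ZMod.χ₄ x = ZMod.χ₄ (-x) := by decide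
    exact this _

lemma chi_four_eq_one_or_neg_one {d : ℤ} (hd : Odd d) :
    ZMod.χ₄ d = 1 ∨ ZMod.χ₄ d = -1 := by
  rw [ZMod.χ₄_int_eq_if_mod_four]
  split_ifs <;> simp
  rcases hd with ⟨k, hk⟩; omega

/-- The constant `(c/d) (-4/d)^(k+1/2)` of `halfSlash`. -/
def thetaMultiplier (k : ℕ) (γ : SL(2, ℤ)) : ℂ :=
  (kronecker (γ 1 0) (γ 1 1) : ℂ) * (kronecker (-4) (γ 1 1) : ℂ) ^ ((k : ℂ) + 1 / 2)

lemma halfSlash_eq (k : ℕ) (f : ℍ → ℂ) (γ : SL(2, ℤ)) :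
    halfSlash k f γ = thetaMultiplier k γ • weightTranslate ((k : ℝ) + 1 / 2) f γ := by
  ext z
  rw [← cuspTranslate_eq]
  simp only [halfSlash, cuspTranslate, thetaMultiplier, Pi.smul_apply, smul_eq_mul, mul_assoc]

lemma kronecker_neg_four_eq {γ : SL(2, ℤ)} (hγ : γ ∈ Gamma0 4) :
    kronecker (-4) (γ 1 1) = 1 ∨ kronecker (-4) (γ 1 1) = -1 := by
  rw [kronecker_neg_four (odd_of_mem_Gamma0 hγ)]
  exact chi_four_eq_one_or_neg_one (odd_of_mem_Gamma0 hγ)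

lemma kronecker_neg_four_ne_zero {γ : SL(2, ℤ)} (hγ : γ ∈ Gamma0 4) :
    (kronecker (-4) (γ 1 1) : ℂ) ≠ 0 := by
  rcases kronecker_neg_four_eq hγ with h | h <;> simp [h]

lemma kronecker_complex_sq (γ : SL(2, ℤ)) : (kronecker (γ 1 0) (γ 1 1) : ℂ) ^ 2 = 1 := by
  exact_mod_cast kronecker_sq (isCoprime_bottom_row γ)

lemma thetaMultiplier_eq (k : ℕ) {γ : SL(2, ℤ)} (hγ : γ ∈ Gamma0 4) :
    thetaMultiplier k γ = thetaMultiplier 0 γ * (kronecker (-4) (γ 1 1) : ℂ) ^ k := by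
  rw [thetaMultiplier, thetaMultiplier, add_comm, Complex.cpow_add _ _ (kronecker_neg_four_ne_zero hγ),
    Complex.cpow_natCast]
  simp [mul_assoc]

lemma thetaMultiplier_zero_sq (γ : SL(2, ℤ)) :
    thetaMultiplier 0 γ ^ 2 = (kronecker (-4) (γ 1 1) : ℂ) := by
  rw [thetaMultiplier, mul_pow, kronecker_complex_sq, one_mul, ← Complex.cpow_nat_mul]
  norm_num

/-- The square of (c/d)(-4/d)^(1/2) is (-4/d) = ±1. This is what makes fourth powers of forms
invariant in the ordinary sense. -/
lemma thetaMultiplier_pow_four (k : ℕ) {γ : SL(2, ℤ)} (hγ : γ ∈ Gamma0 4) :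
    thetaMultiplier k γ ^ 4 = 1 := by
  rw [thetaMultiplier_eq k hγ, mul_pow, show thetaMultiplier 0 γ ^ 4 = (thetaMultiplier 0 γ ^ 2) ^ 2 by
    ring, thetaMultiplier_zero_sq, ← pow_mul, mul_comm k 4, pow_mul]
  rcases kronecker_neg_four_eq hγ with h | h <;> rw [h] <;> norm_num

lemma ne_zero_of_pow_four {u : ℂ} (hu : u ^ 4 = 1) : u ≠ 0 := by
  rintro rfl; norm_num at hu

lemma norm_of_pow_four {u : ℂ} (hu : u ^ 4 = 1) : ‖u‖ = 1 :=
  Complex.norm_eq_one_of_pow_eq_one hu (by norm_num)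

/-- The entry d is prime to 4, and the fourth power of any unit modulo 4 is 1. -/
lemma character_pow_four (χ : DirichletCharacter ℂ 4) {γ : SL(2, ℤ)} (hγ : γ ∈ Gamma0 4) :
    χ ((γ 1 1 : ℤ) : ZMod 4) ^ 4 = 1 := by
  rw [← map_pow]
  have h1 : ∀ x : ZMod 4, IsUnit x → x ^ 4 = 1 := by decide
  rw [h1 _ ?_, map_one]
  have := (isCoprime_bottom_row γ)
  have h4 : IsCoprime (4 : ℤ) (γ 1 1) := this.of_isCoprime_of_dvd_left (even_of_mem_Gamma0 hγ)
  obtain ⟨a, b, hab⟩ := h4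
  refine IsUnit.of_mul_eq_one ((b : ℤ) : ZMod 4) ?_
  have := congrArg (fun x : ℤ => (x : ZMod 4)) hab
  have h40 : (4 : ZMod 4) = 0 := by decide
  push_cast at this
  rw [h40, mul_zero, zero_add] at this
  rw [mul_comm]; exact this

/-! ### Forms of weight `κ` up to fourth roots of unity -/

/-- Holomorphic functions on `ℍ` which transform under `Γ₀(4)` with weight `κ` up to fourth roots of
unity and are bounded at all cusps. -/
structure IsForm (κ : ℝ) (f : ℍ → ℂ) : Prop where
  mdiff : MDiff f
  inv : ∀ γ ∈ Gamma0 4, ∃ u : ℂ, u ^ 4 = 1 ∧ weightTranslate κ f γ = u • f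
  bdd : ∀ γ : SL(2, ℤ), IsBoundedAtImInfty (weightTranslate κ f γ)

/-- The forms in the sense of `IsForm` that vanish at all cusps. -/
structure IsCuspidal (κ : ℝ) (f : ℍ → ℂ) : Prop extends IsForm κ f where
  zero : ∀ γ : SL(2, ℤ), IsZeroAtImInfty (weightTranslate κ f γ)

lemma exists_root_of_halfSlash {k : ℕ} {χ : DirichletCharacter ℂ 4} {f : ℍ → ℂ} {γ : SL(2, ℤ)}
    (hγ : γ ∈ Gamma0 4) (h : halfSlash k f γ = χ ((γ 1 1 : ℤ) : ZMod 4) • f) :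
    ∃ u : ℂ, u ^ 4 = 1 ∧ weightTranslate ((k : ℝ) + 1 / 2) f γ = u • f := by
  have h4 := thetaMultiplier_pow_four k hγ
  refine ⟨(thetaMultiplier k γ)⁻¹ * χ ((γ 1 1 : ℤ) : ZMod 4), ?_, ?_⟩
  · rw [mul_pow, inv_pow, h4, character_pow_four χ hγ]; simp
  · rw [mul_smul, ← h, halfSlash_eq, smul_smul, inv_mul_cancel₀ (ne_zero_of_pow_four h4), one_smul]

lemma isForm_of_mem_halfModularForms {k : ℕ} {χ : DirichletCharacter ℂ 4} {f : ℍ → ℂ}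
    (hf : f ∈ halfModularForms k χ) : IsForm ((k : ℝ) + 1 / 2) f where
  mdiff := hf.1
  inv γ hγ := exists_root_of_halfSlash hγ (hf.2.1 γ hγ)
  bdd γ := by rw [← cuspTranslate_eq]; exact hf.2.2 γ

lemma isCuspidal_of_mem_halfCuspForms {k : ℕ} {χ : DirichletCharacter ℂ 4} {f : ℍ → ℂ}
    (hf : f ∈ halfCuspForms k χ) : IsCuspidal ((k : ℝ) + 1 / 2) f where
  mdiff := hf.1
  inv γ hγ := exists_root_of_halfSlash hγ (hf.2.1 γ hγ)
  bdd γ := by rw [← cuspTranslate_eq]; exact (hf.2.2 γ).isBoundedAtImInfty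
  zero γ := by rw [← cuspTranslate_eq]; exact hf.2.2 γ

lemma isCuspidal_of_mem_integralCuspForms {K : ℕ} {χ : DirichletCharacter ℂ 4} {f : ℍ → ℂ}
    (hf : f ∈ integralCuspForms K χ) : IsCuspidal (K : ℝ) f where
  mdiff := hf.1
  inv γ hγ := ⟨_, character_pow_four χ hγ, by rw [← slash_eq_weightTranslate]; exact hf.2.1 γ hγ⟩
  bdd γ := by rw [← slash_eq_weightTranslate]; exact (hf.2.2 γ).isBoundedAtImInfty
  zero γ := by rw [← slash_eq_weightTranslate]; exact hf.2.2 γ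

lemma weightTranslate_pow_four {κ : ℝ} {w : ℕ} (hw : 4 * κ = w) (f : ℍ → ℂ) (γ : SL(2, ℤ)) :
    (f ^ 4) ∣[(w : ℤ)] γ = weightTranslate κ f γ ^ 4 := by
  rw [slash_eq_weightTranslate]
  ext z
  simp only [weightTranslate, Pi.pow_apply, mul_pow]
  rw [← Complex.cpow_nat_mul]
  congr 2
  have : ((4 : ℝ) : ℂ) * κ = (w : ℂ) := by rw [← Complex.ofReal_mul, hw]; simp
  push_cast at this ⊢
  rw [← this]; ring

lemma isCusp_SL2Z_of_Gamma0 {c : OnePoint ℝ} (hc : IsCusp c (Gamma0 4 : Subgroup (GL (Fin 2) ℝ))) :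
    IsCusp c (Matrix.SpecialLinearGroup.mapGL ℝ : SL(2, ℤ) →* GL (Fin 2) ℝ).range :=
  (Subgroup.IsArithmetic.isCusp_iff_isCusp_SL2Z _).1 hc

/-- The fourth power of a form as a modular form. -/
def IsForm.powFour {κ : ℝ} {f : ℍ → ℂ} (hf : IsForm κ f) {w : ℕ} (hw : 4 * κ = w) :
    ModularForm (Gamma0 4 : Subgroup (GL (Fin 2) ℝ)) (w : ℤ) where
  toFun := f ^ 4
  slash_action_eq' := by
    rintro _ ⟨γ, hγ, rfl⟩
    change (f ^ 4) ∣[(w : ℤ)] γ = _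
    obtain ⟨u, hu, h⟩ := hf.inv γ hγ
    rw [weightTranslate_pow_four hw, h, smul_pow, hu, one_smul]
  holo' := hf.mdiff.pow 4
  bdd_at_cusps' hc := by
    rw [OnePoint.isBoundedAt_iff_forall_SL2Z (isCusp_SL2Z_of_Gamma0 hc)]
    intro γ _
    rw [weightTranslate_pow_four hw]
    have h := Asymptotics.IsBigO.pow (hf.bdd γ) 4
    refine h.congr_right fun z => ?_
    simp

/-- The fourth power of a cuspidal form as a cusp form. -/
def IsCuspidal.powFour {κ : ℝ} {f : ℍ → ℂ} (hf : IsCuspidal κ f) {w : ℕ} (hw : 4 * κ = w) :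
    CuspForm (Gamma0 4 : Subgroup (GL (Fin 2) ℝ)) (w : ℤ) where
  toSlashInvariantForm := (hf.toIsForm.powFour hw).toSlashInvariantForm
  holo' := hf.mdiff.pow 4
  zero_at_cusps' hc := by
    rw [OnePoint.isZeroAt_iff_forall_SL2Z (isCusp_SL2Z_of_Gamma0 hc)]
    intro γ _
    change IsZeroAtImInfty ((f ^ 4) ∣[(w : ℤ)] γ)
    rw [weightTranslate_pow_four hw]
    have h := Filter.Tendsto.pow (hf.zero γ) 4
    rw [zero_pow (by norm_num)] at h
    exact h

/-- The standard bound for the cusp form f⁴ of weight 4κ, followed by a fourth root. -/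
lemma IsCuspidal.exists_bound {κ : ℝ} {f : ℍ → ℂ} (hf : IsCuspidal κ f) {w : ℕ} (hw : 4 * κ = w) :
    ∃ C, 0 ≤ C ∧ ∀ z : ℍ, ‖f z‖ ≤ C * z.im ^ (-(κ / 2)) := by
  obtain ⟨C, hC⟩ := CuspFormClass.exists_bound (hf.powFour hw)
  have hC' : ∀ z : ℍ, ‖f z‖ ^ 4 ≤ C / z.im ^ ((w : ℝ) / 2) := fun z => by
    have := hC z
    rw [Int.cast_natCast] at this
    rw [← norm_pow]; exact this
  have hC0 : 0 ≤ C := by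
    have h := (pow_nonneg (norm_nonneg _) 4).trans (hC' UpperHalfPlane.I)
    simpa using h
  refine ⟨C ^ (1 / 4 : ℝ), by positivity, fun z => ?_⟩
  have hz := z.im_pos
  refine le_of_pow_le_pow_left₀ (n := 4) (by norm_num) (by positivity) ?_
  refine (hC' z).trans_eq ?_
  rw [mul_pow, ← Real.rpow_natCast, ← Real.rpow_mul hC0, ← Real.rpow_natCast (z.im ^ _),
    ← Real.rpow_mul hz.le, div_eq_mul_inv, ← Real.rpow_neg hz.le, ← hw]
  norm_num
  left
  congr 1
  ring

end

section

open Derivative CongruenceSubgroup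

/-! ### Periodicity, Fourier expansions and finite dimension -/

lemma T_mem_Gamma0 : ModularGroup.T ∈ Gamma0 4 := by
  rw [Gamma0_mem]
  simp [ModularGroup.T]

lemma autFactor_T (z : ℍ) : autFactor ModularGroup.T z = 1 := by
  simp [autFactor, ModularGroup.T]

lemma weightTranslate_T (κ : ℝ) (f : ℍ → ℂ) (z : ℍ) :
    weightTranslate κ f ModularGroup.T z = f (ModularGroup.T • z) := by
  simp [weightTranslate, autFactor_T]

lemma kronecker_T : kronecker (ModularGroup.T 1 0) (ModularGroup.T 1 1) = 1 ∧
    kronecker (-4) (ModularGroup.T 1 1) = 1 := by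
  simp [ModularGroup.T, kronecker]

lemma T_smul_of_halfSlash {k : ℕ} {χ : DirichletCharacter ℂ 4} {f : ℍ → ℂ}
    (h : ∀ γ ∈ Gamma0 4, halfSlash k f γ = χ ((γ 1 1 : ℤ) : ZMod 4) • f) (z : ℍ) :
    f (ModularGroup.T • z) = f z := by
  have h1 := congrFun (h _ T_mem_Gamma0) z
  rw [halfSlash_eq, Pi.smul_apply, weightTranslate_T, thetaMultiplier, kronecker_T.1,
    kronecker_T.2] at h1
  simpa [ModularGroup.T] using h1

lemma T_smul_of_slash {K : ℕ} {χ : DirichletCharacter ℂ 4} {f : ℍ → ℂ}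
    (h : ∀ γ ∈ Gamma0 4, f ∣[(K : ℤ)] γ = χ ((γ 1 1 : ℤ) : ZMod 4) • f) (z : ℍ) :
    f (ModularGroup.T • z) = f z := by
  have h1 := congrFun (h _ T_mem_Gamma0) z
  rw [slash_eq_weightTranslate, weightTranslate_T] at h1
  simpa [ModularGroup.T] using h1

lemma periodic_comp_ofComplex {f : ℍ → ℂ} (h : ∀ z, f (ModularGroup.T • z) = f z) :
    Function.Periodic (f ∘ ofComplex) (1 : ℝ) := by
  intro w
  by_cases hw : 0 < w.im
  · have hw' : 0 < (w + (1 : ℝ)).im := by simpa using hw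
    simp only [Function.comp_apply, ofComplex_apply_of_im_pos hw, ofComplex_apply_of_im_pos hw']
    rw [← h ⟨w, hw⟩]
    congr 1
    ext
    have := ModularGroup.coe_T_zpow_smul_eq (z := ⟨w, hw⟩) (n := 1)
    rw [zpow_one] at this
    rw [this]
    simp
  · have hw' : ¬ 0 < (w + (1 : ℝ)).im := by simpa using hw
    simp only [Function.comp_apply, ofComplex_apply_of_im_nonpos (not_lt.1 hw),
      ofComplex_apply_of_im_nonpos (not_lt.1 hw')]

lemma qParam_one (z : ℍ) : Function.Periodic.qParam 1 z = qOf z := by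
  simp [Function.Periodic.qParam, qOf]

lemma norm_qOf (z : ℍ) : ‖qOf z‖ = Real.exp (-2 * Real.pi * z.im) := by
  rw [qOf, Complex.norm_exp]
  congr 1
  simp

lemma IsForm.bdd_one {κ : ℝ} {f : ℍ → ℂ} (hf : IsForm κ f) : IsBoundedAtImInfty f := by
  have := hf.bdd 1
  have h1 : weightTranslate κ f 1 = f := by ext z; simp [weightTranslate, autFactor]
  rwa [h1] at this

lemma IsCuspidal.zero_one {κ : ℝ} {f : ℍ → ℂ} (hf : IsCuspidal κ f) : IsZeroAtImInfty f := by
  have := hf.zero 1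
  have h1 : weightTranslate κ f 1 = f := by ext z; simp [weightTranslate, autFactor]
  rwa [h1] at this

lemma hasSum_fourier {f : ℍ → ℂ} (hf : MDiff f) (hT : ∀ z, f (ModularGroup.T • z) = f z)
    (hb : IsBoundedAtImInfty f) (z : ℍ) :
    HasSum (fun m : ℕ => (qExpansion 1 f).coeff m * qOf z ^ m) (f z) := by
  have := hasSum_qExpansion one_pos (periodic_comp_ofComplex hT) hf hb z
  simpa only [qParam_one, smul_eq_mul] using this

lemma fourier_coeff_unique {f : ℍ → ℂ} (hf : MDiff f) (hT : ∀ z, f (ModularGroup.T • z) = f z)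
    (hb : IsBoundedAtImInfty f) {c : ℕ → ℂ}
    (hc : ∀ z : ℍ, HasSum (fun m : ℕ => c m * qOf z ^ m) (f z)) (m : ℕ) :
    c m = (qExpansion 1 f).coeff m := by
  have han := analyticAt_cuspFunction_zero one_pos (periodic_comp_ofComplex hT) hf hb
  have hc' : ∀ z : ℍ, HasSum (fun m : ℕ => c m • Function.Periodic.qParam 1 z ^ m) (f z) :=
    fun z => by simpa only [qParam_one, smul_eq_mul] using hc z
  have h1 := (hasFPowerSeriesOnBall_cuspFunction one_pos han hc').hasFPowerSeriesAt
  have h2 := (hasFPowerSeriesOnBall_cuspFunction one_pos han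
    (hasSum_qExpansion one_pos (periodic_comp_ofComplex hT) hf hb)).hasFPowerSeriesAt
  simpa using congr_arg (FormalMultilinearSeries.coeff · m) (h1.eq_formalMultilinearSeries h2)

/-- The factor |q|^N is taken out of every surviving term, and what remains is dominated by the
absolutely convergent series at z = i. -/
lemma norm_le_of_coeff_eq_zero {f : ℍ → ℂ} {c : ℕ → ℂ}
    (hc : ∀ z : ℍ, HasSum (fun m : ℕ => c m * qOf z ^ m) (f z)) {N : ℕ} (h0 : ∀ m < N, c m = 0) :
    ∃ C, ∀ z : ℍ, 1 ≤ z.im → ‖f z‖ ≤ C * Real.exp (-2 * Real.pi * z.im) ^ N := by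
  have hs := ((hc UpperHalfPlane.I).summable.norm)
  simp only [norm_mul, norm_pow, norm_qOf, I_im, mul_one] at hs
  set ρ := Real.exp (-2 * Real.pi) with hρ
  have hρ0 : 0 < ρ := Real.exp_pos _
  refine ⟨ρ⁻¹ ^ N * ∑' m, ‖c m‖ * ρ ^ m, fun z hz => ?_⟩
  have hq : Real.exp (-2 * Real.pi * z.im) ≤ ρ := by
    rw [hρ]; refine Real.exp_le_exp.2 ?_; nlinarith [Real.pi_pos]
  set x := Real.exp (-2 * Real.pi * z.im) with hx
  have hx0 : 0 < x := Real.exp_pos _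
  have hle : ∀ m, ‖c m * qOf z ^ m‖ ≤ ρ⁻¹ ^ N * x ^ N * (‖c m‖ * ρ ^ m) := by
    intro m
    rw [norm_mul, norm_pow, norm_qOf]
    rcases lt_or_ge m N with h | h
    · simp [h0 m h]
    · obtain ⟨j, rfl⟩ := Nat.exists_eq_add_of_le h
      calc ‖c (N + j)‖ * x ^ (N + j) = x ^ N * (‖c (N + j)‖ * x ^ j) := by ring
        _ ≤ x ^ N * (‖c (N + j)‖ * ρ ^ j) := by gcongr
        _ = _ := by rw [pow_add, inv_pow]; field_simp
  have h1 := tsum_of_norm_bounded (hs.mul_left (ρ⁻¹ ^ N * x ^ N)).hasSum hle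
  rw [(hc z).tsum_eq, tsum_mul_left] at h1
  calc _ ≤ _ := h1
    _ = _ := by ring

/-- The coefficient is an integral over a horizontal segment at any height t. For m < N the decay
makes it O(e^(-2πt)), and t tends to infinity. -/
lemma qExpansion_coeff_eq_zero_of_decay {F : ℍ → ℂ} (hF : MDiff F)
    (hT : Function.Periodic (F ∘ ofComplex) (1 : ℝ)) (hb : IsBoundedAtImInfty F) {N : ℕ} {C A : ℝ}
    (h : ∀ z : ℍ, A ≤ z.im → ‖F z‖ ≤ C * Real.exp (-2 * Real.pi * z.im) ^ N) {m : ℕ} (hm : m < N) :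
    (qExpansion 1 F).coeff m = 0 := by
  have key : ∀ t : ℝ, max A 1 ≤ t →
      ‖(qExpansion 1 F).coeff m‖ ≤ C * Real.exp (-2 * Real.pi * t) := by
    intro t ht
    have ht0 : 0 < t := lt_of_lt_of_le one_pos ((le_max_right _ _).trans ht)
    have hC : 0 ≤ C := by
      have := (norm_nonneg _).trans (h ⟨Complex.I * t, by simpa using ht0⟩
        (by simpa using (le_max_left A 1).trans ht))
      exact nonneg_of_mul_nonneg_left this (by positivity)
    rw [qExpansion_coeff_eq_intervalIntegral one_pos hT hF hb m ht0]
    simp only [one_mul, Complex.ofReal_one, ne_eq, one_ne_zero, not_false_eq_true, div_self]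
    have := intervalIntegral.norm_integral_le_of_norm_le_const (a := 0) (b := 1)
      (C := C * Real.exp (-2 * Real.pi * t)) (f := fun u : ℝ =>
        1 / Function.Periodic.qParam 1 (u + t * Complex.I) ^ m *
          F ⟨u + t * Complex.I, by simpa using ht0⟩) ?_
    · simpa using this
    · intro u _
      set z : ℍ := ⟨u + t * Complex.I, by simpa using ht0⟩ with hz
      have him : z.im = t := by simp [hz, UpperHalfPlane.im]
      have h1 := h z (by rw [him]; exact (le_max_left _ _).trans ht)
      have h2 : Function.Periodic.qParam 1 (u + t * Complex.I) = qOf z := qParam_one z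
      rw [h2, norm_mul, norm_div, norm_one, norm_pow, norm_qOf]
      rw [him] at h1 ⊢
      set x := Real.exp (-2 * Real.pi * t)
      have hx0 : 0 < x := Real.exp_pos _
      have hx1 : x ≤ 1 := Real.exp_le_one_iff.2 (by nlinarith [Real.pi_pos])
      obtain ⟨j, rfl⟩ := Nat.exists_eq_add_of_lt hm
      calc 1 / x ^ m * ‖F z‖ ≤ 1 / x ^ m * (C * x ^ (m + j + 1)) := by gcongr
        _ = C * (x ^ j * x) := by rw [pow_succ, pow_add]; field_simp
        _ ≤ C * (1 * x) := by gcongr; exact pow_le_one₀ hx0.le hx1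
        _ = C * x := by ring
  have hlim : Filter.Tendsto (fun t : ℝ => C * Real.exp (-2 * Real.pi * t)) Filter.atTop
      (nhds (C * 0)) := by
    refine Filter.Tendsto.const_mul _ (Real.tendsto_exp_atBot.comp ?_)
    exact Filter.tendsto_id.const_mul_atTop_of_neg (by linarith [Real.pi_pos])
  rw [mul_zero] at hlim
  exact norm_le_zero_iff.1 (ge_of_tendsto hlim (Filter.eventually_atTop.2 ⟨_, key⟩))

lemma isBoundedAtImInfty_prod {ι : Type*} (s : Finset ι) (F : ι → ℍ → ℂ)
    (h : ∀ i, IsBoundedAtImInfty (F i)) : IsBoundedAtImInfty (∏ i ∈ s, F i) := by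
  classical
  induction s using Finset.induction_on with
  | empty => exact Filter.const_boundedAtFilter atImInfty (1 : ℂ)
  | insert a s ha ih => rw [Finset.prod_insert ha]; exact (h a).mul ih

/-- A form with sufficiently many vanishing Fourier coefficients is zero. -/
lemma exists_sturm_bound {κ : ℝ} {w : ℕ} (hw : 4 * κ = w) : ∃ N : ℕ, ∀ f : ℍ → ℂ, IsForm κ f →
    (∀ z, f (ModularGroup.T • z) = f z) → (∀ m < N, (qExpansion 1 f).coeff m = 0) → f = 0 := by
  set Γ : Subgroup (GL (Fin 2) ℝ) := (Gamma0 4).map (Matrix.SpecialLinearGroup.mapGL ℝ)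
  set S : Subgroup (GL (Fin 2) ℝ) :=
    (Matrix.SpecialLinearGroup.mapGL ℝ : SL(2, ℤ) →* GL (Fin 2) ℝ).range
  set W : ℤ := (w : ℤ) * Nat.card (S ⧸ Γ.subgroupOf S)
  refine ⟨W.toNat / 12 + 1, fun f hf hT h0 => ?_⟩
  set N := W.toNat / 12 + 1
  obtain ⟨C, hC⟩ := norm_le_of_coeff_eq_zero (hasSum_fourier hf.mdiff hT hf.bdd_one) h0
  -- The norm of f⁴ to level one is the product of its translates over the cosets, a form of weight
  -- W. The trivial coset contributes f⁴, which decays like |q|^(4N), and the other factors are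
  -- bounded at i∞.
  set F := ModularForm.norm S (hf.powFour hw) with hFdef
  let _ := Fintype.ofFinite (S ⧸ Γ.subgroupOf S)
  have hb : ∀ q : S ⧸ Γ.subgroupOf S,
      IsBoundedAtImInfty (SlashInvariantForm.quotientFunc (hf.powFour hw) q) := by
    refine Quotient.forall.mpr fun ⟨r, hr⟩ => ?_
    obtain ⟨γ, rfl⟩ := hr
    rw [SlashInvariantForm.quotientFunc_mk]
    have hinv : (Matrix.SpecialLinearGroup.mapGL ℝ γ)⁻¹ =
      Matrix.SpecialLinearGroup.mapGL ℝ γ⁻¹ := (map_inv _ _).symm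
    have heq : (⇑(hf.powFour hw)) ∣[(w : ℤ)] (Matrix.SpecialLinearGroup.mapGL ℝ γ)⁻¹ =
        weightTranslate κ f γ⁻¹ ^ 4 := by
      rw [hinv]
      exact weightTranslate_pow_four hw f γ⁻¹
    rw [heq]
    have h := Asymptotics.IsBigO.pow (hf.bdd γ⁻¹) 4
    refine h.congr_right fun z => ?_
    simp
  classical
  have hF : (F : ℍ → ℂ) = f ^ 4 * ∏ q ∈ Finset.univ.erase (⟦1⟧ : S ⧸ Γ.subgroupOf S),
      SlashInvariantForm.quotientFunc (hf.powFour hw) q := by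
    refine (ModularForm.coe_norm S (hf.powFour hw)).trans ?_
    refine (Finset.mul_prod_erase Finset.univ (fun q : S ⧸ Γ.subgroupOf S =>
      SlashInvariantForm.quotientFunc (hf.powFour hw) q) (Finset.mem_univ ⟦1⟧)).symm.trans ?_
    have h1 : SlashInvariantForm.quotientFunc (hf.powFour hw) (⟦1⟧ : S ⧸ Γ.subgroupOf S) = f ^ 4 := by
      rw [SlashInvariantForm.quotientFunc_mk, Subgroup.coe_one, inv_one, SlashAction.slash_one]
      rfl
    simp only [h1]
    congr!
  have hG := isBoundedAtImInfty_prod (Finset.univ.erase (⟦1⟧ : S ⧸ Γ.subgroupOf S)) _ hb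
  obtain ⟨M, A, hM⟩ := isBoundedAtImInfty_iff.1 hG
  have hdecay : ∀ z : ℍ, max A 1 ≤ z.im →
      ‖F z‖ ≤ (C ^ 4 * M) * Real.exp (-2 * Real.pi * z.im) ^ (4 * N) := by
    intro z hz
    have h1 := hC z ((le_max_right _ _).trans hz)
    have h2 := hM z ((le_max_left _ _).trans hz)
    rw [hF, Pi.mul_apply, norm_mul, Pi.pow_apply, norm_pow]
    calc _ ≤ (C * Real.exp (-2 * Real.pi * z.im) ^ N) ^ 4 * M := by gcongr
      _ = _ := by rw [mul_pow, ← pow_mul]; ring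
  have hF0 : F = 0 := by
    -- Order greater than W/12 forces a level one form to vanish. The choice of N gives order at
    -- least N > W/12, although the decay is even of order 4N.
    refine ModularForm.sturm_bound_levelOne (k := W) ?_
    refine lt_of_lt_of_le (b := ((N : ℕ) : ℕ∞)) (by exact_mod_cast Nat.lt_succ_self _) ?_
    refine PowerSeries.nat_le_order _ _ fun m hm => ?_
    refine qExpansion_coeff_eq_zero_of_decay (ModularFormClass.holo F)
      (SlashInvariantFormClass.periodic_comp_ofComplex F one_mem_strictPeriods_SL) ?_ hdecay (by omega)
    exact ModularFormClass.bdd_at_infty F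
  have h4 := (ModularForm.norm_eq_zero_iff S (f := hf.powFour hw)).1 hF0
  ext z
  have := congrFun h4 z
  exact pow_eq_zero_iff (n := 4) (by norm_num) |>.1 this

/-- By the Sturm bound the first N Fourier coefficients determine the form. -/
instance finiteDimensional_halfCuspForms (k : ℕ) (χ : DirichletCharacter ℂ 4) :
    FiniteDimensional ℂ (halfCuspForms k χ) := by
  obtain ⟨N, hN⟩ := exists_sturm_bound (κ := (k : ℝ) + 1 / 2) (w := 4 * k + 2) (by push_cast; ring)
  have han : ∀ f : halfCuspForms k χ, AnalyticAt ℂ (cuspFunction 1 (f : ℍ → ℂ)) 0 := fun f =>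
    analyticAt_cuspFunction_zero one_pos (periodic_comp_ofComplex (T_smul_of_halfSlash f.2.2.1))
      f.2.1 (isCuspidal_of_mem_halfCuspForms f.2).toIsForm.bdd_one
  let L : halfCuspForms k χ →ₗ[ℂ] (Fin N → ℂ) :=
    { toFun := fun f m => (qExpansion 1 (f : ℍ → ℂ)).coeff m
      map_add' := fun f g => by
        ext m
        simp only [Submodule.coe_add, Pi.add_apply]
        rw [qExpansion_add (han f) (han g), map_add]
      map_smul' := fun c f => by
        ext m
        simp only [Submodule.coe_smul, Pi.smul_apply, RingHom.id_apply]
        rw [qExpansion_smul (han f), PowerSeries.coeff_smul] }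
  refine FiniteDimensional.of_injective L ?_
  rw [← LinearMap.ker_eq_bot, LinearMap.ker_eq_bot']
  intro f hf
  refine Subtype.ext (hN f (isCuspidal_of_mem_halfCuspForms f.2).toIsForm
    (T_smul_of_halfSlash f.2.2.1) fun m hm => ?_)
  exact congrFun hf ⟨m, hm⟩

end

section

open MeasureTheory Set

/-! ### The invariant measure in coordinates -/

/-- The point `x + iy` of `ℍ` (for `y > 0`). -/
def pt (x y : ℝ) : ℍ := ofComplex (x + y * Complex.I)

lemma coe_pt {x y : ℝ} (hy : 0 < y) : (pt x y : ℂ) = x + y * Complex.I := by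
  rw [pt, ofComplex_apply_of_im_pos (by simpa using hy)]

lemma im_pt {x y : ℝ} (hy : 0 < y) : (pt x y).im = y := by
  rw [← coe_im, coe_pt hy]; simp

lemma re_pt {x y : ℝ} (hy : 0 < y) : (pt x y).re = x := by
  rw [← coe_re, coe_pt hy]; simp

lemma measurable_ofComplex : Measurable (ofComplex : ℂ → ℍ) := by
  rw [measurableEmbedding_coe.measurable_comp_iff.symm]
  have : UpperHalfPlane.coe ∘ (ofComplex : ℂ → ℍ) =
      fun w => if 0 < w.im then w else ((ofComplex 0 : ℍ) : ℂ) := by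
    ext w
    split_ifs with h
    · simp [ofComplex_apply_of_im_pos h]
    · simp [ofComplex_apply_of_im_nonpos (not_lt.1 h), ofComplex_apply_of_im_nonpos (w := 0)]
  rw [this]
  exact Measurable.ite (measurableSet_lt measurable_const Complex.measurable_im) measurable_id
    measurable_const

lemma measurable_pt : Measurable fun p : ℝ × ℝ => pt p.1 p.2 :=
  measurable_ofComplex.comp (by fun_prop)

/-- The measure `dy / y²` on `(0, ∞)`. -/
def heightMeasure : Measure ℝ :=
  (volume.restrict (Ioi 0)).withDensity fun y => ENNReal.ofReal ((y ^ 2)⁻¹)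

instance : SFinite heightMeasure := by unfold heightMeasure; infer_instance

lemma lintegral_heightMeasure (φ : ℝ → ENNReal) :
    ∫⁻ y, φ y ∂heightMeasure = ∫⁻ y in Ioi 0, ENNReal.ofReal ((y ^ 2)⁻¹) * φ y := by
  rw [heightMeasure, lintegral_withDensity_eq_lintegral_mul_non_measurable₀]
  · rfl
  · exact (by fun_prop : Measurable fun y : ℝ => ENNReal.ofReal ((y ^ 2)⁻¹)).aemeasurable
  · simp

/-- The measure on ℍ is Lebesgue measure with density y^(-2), so this is Tonelli. The junk values of
`pt` for y ≤ 0 do no harm, since `heightMeasure` does not charge that half-line. -/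
lemma lintegral_volume_eq {φ : ℍ → ENNReal} (hφ : Measurable φ) :
    ∫⁻ z, φ z = ∫⁻ p, φ (pt p.1 p.2) ∂((volume : Measure ℝ).prod heightMeasure) := by
  set Ψ : ℂ → ENNReal := fun w => ENNReal.ofReal ((w.im ^ 2)⁻¹) * φ (ofComplex w) with hΨ
  have hΨm : Measurable Ψ := by
    have := hφ.comp measurable_ofComplex
    have h2 : Measurable fun w : ℂ => ENNReal.ofReal ((w.im ^ 2)⁻¹) := by fun_prop
    exact h2.mul this
  have hmp : MeasurePreserving UpperHalfPlane.coe (volume.comap UpperHalfPlane.coe)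
      (volume.restrict (.range UpperHalfPlane.coe)) :=
    ⟨measurable_coe, by rw [measurableEmbedding_coe.map_comap]⟩
  have h1 : ∫⁻ z, φ z = ∫⁻ z, Ψ (UpperHalfPlane.coe z) ∂(volume.comap UpperHalfPlane.coe) := by
    rw [volume_def, lintegral_withDensity_eq_lintegral_mul_non_measurable₀]
    · refine lintegral_congr fun z => ?_
      simp only [Pi.mul_apply, hΨ, ofComplex_apply]
      congr 1
      rw [ENNReal.ofReal, ENNReal.coe_inj]
      ext
      have : 0 ≤ z.im := z.im_pos.le
      simp [Real.coe_toNNReal', this]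
    · refine Measurable.aemeasurable ?_
      refine Measurable.coe_nnreal_ennreal ?_
      refine Measurable.pow_const ?_ 2
      refine Measurable.const_div ?_ 1
      exact (Measurable.subtype_mk (by fun_prop))
    · simp
  rw [h1, hmp.lintegral_comp_emb measurableEmbedding_coe]
  have hr : Set.range UpperHalfPlane.coe = {w : ℂ | 0 < w.im} := by
    exact UpperHalfPlane.range_coe
  rw [hr, ← lintegral_indicator (measurableSet_lt measurable_const Complex.measurable_im)]
  have h2 := Complex.volume_preserving_equiv_real_prod.symm.lintegral_comp
    (hΨm.indicator (measurableSet_lt measurable_const Complex.measurable_im :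
      MeasurableSet {w : ℂ | 0 < w.im}))
  rw [← h2, Measure.volume_eq_prod, lintegral_prod_symm, lintegral_prod_symm,
    lintegral_heightMeasure, ← lintegral_indicator measurableSet_Ioi]
  · refine lintegral_congr fun y => ?_
    by_cases hy : 0 < y
    · rw [indicator_of_mem (mem_Ioi.2 hy), ← lintegral_const_mul]
      · refine lintegral_congr fun x => ?_
        rw [indicator_of_mem (by simpa [Complex.measurableEquivRealProd_symm_apply] using hy)]
        simp only [hΨ, Complex.measurableEquivRealProd_symm_apply, pt]
        congr 3
        apply Complex.ext <;> simp
      · exact hφ.comp (measurable_pt.comp (by fun_prop))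
    · rw [indicator_of_notMem (by simpa using hy)]
      rw [← lintegral_zero (μ := (volume : Measure ℝ))]
      refine lintegral_congr fun x => ?_
      rw [indicator_of_notMem (by simpa [Complex.measurableEquivRealProd_symm_apply] using hy)]
  · exact (hφ.comp measurable_pt).aemeasurable
  · exact ((hΨm.indicator (measurableSet_lt measurable_const Complex.measurable_im)).comp
      Complex.measurableEquivRealProd.symm.measurable).aemeasurable

lemma measurePreserving_pt : MeasurePreserving (fun p : ℝ × ℝ => pt p.1 p.2)
    ((volume : Measure ℝ).prod heightMeasure) volume := by
  refine ⟨measurable_pt, ?_⟩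
  ext s hs
  rw [Measure.map_apply measurable_pt hs, ← lintegral_indicator_one hs,
    lintegral_volume_eq (measurable_one.indicator hs), ← lintegral_indicator_one (measurable_pt hs)]
  rfl

/-- On the fundamental domain y² ≥ 3/4, so it lies in a box of bounded width above y = 1/2, and
dy/y² is finite there. -/
lemma volume_fd_lt_top : volume ModularGroup.fd < ⊤ := by
  have hm : MeasurableSet ModularGroup.fd := ModularGroup.isClosed_fd.measurableSet
  rw [← measurePreserving_pt.measure_preimage hm.nullMeasurableSet]
  have hsub : (fun p : ℝ × ℝ => pt p.1 p.2) ⁻¹' ModularGroup.fd ⊆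
      -- The second piece absorbs the junk values of `pt` and is a null set.
      (Icc (-1) 1 ×ˢ Ioi (1 / 2)) ∪ (univ ×ˢ Iic 0) := by
    rintro ⟨x, y⟩ h
    rcases le_or_gt y 0 with hy | hy
    · exact Or.inr ⟨mem_univ _, hy⟩
    · left
      have h1 := ModularGroup.three_le_four_mul_im_sq_of_mem_fd h
      have h2 := h.2
      rw [re_pt hy] at h2
      rw [im_pt hy] at h1
      rw [abs_le] at h2
      exact ⟨⟨by linarith, by linarith⟩, by simp only [mem_Ioi]; nlinarith⟩
  refine lt_of_le_of_lt (measure_mono hsub) (lt_of_le_of_lt (measure_union_le _ _) ?_)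
  rw [Measure.prod_prod, Measure.prod_prod]
  have h0 : heightMeasure (Iic 0) = 0 := by
    rw [heightMeasure]
    have : (volume.restrict (Ioi (0 : ℝ))) (Iic 0) = 0 := by
      rw [Measure.restrict_apply measurableSet_Iic, inter_comm, Ioi_inter_Iic, Ioc_self,
        measure_empty]
    exact withDensity_absolutelyContinuous _ _ this
  have h1 : heightMeasure (Ioi (1 / 2)) < ⊤ := by
    rw [heightMeasure, withDensity_apply _ measurableSet_Ioi,
      Measure.restrict_restrict measurableSet_Ioi, Ioi_inter_Ioi]
    have hint : IntegrableOn (fun y : ℝ => (y ^ 2)⁻¹) (Ioi (1 / 2)) := by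
      have := integrableOn_Ioi_rpow_of_lt (a := -2) (by norm_num) (c := 1 / 2) (by norm_num)
      refine this.congr_fun (fun y hy => ?_) measurableSet_Ioi
      have hy' : (0 : ℝ) < y := lt_trans (by norm_num) hy
      simp only
      rw [Real.rpow_neg hy'.le, Real.rpow_ofNat]
    rw [max_eq_left (by norm_num : (0 : ℝ) ≤ 1 / 2)]
    exact hint.lintegral_lt_top
  rw [h0, mul_zero, add_zero]
  refine ENNReal.mul_lt_top ?_ h1
  simp

end

section

open MeasureTheory Set CongruenceSubgroup

/-! ### The Petersson product -/

/-- Needed for definiteness of the Petersson form: a continuous function that vanishes almost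
everywhere on an open set vanishes there. -/
instance : (volume : Measure ℍ).IsOpenPosMeasure := by
  have h := Measure.IsOpenPosMeasure.comap (volume : Measure ℂ) isOpenEmbedding_coe
  refine Measure.AbsolutelyContinuous.isOpenPosMeasure (μ := volume.comap UpperHalfPlane.coe) ?_
  rw [volume_def]
  refine withDensity_absolutelyContinuous' ?_ ?_
  · refine (Measurable.coe_nnreal_ennreal (Measurable.pow_const (Measurable.const_div ?_ 1)
      2)).aemeasurable
    exact Measurable.subtype_mk (by fun_prop)
  · refine Filter.Eventually.of_forall fun z => ?_
    have hz : (NNReal.mk z.im z.im_pos.le : NNReal) ≠ 0 := fun h0 =>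
      z.im_ne_zero (congrArg NNReal.toReal h0)
    exact ENNReal.coe_ne_zero.2 (pow_ne_zero 2 (div_ne_zero one_ne_zero hz))

/-- The integrand `f(z) conj(h(z)) Im(z)^κ` of the Petersson product. -/
def peterssonDensity (κ : ℝ) (f h : ℍ → ℂ) (z : ℍ) : ℂ :=
  f z * conj (h z) * ((z.im ^ κ : ℝ) : ℂ)

instance : Finite (SL(2, ℤ) ⧸ Gamma0 4) := Subgroup.finite_quotient_of_finiteIndex

instance : Fintype (SL(2, ℤ) ⧸ Gamma0 4) := Fintype.ofFinite _

lemma peterssonProduct_eq_sum (κ : ℝ) (f h : ℍ → ℂ) :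
    peterssonProduct κ f h = ∑ q : SL(2, ℤ) ⧸ Gamma0 4,
      ∫ z in ModularGroup.fd, peterssonDensity κ f h (q.out⁻¹ • z) := by
  rw [peterssonProduct, finsum_eq_sum_of_fintype]
  rfl

lemma continuous_SL_smul (γ : SL(2, ℤ)) : Continuous fun z : ℍ => γ • z :=
  continuous_const_smul (γ : GL (Fin 2) ℝ)

lemma continuous_peterssonDensity {κ : ℝ} {f h : ℍ → ℂ} (hf : Continuous f) (hh : Continuous h) :
    Continuous (peterssonDensity κ f h) := by
  refine (hf.mul (Complex.continuous_conj.comp hh)).mul (Complex.continuous_ofReal.comp ?_)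
  exact continuous_im.rpow_const fun z => Or.inl z.im_ne_zero

lemma norm_peterssonDensity (κ : ℝ) (f h : ℍ → ℂ) (z : ℍ) :
    ‖peterssonDensity κ f h z‖ = ‖f z‖ * ‖h z‖ * z.im ^ κ := by
  rw [peterssonDensity, norm_mul, norm_mul, RCLike.norm_conj, Complex.norm_real,
    Real.norm_of_nonneg (Real.rpow_nonneg z.im_pos.le _)]

lemma IsCuspidal.exists_density_bound {κ : ℝ} {w : ℕ} (hw : 4 * κ = w) {f h : ℍ → ℂ}
    (hf : IsCuspidal κ f) (hh : IsCuspidal κ h) :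
    ∃ C, ∀ z, ‖peterssonDensity κ f h z‖ ≤ C := by
  obtain ⟨A, hA, hf'⟩ := hf.exists_bound hw
  obtain ⟨B, hB, hh'⟩ := hh.exists_bound hw
  refine ⟨A * B, fun z => ?_⟩
  have hz := z.im_pos
  have h0 : z.im ^ (-(κ / 2)) * z.im ^ (-(κ / 2)) * z.im ^ κ = 1 := by
    rw [← Real.rpow_add hz, ← Real.rpow_add hz]
    ring_nf
    simp
  rw [norm_peterssonDensity]
  calc _ ≤ (A * z.im ^ (-(κ / 2))) * (B * z.im ^ (-(κ / 2))) * z.im ^ κ := by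
        gcongr
        · exact hf' z
        · exact hh' z
    _ = A * B * (z.im ^ (-(κ / 2)) * z.im ^ (-(κ / 2)) * z.im ^ κ) := by ring
    _ = A * B := by rw [h0, mul_one]

lemma integrableOn_peterssonDensity {κ : ℝ} {w : ℕ} (hw : 4 * κ = w) {f h : ℍ → ℂ}
    (hf : IsCuspidal κ f) (hh : IsCuspidal κ h) (δ : SL(2, ℤ)) :
    IntegrableOn (fun z => peterssonDensity κ f h (δ • z)) ModularGroup.fd := by
  obtain ⟨C, hC⟩ := hf.exists_density_bound hw hh
  refine IntegrableOn.of_bound volume_fd_lt_top ?_ C (Filter.Eventually.of_forall fun z => hC _)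
  exact ((continuous_peterssonDensity hf.mdiff.continuous hh.mdiff.continuous).comp
    (continuous_SL_smul δ)).aestronglyMeasurable

section Sesquilinear

variable {κ : ℝ} {w : ℕ} {f f' h h' : ℍ → ℂ}

lemma peterssonProduct_add_left (hw : 4 * κ = w) (hf : IsCuspidal κ f) (hf' : IsCuspidal κ f')
    (hh : IsCuspidal κ h) :
    peterssonProduct κ (f + f') h = peterssonProduct κ f h + peterssonProduct κ f' h := by
  simp only [peterssonProduct_eq_sum, ← Finset.sum_add_distrib]
  refine Finset.sum_congr rfl fun q _ => ?_
  rw [← integral_add (integrableOn_peterssonDensity hw hf hh _)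
    (integrableOn_peterssonDensity hw hf' hh _)]
  refine integral_congr_ae (Filter.Eventually.of_forall fun z => ?_)
  simp only [peterssonDensity, Pi.add_apply]
  ring

lemma peterssonProduct_smul_left (c : ℂ) :
    peterssonProduct κ (c • f) h = c * peterssonProduct κ f h := by
  simp only [peterssonProduct_eq_sum, Finset.mul_sum]
  refine Finset.sum_congr rfl fun q _ => ?_
  rw [← integral_const_mul]
  refine integral_congr_ae (Filter.Eventually.of_forall fun z => ?_)
  simp only [peterssonDensity, Pi.smul_apply, smul_eq_mul]
  ring

lemma conj_peterssonProduct : conj (peterssonProduct κ f h) = peterssonProduct κ h f := by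
  simp only [peterssonProduct_eq_sum, map_sum]
  refine Finset.sum_congr rfl fun q _ => ?_
  rw [← integral_conj]
  refine integral_congr_ae (Filter.Eventually.of_forall fun z => ?_)
  simp only [peterssonDensity, map_mul, Complex.conj_conj, Complex.conj_ofReal]
  ring

lemma peterssonDensity_self (z : ℍ) :
    peterssonDensity κ f f z = ((‖f z‖ ^ 2 * z.im ^ κ : ℝ) : ℂ) := by
  rw [peterssonDensity, Complex.mul_conj, Complex.normSq_eq_norm_sq]
  push_cast
  rfl

lemma peterssonProduct_self : peterssonProduct κ f f =
    ((∑ q : SL(2, ℤ) ⧸ Gamma0 4, ∫ z in ModularGroup.fd,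
      ‖f (q.out⁻¹ • z)‖ ^ 2 * (q.out⁻¹ • z).im ^ κ : ℝ) : ℂ) := by
  rw [peterssonProduct_eq_sum, Complex.ofReal_sum]
  refine Finset.sum_congr rfl fun q _ => ?_
  rw [← integral_complex_ofReal]
  exact integral_congr_ae (Filter.Eventually.of_forall fun z => peterssonDensity_self _)

lemma IsForm.eq_zero_smul (hf : IsForm κ f) {γ : SL(2, ℤ)} (hγ : γ ∈ Gamma0 4) {z : ℍ}
    (hz : f z = 0) : f (γ • z) = 0 := by
  obtain ⟨u, hu, h⟩ := hf.inv γ hγ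
  have := congrFun h z
  rw [weightTranslate, Pi.smul_apply, hz, smul_zero, mul_eq_zero, Complex.cpow_eq_zero_iff] at this
  exact this.resolve_left fun h' => autFactor_ne_zero γ z h'.1

/-- Every integral in the sum is nonnegative, hence zero. By continuity f vanishes on each translate
of the open fundamental domain, then on its closure, and the Γ₀(4)-images of these translates cover
ℍ. -/
lemma eq_zero_of_peterssonProduct_self (hw : 4 * κ = w) (hf : IsCuspidal κ f)
    (h0 : peterssonProduct κ f f = 0) : f = 0 := by
  rw [peterssonProduct_self, Complex.ofReal_eq_zero] at h0
  have hnn : ∀ q : SL(2, ℤ) ⧸ Gamma0 4, 0 ≤ ∫ z in ModularGroup.fd,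
      ‖f (q.out⁻¹ • z)‖ ^ 2 * (q.out⁻¹ • z).im ^ κ := fun q =>
    integral_nonneg fun z => by have := (q.out⁻¹ • z).im_pos; positivity
  have h1 := (Finset.sum_eq_zero_iff_of_nonneg fun q _ => hnn q).1 h0
  have h2 : ∀ q : SL(2, ℤ) ⧸ Gamma0 4, ∀ z ∈ ModularGroup.fdo, f (q.out⁻¹ • z) = 0 := by
    intro q
    have h3 := h1 q (Finset.mem_univ _)
    have hint := (integrableOn_peterssonDensity hw hf hf q.out⁻¹).norm
    have hcont : Continuous fun z : ℍ => ‖f (q.out⁻¹ • z)‖ ^ 2 * (q.out⁻¹ • z).im ^ κ := by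
      have hs := continuous_SL_smul q.out⁻¹
      exact ((hf.mdiff.continuous.comp hs).norm.pow 2).mul
        ((continuous_im.comp hs).rpow_const fun z => Or.inl (q.out⁻¹ • z).im_ne_zero)
    rw [integral_eq_zero_iff_of_nonneg (fun z => by
      have := (q.out⁻¹ • z).im_pos; positivity) (by
      refine hint.congr (Filter.Eventually.of_forall fun z => ?_)
      simp only [norm_peterssonDensity, sq])] at h3
    have h4 := ae_restrict_of_ae_restrict_of_subset ModularGroup.fdo_subset_fd h3
    have h5 : EqOn (fun z : ℍ => ‖f (q.out⁻¹ • z)‖ ^ 2 * (q.out⁻¹ • z).im ^ κ) 0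
        ModularGroup.fdo := by
      exact Measure.eqOn_open_of_ae_eq h4 ModularGroup.isOpen_fdo hcont.continuousOn
        continuousOn_const
    intro z hz
    have h6 := h5 hz
    simp only [Pi.zero_apply, mul_eq_zero, pow_eq_zero_iff, ne_eq, OfNat.ofNat_ne_zero,
      not_false_eq_true, norm_eq_zero] at h6
    exact h6.resolve_right (Real.rpow_pos_of_pos (q.out⁻¹ • z).im_pos _).ne'
  have h3 : ∀ q : SL(2, ℤ) ⧸ Gamma0 4, ∀ z ∈ ModularGroup.fd, f (q.out⁻¹ • z) = 0 := by
    intro q z hz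
    rw [ModularGroup.fd_eq_closure_fdo] at hz
    have hcl : IsClosed {z : ℍ | f (q.out⁻¹ • z) = 0} :=
      isClosed_eq (hf.mdiff.continuous.comp (continuous_SL_smul _)) continuous_const
    exact closure_minimal (h2 q) hcl hz
  ext z
  obtain ⟨γ, hγ⟩ := ModularGroup.exists_smul_mem_fd z
  have h4 := h3 (γ : SL(2, ℤ) ⧸ Gamma0 4) _ hγ
  -- The representative of γΓ₀(4) is γε with ε ∈ Γ₀(4), so the zero found so far is at ε⁻¹z;
  -- invariance carries it to z.
  obtain ⟨ε, hε⟩ := QuotientGroup.mk_out_eq_mul (Gamma0 4) γ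
  rw [hε, ← mul_smul, mul_inv_rev, mul_assoc, inv_mul_cancel, mul_one] at h4
  have h5 := hf.toIsForm.eq_zero_smul ε.2 h4
  rwa [← mul_smul, mul_inv_cancel, one_smul] at h5

end Sesquilinear

lemma exists_riesz {V : Type*} [AddCommGroup V] [Module ℂ V] [FiniteDimensional ℂ V]
    (B : V → V → ℂ) (hadd : ∀ x y z, B (x + y) z = B x z + B y z)
    (hsmul : ∀ (c : ℂ) x y, B (c • x) y = c * B x y) (hconj : ∀ x y, conj (B x y) = B y x)
    (hpos : ∀ x, 0 ≤ (B x x).re) (hdef : ∀ x, B x x = 0 → x = 0) (L : V →ₗ[ℂ] ℂ) :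
    ∃ u, ∀ x, B x u = L x := by
  let core : InnerProductSpace.Core ℂ V :=
    -- The arguments are swapped because the inner product of the library is conjugate linear in its
    -- first slot, while B is linear there.
    { inner := fun x y => B y x
      conj_inner_symm := fun x y => hconj x y
      re_inner_nonneg := fun x => hpos x
      add_left := fun x y z => by rw [← hconj, hadd, map_add, hconj, hconj]
      smul_left := fun x y r => by rw [← hconj, hsmul, map_mul, hconj]
      definite := fun x h => hdef x h }
  let _ : NormedAddCommGroup V := core.toNormedAddCommGroup
  let _ : InnerProductSpace ℂ V := InnerProductSpace.ofCore core.toCore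
  have _ : CompleteSpace V := FiniteDimensional.complete ℂ V
  refine ⟨(InnerProductSpace.toDual ℂ V).symm (LinearMap.toContinuousLinearMap L), fun x => ?_⟩
  have := InnerProductSpace.toDual_symm_apply (𝕜 := ℂ) (x := x)
    (y := LinearMap.toContinuousLinearMap L)
  exact this

end

section

open CongruenceSubgroup

/-! ### The map `h ↦ [h, g]_ν` -/

lemma chiNegFour_apply {γ : SL(2, ℤ)} (hγ : γ ∈ Gamma0 4) :
    chiNegFour ((γ 1 1 : ℤ) : ZMod 4) = (kronecker (-4) (γ 1 1) : ℂ) := by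
  rw [kronecker_neg_four (odd_of_mem_Gamma0 hγ)]
  rfl

/-- The origin of the character χ₋₄^(k+l+1): the symbols (c/d) square to one, and the two half
powers of (-4/d) combine to a whole one. -/
lemma thetaMultiplier_mul_thetaMultiplier (k l : ℕ) {γ : SL(2, ℤ)} (hγ : γ ∈ Gamma0 4) :
    (kronecker (-4) (γ 1 1) : ℂ) ^ (k + l + 1) * (thetaMultiplier k γ * thetaMultiplier l γ) = 1 := by
  have h : (kronecker (-4) (γ 1 1) : ℂ) ^ 2 = 1 := by
    rcases kronecker_neg_four_eq hγ with h | h <;> rw [h] <;> norm_num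
  rw [thetaMultiplier_eq k hγ, thetaMultiplier_eq l hγ]
  calc _ = thetaMultiplier 0 γ ^ 2 * (kronecker (-4) (γ 1 1) : ℂ) *
        ((kronecker (-4) (γ 1 1) : ℂ) ^ 2) ^ (k + l) := by ring
    _ = ((kronecker (-4) (γ 1 1) : ℂ) ^ 2) ^ (k + l + 1) := by
      rw [thetaMultiplier_zero_sq]; ring
    _ = 1 := by rw [h, one_pow]

lemma weight_add (k l ν : ℕ) : ((k : ℝ) + 1 / 2) + ((l : ℝ) + 1 / 2) + 2 * ν =
    ((k + l + 2 * ν + 1 : ℕ) : ℝ) := by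
  push_cast; ring

/-- The form g is replaced by its own translate, after which the covariance of the bracket applies.
Since φ need not be invariant, this covers both cusp forms and the seed q^n of the Poincaré series.
-/
lemma rankinCohen_halfSlash (k ν : ℕ) {l : ℕ} {χ : DirichletCharacter ℂ 4} {φ g : ℍ → ℂ}
    (hφ : MDiff φ) (hg : g ∈ halfModularForms l χ) {γ : SL(2, ℤ)} (hγ : γ ∈ Gamma0 4) :
    (χ * chiNegFour ^ (k + l + 1)) ((γ 1 1 : ℤ) : ZMod 4) •
      rankinCohen ((k : ℝ) + 1 / 2) ((l : ℝ) + 1 / 2) ν (halfSlash k φ γ) g =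
    weightTranslate ((k + l + 2 * ν + 1 : ℕ) : ℝ)
      (rankinCohen ((k : ℝ) + 1 / 2) ((l : ℝ) + 1 / 2) ν φ g) γ := by
  set c := χ ((γ 1 1 : ℤ) : ZMod 4) with hc
  have hc0 : c ≠ 0 := ne_zero_of_pow_four (character_pow_four χ hγ)
  have h1 : g = (c⁻¹ * thetaMultiplier l γ) • weightTranslate ((l : ℝ) + 1 / 2) g γ := by
    rw [mul_smul, ← halfSlash_eq, hg.2.1 γ hγ, smul_smul, inv_mul_cancel₀ hc0, one_smul]
  conv_lhs => rw [h1, halfSlash_eq]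
  rw [rankinCohen_smul ν (mdifferentiable_weightTranslate _ hφ γ)
    (mdifferentiable_weightTranslate _ hg.1 γ), rankinCohen_weightTranslate (by positivity)
    (by positivity) ν hφ hg.1, smul_smul, weight_add]
  rw [MulChar.mul_apply, MulChar.pow_apply' _ (Nat.succ_ne_zero _), chiNegFour_apply hγ, ← hc]
  have h2 := thetaMultiplier_mul_thetaMultiplier k l hγ
  have h3 : c * (kronecker (-4) (γ 1 1) : ℂ) ^ (k + l + 1) *
      (thetaMultiplier k γ * (c⁻¹ * thetaMultiplier l γ)) = 1 := by
    rw [← h2]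
    field_simp
  rw [h3, one_smul]

lemma character_one_apply {γ : SL(2, ℤ)} (hγ : γ ∈ Gamma0 4) :
    (1 : DirichletCharacter ℂ 4) ((γ 1 1 : ℤ) : ZMod 4) = 1 := by
  refine MulChar.one_apply ?_
  by_contra h
  have := character_pow_four 1 hγ
  rw [MulChar.map_nonunit _ h] at this
  norm_num at this

lemma rankinCohen_mem_integralCuspForms {k l : ℕ} (ν : ℕ) {χ : DirichletCharacter ℂ 4} {h g : ℍ → ℂ}
    (hh : h ∈ halfCuspForms k 1) (hg : g ∈ halfModularForms l χ) :
    rankinCohen ((k : ℝ) + 1 / 2) ((l : ℝ) + 1 / 2) ν h g ∈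
      integralCuspForms (k + l + 2 * ν + 1) (χ * chiNegFour ^ (k + l + 1)) := by
  refine ⟨mdifferentiable_rankinCohen ν hh.1 hg.1, fun γ hγ => ?_, fun γ => ?_⟩
  · rw [slash_eq_weightTranslate, ← rankinCohen_halfSlash k ν hh.1 hg hγ, hh.2.1 γ hγ,
      character_one_apply hγ, one_smul]
  · rw [slash_eq_weightTranslate, ← weight_add,
      ← rankinCohen_weightTranslate (by positivity) (by positivity) ν hh.1 hg.1]
    refine isZeroAtImInfty_rankinCohen ν (mdifferentiable_weightTranslate _ hh.1 γ)
      (mdifferentiable_weightTranslate _ hg.1 γ) ?_ ?_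
    · rw [← cuspTranslate_eq]; exact hh.2.2 γ
    · rw [← cuspTranslate_eq]; exact hg.2.2 γ

/-- The linear map `h ↦ [h, g]_ν`. -/
def rankinCohenMap (k ν : ℕ) {l : ℕ} {χ : DirichletCharacter ℂ 4} {g : ℍ → ℂ}
    (hg : g ∈ halfModularForms l χ) : halfCuspForms k 1 →ₗ[ℂ]
      integralCuspForms (k + l + 2 * ν + 1) (χ * chiNegFour ^ (k + l + 1)) where
  toFun h := ⟨_, rankinCohen_mem_integralCuspForms ν h.2 hg⟩
  map_add' h h' := Subtype.ext (rankinCohen_add ν h.2.1 h'.2.1)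
  map_smul' c h := Subtype.ext (by
    have := rankinCohen_smul (κ := (k : ℝ) + 1 / 2) (lam := (l : ℝ) + 1 / 2) ν h.2.1 hg.1 c 1
    rw [one_smul, mul_one] at this
    exact this)

lemma four_mul_weight (k : ℕ) : 4 * ((k : ℝ) + 1 / 2) = ((4 * k + 2 : ℕ) : ℝ) := by
  push_cast; ring

lemma four_mul_natCast (K : ℕ) : 4 * (K : ℝ) = ((4 * K : ℕ) : ℝ) := by
  push_cast; ring

/-! ### Existence and uniqueness of the Petersson adjoint -/

section Adjoint

variable {k K : ℕ} {χ χ' : DirichletCharacter ℂ 4}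

lemma peterssonProduct_self_re_nonneg (κ : ℝ) (f : ℍ → ℂ) : 0 ≤ (peterssonProduct κ f f).re := by
  rw [peterssonProduct_self, Complex.ofReal_re]
  refine Finset.sum_nonneg fun q _ => MeasureTheory.integral_nonneg fun z => ?_
  have := (q.out⁻¹ • z).im_pos
  positivity

lemma exists_peterssonProduct_eq (L : halfCuspForms k χ →ₗ[ℂ] ℂ) :
    ∃ u : halfCuspForms k χ, ∀ h : halfCuspForms k χ,
      peterssonProduct ((k : ℝ) + 1 / 2) h u = L h := by
  refine exists_riesz (fun f h : halfCuspForms k χ => peterssonProduct ((k : ℝ) + 1 / 2) f h)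
    (fun x y z => ?_) (fun c x y => ?_) (fun x y => ?_) (fun x => ?_) (fun x hx => ?_) L
  · exact peterssonProduct_add_left (four_mul_weight k) (isCuspidal_of_mem_halfCuspForms x.2)
      (isCuspidal_of_mem_halfCuspForms y.2) (isCuspidal_of_mem_halfCuspForms z.2)
  · exact peterssonProduct_smul_left c
  · exact conj_peterssonProduct
  · exact peterssonProduct_self_re_nonneg _ _
  · exact Subtype.ext (eq_zero_of_peterssonProduct_self (four_mul_weight k)
      (isCuspidal_of_mem_halfCuspForms x.2) hx)

lemma eq_of_peterssonProduct_eq {u v : halfCuspForms k χ}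
    (h : ∀ x : halfCuspForms k χ,
      peterssonProduct ((k : ℝ) + 1 / 2) u x = peterssonProduct ((k : ℝ) + 1 / 2) v x) : u = v := by
  have hu := isCuspidal_of_mem_halfCuspForms u.2
  have hd := isCuspidal_of_mem_halfCuspForms (u - v).2
  have hv' : IsCuspidal ((k : ℝ) + 1 / 2) ((-1 : ℂ) • (v : ℍ → ℂ)) :=
    isCuspidal_of_mem_halfCuspForms ((-1 : ℂ) • v).2
  have h1 := h (u - v)
  have h2 : ((u - v : halfCuspForms k χ) : ℍ → ℂ) = (u : ℍ → ℂ) + (-1 : ℂ) • (v : ℍ → ℂ) := by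
    ext z; simp [sub_eq_add_neg]
  have h3 : peterssonProduct ((k : ℝ) + 1 / 2) ((u - v : halfCuspForms k χ) : ℍ → ℂ)
      (u - v : halfCuspForms k χ) = 0 := by
    nth_rewrite 1 [h2]
    rw [peterssonProduct_add_left (four_mul_weight k) hu hv' hd, peterssonProduct_smul_left, h1]
    ring
  have h4 := eq_zero_of_peterssonProduct_self (four_mul_weight k) hd h3
  exact sub_eq_zero.1 (Subtype.ext h4)

/-- The existence and uniqueness of Petersson adjoints. -/
lemma existsUnique_adjoint (T : halfCuspForms k χ →ₗ[ℂ] integralCuspForms K χ') :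
    ∃ U : integralCuspForms K χ' →ₗ[ℂ] halfCuspForms k χ,
      IsPeterssonAdjoint ((k : ℝ) + 1 / 2) (K : ℝ) T U ∧
      ∀ U', IsPeterssonAdjoint ((k : ℝ) + 1 / 2) (K : ℝ) T U' → U' = U := by
  have hW := fun f : integralCuspForms K χ' => isCuspidal_of_mem_integralCuspForms f.2
  have h1 : ∀ f : integralCuspForms K χ', ∃ u : halfCuspForms k χ, ∀ h : halfCuspForms k χ,
      peterssonProduct ((k : ℝ) + 1 / 2) u h = peterssonProduct (K : ℝ) f (T h) := by
    intro f
    -- The product is linear in its first argument, so Riesz is applied to h ↦ ⟨Th, f⟩ and the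
    -- identity is conjugated afterwards.
    obtain ⟨u, hu⟩ := exists_peterssonProduct_eq
      { toFun := fun h : halfCuspForms k χ => peterssonProduct (K : ℝ) (T h) f
        map_add' := fun x y => by
          rw [map_add]
          exact peterssonProduct_add_left (four_mul_natCast K) (hW _) (hW _) (hW _)
        map_smul' := fun c x => by
          rw [map_smul]
          exact peterssonProduct_smul_left c }
    refine ⟨u, fun h => ?_⟩
    rw [← conj_peterssonProduct, hu]
    exact conj_peterssonProduct
  choose U hU using h1
  refine ⟨{ toFun := U, map_add' := fun f f' => ?_, map_smul' := fun c f => ?_ },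
    fun f h => (hU f h).symm, fun U' hU' => ?_⟩
  · refine eq_of_peterssonProduct_eq fun x => ?_
    rw [hU]
    refine (peterssonProduct_add_left (four_mul_natCast K) (hW f) (hW f') (hW _)).trans ?_
    rw [← hU, ← hU]
    exact (peterssonProduct_add_left (four_mul_weight k) (isCuspidal_of_mem_halfCuspForms (U f).2)
      (isCuspidal_of_mem_halfCuspForms (U f').2) (isCuspidal_of_mem_halfCuspForms x.2)).symm
  · refine eq_of_peterssonProduct_eq fun x => ?_
    rw [hU]
    refine (peterssonProduct_smul_left c).trans ?_
    rw [← hU]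
    exact (peterssonProduct_smul_left c).symm
  · refine LinearMap.ext fun f => eq_of_peterssonProduct_eq fun x => ?_
    rw [← hU' f x]
    exact (hU f x).symm

end Adjoint

end

section

open CongruenceSubgroup

/-! ### The cocycle relation of the half-integral weight slash operator -/

lemma halfSlash_apply (k : ℕ) (φ : ℍ → ℂ) (γ : SL(2, ℤ)) (z : ℍ) :
    halfSlash k φ γ z = halfSlash k 1 γ z * φ (γ • z) := by
  simp [halfSlash]

lemma mdifferentiable_halfSlash (k : ℕ) {φ : ℍ → ℂ} (hφ : MDiff φ) (γ : SL(2, ℤ)) :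
    MDiff (halfSlash k φ γ) := by
  rw [halfSlash_eq]
  exact (mdifferentiable_weightTranslate _ hφ γ).const_smul _

lemma norm_halfSlash (k : ℕ) (φ : ℍ → ℂ) {γ : SL(2, ℤ)} (hγ : γ ∈ Gamma0 4) (z : ℍ) :
    ‖halfSlash k φ γ z‖ = ‖autFactor γ z‖ ^ (-((k : ℝ) + 1 / 2)) * ‖φ (γ • z)‖ := by
  rw [halfSlash_eq, Pi.smul_apply, norm_smul, norm_of_pow_four (thetaMultiplier_pow_four k hγ),
    one_mul, norm_weightTranslate]

/-- The second factor is the k-th power of a genuine cocycle on Γ₀(4), so the cocycle relation in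
one half-integral weight is equivalent to that in every other. -/
lemma halfSlash_one_eq (k : ℕ) {γ : SL(2, ℤ)} (hγ : γ ∈ Gamma0 4) (z : ℍ) :
    halfSlash k 1 γ z = halfSlash 0 1 γ z * ((kronecker (-4) (γ 1 1) : ℂ) / autFactor γ z) ^ k := by
  have h0 := autFactor_ne_zero γ z
  simp only [halfSlash_eq, Pi.smul_apply, weightTranslate, Pi.one_apply, smul_eq_mul, mul_one]
  rw [thetaMultiplier_eq k hγ, div_pow]
  have h1 : autFactor γ z ^ (-(((k : ℝ) + 1 / 2 : ℝ) : ℂ)) =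
      autFactor γ z ^ (-((((0 : ℕ) : ℝ) + 1 / 2 : ℝ) : ℂ)) / autFactor γ z ^ k := by
    rw [← Complex.cpow_natCast, ← Complex.cpow_sub _ _ h0]
    congr 1
    push_cast
    ring
  rw [h1]
  ring

lemma bottomRight_mul {γ δ : SL(2, ℤ)} (hγ : γ ∈ Gamma0 4) :
    (((γ * δ) 1 1 : ℤ) : ZMod 4) = ((γ 1 1 : ℤ) : ZMod 4) * ((δ 1 1 : ℤ) : ZMod 4) := by
  rw [Gamma0_mem] at hγ
  rw [Matrix.SpecialLinearGroup.coe_mul, Matrix.mul_apply, Fin.sum_univ_two]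
  push_cast
  rw [hγ]
  ring

lemma kronecker_neg_four_mul {γ δ : SL(2, ℤ)} (hγ : γ ∈ Gamma0 4) (hδ : δ ∈ Gamma0 4) :
    (kronecker (-4) ((γ * δ) 1 1) : ℂ) = kronecker (-4) (γ 1 1) * kronecker (-4) (δ 1 1) := by
  rw [← chiNegFour_apply hγ, ← chiNegFour_apply hδ, ← chiNegFour_apply (mul_mem hγ hδ),
    bottomRight_mul hγ, map_mul]

/-- The cocycle relation of the automorphy factor, read off from the existence of a nonzero form. -/
lemma halfSlash_mul {l : ℕ} {χ : DirichletCharacter ℂ 4} {g : ℍ → ℂ}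
    (hg : g ∈ halfModularForms l χ) (hg0 : g ≠ 0) (k : ℕ) (φ : ℍ → ℂ) {γ δ : SL(2, ℤ)}
    (hγ : γ ∈ Gamma0 4) (hδ : δ ∈ Gamma0 4) :
    halfSlash k (halfSlash k φ γ) δ = halfSlash k φ (γ * δ) := by
  have hcoc : halfSlash k (halfSlash k 1 γ) δ = halfSlash k 1 (γ * δ) := by
    have hm1 := mdifferentiable_halfSlash k (mdifferentiable_halfSlash k
      (mdifferentiable_const (c := (1 : ℂ))) γ) δ
    have hm2 := mdifferentiable_halfSlash k (mdifferentiable_const (c := (1 : ℂ))) (γ * δ)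
    -- Where g(z) ≠ 0 the laws of g under γ, δ and γδ determine the factor. Elsewhere the product
    -- vanishes trivially, and holomorphic functions on ℍ have no zero divisors.
    have hprod : g * (halfSlash k (halfSlash k 1 γ) δ - halfSlash k 1 (γ * δ)) = 0 := by
      ext z
      rw [Pi.mul_apply, Pi.sub_apply, Pi.zero_apply]
      by_cases hz : g z = 0
      · rw [hz, zero_mul]
      have e1 := congrFun (hg.2.1 (γ * δ) (mul_mem hγ hδ)) z
      have e2 := congrFun (hg.2.1 γ hγ) (δ • z)
      have e3 := congrFun (hg.2.1 δ hδ) z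
      rw [halfSlash_apply, Pi.smul_apply, smul_eq_mul] at e1 e2 e3
      rw [bottomRight_mul hγ, map_mul, mul_smul] at e1
      have hl : halfSlash l 1 (γ * δ) z = halfSlash l 1 γ (δ • z) * halfSlash l 1 δ z := by
        have hgz : g (γ • δ • z) ≠ 0 := by
          intro h0
          rw [h0, mul_zero] at e1
          have h1 := ne_zero_of_pow_four (character_pow_four χ hγ)
          have h2 := ne_zero_of_pow_four (character_pow_four χ hδ)
          exact mul_ne_zero (mul_ne_zero h1 h2) hz e1.symm
        refine mul_right_cancel₀ hgz ?_
        linear_combination e1 - halfSlash l 1 δ z * e2 - χ ((γ 1 1 : ℤ) : ZMod 4) * e3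
      rw [halfSlash_one_eq l (mul_mem hγ hδ), halfSlash_one_eq l hγ, halfSlash_one_eq l hδ,
        kronecker_neg_four_mul hγ hδ, autFactor_mul] at hl
      have h1 := div_ne_zero (kronecker_neg_four_ne_zero hγ) (autFactor_ne_zero γ (δ • z))
      have h2 := div_ne_zero (kronecker_neg_four_ne_zero hδ) (autFactor_ne_zero δ z)
      rw [mul_div_mul_comm, mul_pow] at hl
      -- Passage from weight l+1/2 down to weight 1/2; the rewriting that follows goes up to k+1/2.
      have h0 : halfSlash 0 1 (γ * δ) z = halfSlash 0 1 γ (δ • z) * halfSlash 0 1 δ z :=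
        mul_right_cancel₀ (mul_ne_zero (pow_ne_zero l h1) (pow_ne_zero l h2))
          (hl.trans (by ring))
      rw [halfSlash_apply k _ δ, halfSlash_one_eq k (mul_mem hγ hδ), halfSlash_one_eq k hγ,
        halfSlash_one_eq k hδ, kronecker_neg_four_mul hγ hδ, autFactor_mul, h0,
        mul_div_mul_comm, mul_pow]
      ring
    rcases (mul_eq_zero_iff hg.1 (hm1.sub hm2)).1 hprod with h | h
    · exact absurd h hg0
    · exact sub_eq_zero.1 h
  ext z
  have := congrFun hcoc z
  rw [halfSlash_apply] at this
  rw [halfSlash_apply, halfSlash_apply k φ γ, halfSlash_apply k φ (γ * δ), ← this, mul_smul]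
  ring

/-! ### Bottom rows -/

/-- The bottom row of a matrix. -/
def bottomRow (γ : SL(2, ℤ)) : Fin 2 → ℤ := ![γ 1 0, γ 1 1]

lemma bottomRow_mul (γ δ : SL(2, ℤ)) : bottomRow (γ * δ) = Matrix.vecMul (bottomRow γ) δ := by
  ext j
  fin_cases j <;>
    simp [bottomRow, Matrix.SpecialLinearGroup.coe_mul, Matrix.mul_apply, Fin.sum_univ_two,
      Matrix.vecMul, dotProduct]

lemma autFactor_eq_bottomRow (γ : SL(2, ℤ)) (z : ℍ) :
    autFactor γ z = bottomRow γ 0 * (z : ℂ) + bottomRow γ 1 := rfl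

/-- The matrix γ'γ⁻¹ has bottom row (0, 1) and determinant one, so it is unipotent; m is its upper
right entry. -/
lemma eq_T_zpow_mul {γ γ' : SL(2, ℤ)} (h : bottomRow γ' = bottomRow γ) :
    ∃ m : ℤ, γ' = ModularGroup.T ^ m * γ := by
  have h0 : γ' 1 0 = γ 1 0 := congrFun h 0
  have h1 : γ' 1 1 = γ 1 1 := congrFun h 1
  have hd := γ.det_coe
  rw [Matrix.det_fin_two] at hd
  have e10 : (γ' * γ⁻¹) 1 0 = 0 := by
    simp only [Matrix.SpecialLinearGroup.coe_mul, Matrix.SpecialLinearGroup.coe_inv,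
      Matrix.adjugate_fin_two, Matrix.mul_apply, Fin.sum_univ_two, Matrix.of_apply,
      Matrix.cons_val', Matrix.cons_val_zero, Matrix.cons_val_one, Matrix.cons_val_fin_one, h0, h1]
    ring
  have e11 : (γ' * γ⁻¹) 1 1 = 1 := by
    simp only [Matrix.SpecialLinearGroup.coe_mul, Matrix.SpecialLinearGroup.coe_inv,
      Matrix.adjugate_fin_two, Matrix.mul_apply, Fin.sum_univ_two, Matrix.of_apply,
      Matrix.cons_val', Matrix.cons_val_zero, Matrix.cons_val_one, Matrix.cons_val_fin_one, h0, h1]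
    linarith
  refine ⟨(γ' * γ⁻¹) 0 1, ?_⟩
  rw [← mul_inv_eq_iff_eq_mul]
  have hd' := (γ' * γ⁻¹).det_coe
  rw [Matrix.det_fin_two, e10, e11, mul_zero, sub_zero, mul_one] at hd'
  ext i j
  rw [ModularGroup.coe_T_zpow]
  fin_cases i <;> fin_cases j
  · exact hd'
  · rfl
  · exact e10
  · exact e11

lemma bottomRow_T_zpow_mul (m : ℤ) (γ : SL(2, ℤ)) :
    bottomRow (ModularGroup.T ^ m * γ) = bottomRow γ := by
  ext j
  fin_cases j <;> simp [bottomRow]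

lemma T_zpow_mem_Gamma0 (m : ℤ) : ModularGroup.T ^ m ∈ Gamma0 4 := zpow_mem T_mem_Gamma0 m

/-- The bottom rows of matrices in `Γ₀(4)`. -/
abbrev Gamma0Row := {p : Fin 2 → ℤ // IsCoprime (p 0) (p 1) ∧ (4 : ℤ) ∣ p 0}

lemma bottomRow_mem {γ : SL(2, ℤ)} (hγ : γ ∈ Gamma0 4) :
    IsCoprime (bottomRow γ 0) (bottomRow γ 1) ∧ (4 : ℤ) ∣ bottomRow γ 0 :=
  ⟨isCoprime_bottom_row γ, even_of_mem_Gamma0 hγ⟩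

lemma exists_bottomRow (p : Gamma0Row) : ∃ γ ∈ Gamma0 4, bottomRow γ = p := by
  obtain ⟨γ, -, h⟩ := ModularGroup.bottom_row_surj p.2.1
  have h0 : γ 1 0 = p.1 0 := congrFun h 0
  have h1 : γ 1 1 = p.1 1 := congrFun h 1
  refine ⟨γ, ?_, ?_⟩
  · rw [Gamma0_mem, h0]
    exact (ZMod.intCast_zmod_eq_zero_iff_dvd _ _).2 p.2.2
  · ext j; fin_cases j
    · exact h0
    · exact h1

/-- A matrix in `Γ₀(4)` with given bottom row. -/
def Gamma0Row.lift (p : Gamma0Row) : SL(2, ℤ) := (exists_bottomRow p).choose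

lemma Gamma0Row.lift_mem (p : Gamma0Row) : p.lift ∈ Gamma0 4 := (exists_bottomRow p).choose_spec.1

lemma Gamma0Row.bottomRow_lift (p : Gamma0Row) : bottomRow p.lift = p :=
  (exists_bottomRow p).choose_spec.2

lemma Gamma0Row.autFactor_lift (p : Gamma0Row) (z : ℍ) :
    autFactor p.lift z = p.1 0 * (z : ℂ) + p.1 1 := by
  rw [autFactor_eq_bottomRow, p.bottomRow_lift]

/-- Right multiplication by `δ ∈ Γ₀(4)` on bottom rows. -/
def Gamma0Row.mulRight {δ : SL(2, ℤ)} (hδ : δ ∈ Gamma0 4) : Gamma0Row ≃ Gamma0Row where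
  toFun p := ⟨bottomRow (p.lift * δ), bottomRow_mem (mul_mem p.lift_mem hδ)⟩
  invFun p := ⟨bottomRow (p.lift * δ⁻¹), bottomRow_mem (mul_mem p.lift_mem (inv_mem hδ))⟩
  left_inv p := Subtype.ext (by
    simp only [bottomRow_mul, Gamma0Row.bottomRow_lift]
    rw [Matrix.vecMul_vecMul, ← Matrix.SpecialLinearGroup.coe_mul, mul_inv_cancel]
    simp)
  right_inv p := Subtype.ext (by
    simp only [bottomRow_mul, Gamma0Row.bottomRow_lift]
    rw [Matrix.vecMul_vecMul, ← Matrix.SpecialLinearGroup.coe_mul, inv_mul_cancel]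
    simp)

/-- `Γ₀(4)` is the disjoint union of the cosets `⟨T⟩ γ` indexed by bottom rows. -/
def gamma0Equiv : ℤ × Gamma0Row ≃ Gamma0 4 := by
  refine Equiv.ofBijective (fun x => ⟨ModularGroup.T ^ x.1 * x.2.lift,
    mul_mem (T_zpow_mem_Gamma0 _) x.2.lift_mem⟩) ⟨?_, ?_⟩
  · rintro ⟨m, p⟩ ⟨m', p'⟩ h
    have h1 : ModularGroup.T ^ m * p.lift = ModularGroup.T ^ m' * p'.lift := congrArg Subtype.val h
    have h2 := congrArg bottomRow h1
    rw [bottomRow_T_zpow_mul, bottomRow_T_zpow_mul, p.bottomRow_lift, p'.bottomRow_lift] at h2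
    obtain rfl : p = p' := Subtype.ext h2
    have h3 := congrArg (fun γ : SL(2, ℤ) => γ 0 1) (mul_right_cancel h1)
    simp only [ModularGroup.coe_T_zpow] at h3
    simpa using h3
  · rintro ⟨γ, hγ⟩
    obtain ⟨m, hm⟩ := eq_T_zpow_mul (γ := Gamma0Row.lift ⟨bottomRow γ, bottomRow_mem hγ⟩) (γ' := γ)
      (Gamma0Row.bottomRow_lift ⟨bottomRow γ, bottomRow_mem hγ⟩).symm
    exact ⟨(m, ⟨bottomRow γ, bottomRow_mem hγ⟩), Subtype.ext hm.symm⟩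

lemma apply_T_zpow_smul {α : Type*} {F : ℍ → α} (hT : ∀ z, F (ModularGroup.T • z) = F z) (m : ℤ)
    (z : ℍ) : F (ModularGroup.T ^ m • z) = F z := by
  have h1 : ∀ (n : ℕ) (z : ℍ), F (ModularGroup.T ^ n • z) = F z := by
    intro n
    induction n with
    | zero => simp
    | succ n ih => intro z; rw [pow_succ', mul_smul, hT, ih]
  rcases m.eq_nat_or_neg with ⟨n, rfl | rfl⟩
  · rw [zpow_natCast]; exact h1 n z
  · rw [← h1 n, ← mul_smul, zpow_neg, zpow_natCast, mul_inv_cancel, one_smul]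

/-- Makes the terms of the Poincaré series independent of the chosen lifts: the multiplier and cz+d
see only the bottom row, and a change of lift by T^m is absorbed by φ. -/
lemma halfSlash_eq_of_bottomRow_eq (k : ℕ) {φ : ℍ → ℂ} (hT : ∀ z, φ (ModularGroup.T • z) = φ z)
    {γ γ' : SL(2, ℤ)} (h : bottomRow γ' = bottomRow γ) : halfSlash k φ γ' = halfSlash k φ γ := by
  obtain ⟨m, rfl⟩ := eq_T_zpow_mul h
  have h0 : (ModularGroup.T ^ m * γ) 1 0 = γ 1 0 := congrFun h 0
  have h1 : (ModularGroup.T ^ m * γ) 1 1 = γ 1 1 := congrFun h 1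
  ext z
  rw [halfSlash, halfSlash, h0, h1, mul_smul, apply_T_zpow_smul hT]

end

section

open CongruenceSubgroup

/-! ### Poincaré series of half-integral weight -/

lemma summable_lattice {s : ℝ} (hs : 2 < s) (z : ℍ) :
    Summable fun r : Fin 2 → ℤ => ‖(r 0 : ℂ) * (z : ℂ) + r 1‖ ^ (-s) :=
  Summable.of_nonneg_of_le (fun r => by positivity)
    (fun r => EisensteinSeries.summand_bound z (by linarith) r)
    ((EisensteinSeries.summable_one_div_norm_rpow hs).mul_left _)

lemma tsum_lattice_T_zpow (s : ℝ) (m : ℤ) (z : ℍ) :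
    ∑' r : Fin 2 → ℤ, ‖(r 0 : ℂ) * ((ModularGroup.T ^ m • z : ℍ) : ℂ) + r 1‖ ^ (-s) =
      ∑' r : Fin 2 → ℤ, ‖(r 0 : ℂ) * (z : ℂ) + r 1‖ ^ (-s) := by
  let e : (Fin 2 → ℤ) ≃ (Fin 2 → ℤ) :=
    { toFun := fun r => ![r 0, r 1 - m * r 0]
      invFun := fun r => ![r 0, r 1 + m * r 0]
      left_inv := fun r => by ext j; fin_cases j <;> simp
      right_inv := fun r => by ext j; fin_cases j <;> simp }
  rw [← e.tsum_eq]
  refine tsum_congr fun r => ?_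
  congr 2
  rw [ModularGroup.coe_T_zpow_smul_eq]
  simp only [e, Equiv.coe_fn_mk, Matrix.cons_val_zero, Matrix.cons_val_one,
    Matrix.cons_val_fin_one]
  push_cast
  ring

/-- The sum is invariant under z ↦ z+m, so z may be moved to |Re z| ≤ 1, where the lattice estimate
is uniform in y ≥ 1. -/
lemma exists_lattice_bound {s : ℝ} (hs : 2 < s) : ∃ C, ∀ z : ℍ, 1 ≤ z.im →
    ∑' r : Fin 2 → ℤ, ‖(r 0 : ℂ) * (z : ℂ) + r 1‖ ^ (-s) ≤ C := by
  refine ⟨∑' r : Fin 2 → ℤ, EisensteinSeries.r ⟨⟨1, 1⟩, one_pos⟩ ^ (-s) * ‖r‖ ^ (-s),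
    fun z hz => ?_⟩
  obtain ⟨m, hm⟩ := ModularGroup_T_zpow_mem_verticalStrip z one_pos
  rw [← tsum_lattice_T_zpow s (((1 : ℕ) : ℤ) * m)]
  have hm' : ModularGroup.T ^ (((1 : ℕ) : ℤ) * m) • z ∈ verticalStrip 1 1 := by
    refine ⟨by simpa using hm.1, ?_⟩
    rw [ModularGroup.im_T_zpow_smul]
    exact hz
  exact (summable_lattice hs _).tsum_le_tsum
    (fun r => EisensteinSeries.summand_bound_of_mem_verticalStrip (by linarith) r one_pos hm')
    ((EisensteinSeries.summable_one_div_norm_rpow hs).mul_left _)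

lemma mdifferentiable_qOf_pow (n : ℕ) : MDiff fun z : ℍ => qOf z ^ n := by
  rw [UpperHalfPlane.mdifferentiable_iff]
  have h : DifferentiableOn ℂ (fun w : ℂ => Complex.exp (2 * Real.pi * Complex.I * w) ^ n)
      {w | 0 < w.im} := by
    refine Differentiable.differentiableOn ?_
    fun_prop
  refine h.congr fun w hw => ?_
  simp only [Function.comp_apply, qOf]
  rw [ofComplex_apply_of_im_pos hw]

lemma qOf_T_smul (z : ℍ) : qOf (ModularGroup.T • z) = qOf z := by
  have h := ModularGroup.coe_T_zpow_smul_eq (z := z) (n := 1)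
  rw [zpow_one] at h
  rw [qOf, qOf, h, Int.cast_one, mul_add, mul_one, Complex.exp_add, Complex.exp_two_pi_mul_I,
    mul_one]

lemma norm_qOf_pow (n : ℕ) (z : ℍ) : ‖qOf z ^ n‖ = Real.exp (-(2 * Real.pi * n * z.im)) := by
  rw [norm_pow, norm_qOf, ← Real.exp_nat_mul]
  congr 1
  ring

/-- The term of the Poincaré series `P_n` with index `p`. -/
def poincareTerm (k n : ℕ) (p : Gamma0Row) : ℍ → ℂ := halfSlash k (fun z => qOf z ^ n) p.lift

/-- The Poincaré series `P_n` of weight `k + 1/2`; the rows `p` and `-p` both occur. -/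
def poincare (k n : ℕ) (z : ℍ) : ℂ := ∑' p : Gamma0Row, poincareTerm k n p z

lemma norm_poincareTerm (k n : ℕ) (p : Gamma0Row) (z : ℍ) :
    ‖poincareTerm k n p z‖ = ‖autFactor p.lift z‖ ^ (-((k : ℝ) + 1 / 2)) *
      Real.exp (-(2 * Real.pi * n * (p.lift • z).im)) := by
  rw [poincareTerm, norm_halfSlash k _ p.lift_mem, norm_qOf_pow]

lemma norm_poincareTerm_le (k n : ℕ) (p : Gamma0Row) (z : ℍ) :
    ‖poincareTerm k n p z‖ ≤ ‖(p.1 0 : ℂ) * (z : ℂ) + p.1 1‖ ^ (-((k : ℝ) + 1 / 2)) := by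
  rw [norm_poincareTerm, p.autFactor_lift]
  refine mul_le_of_le_one_right (by positivity) (Real.exp_le_one_iff.2 ?_)
  have := (p.lift • z).im_pos
  rw [neg_nonpos]
  positivity

/-- The exponential is at most 1, so the terms are dominated by |cz+d|^(-(k+1/2)); this is summable
over the lattice because k ≥ 2 puts the exponent above 2. -/
lemma locallyMajorized_poincareTerm {k : ℕ} (hk : 2 ≤ k) (n : ℕ) :
    LocallyMajorized (poincareTerm k n) where
  mdiff p := mdifferentiable_halfSlash k (mdifferentiable_qOf_pow n) _
  major z₀ := by
    have hk' : (2 : ℝ) ≤ k := by exact_mod_cast hk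
    have hB : 0 < z₀.im / 2 := by have := z₀.im_pos; positivity
    refine ⟨z₀.im / 2, hB, fun p : Gamma0Row => EisensteinSeries.r ⟨⟨|z₀.re| + z₀.im / 2, z₀.im / 2⟩,
      hB⟩ ^ (-((k : ℝ) + 1 / 2)) * ‖(p : Fin 2 → ℤ)‖ ^ (-((k : ℝ) + 1 / 2)), ?_, ?_⟩
    · exact ((EisensteinSeries.summable_one_div_norm_rpow (by linarith)).mul_left _).subtype _
    · intro p z hz
      refine (norm_poincareTerm_le k n p z).trans ?_
      refine EisensteinSeries.summand_bound_of_mem_verticalStrip (by linarith) p.1 hB ?_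
      rw [dist_eq_norm] at hz
      have h1 := (Complex.abs_re_le_norm _).trans hz.le
      have h2 := (Complex.abs_im_le_norm _).trans hz.le
      rw [Complex.sub_re, coe_re, coe_re] at h1
      rw [Complex.sub_im, coe_im, coe_im] at h2
      refine ⟨?_, by linarith [(abs_le.1 h2).1]⟩
      have := abs_add_le (z.re - z₀.re) z₀.re
      rw [sub_add_cancel] at this
      linarith

lemma hasSum_poincare {k : ℕ} (hk : 2 ≤ k) (n : ℕ) (z : ℍ) :
    HasSum (fun p => poincareTerm k n p z) (poincare k n z) :=
  ((locallyMajorized_poincareTerm hk n).summable z).hasSum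

lemma exp_neg_le_rpow {t : ℝ} (ht : 0 < t) : Real.exp (-t) ≤ t ^ (-(1 / 8) : ℝ) := by
  rcases le_total t 1 with h | h
  · refine (Real.exp_le_one_iff.2 (by linarith)).trans ?_
    exact Real.one_le_rpow_of_pos_of_le_one_of_nonpos ht h (by norm_num)
  · rw [Real.exp_neg, Real.rpow_neg ht.le]
    refine inv_anti₀ (by positivity) ?_
    calc t ^ (1 / 8 : ℝ) ≤ t ^ (1 : ℝ) := Real.rpow_le_rpow_of_exponent_le h (by norm_num)
      _ = t := Real.rpow_one t
      _ ≤ Real.exp t := by linarith [Real.add_one_le_exp t]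

/-- With x = |cz+d| for the product matrix, e^(-y/x²) ≤ (y/x²)^(-1/8) trades a quarter of the
exponent of x for decay in y. The remaining exponent k+1/4 is still above 2. -/
lemma norm_weightTranslate_poincareTerm_le (k : ℕ) {n : ℕ} (hn : 1 ≤ n) (p : Gamma0Row)
    (δ : SL(2, ℤ)) (z : ℍ) :
    ‖weightTranslate ((k : ℝ) + 1 / 2) (poincareTerm k n p) δ z‖ ≤
      z.im ^ (-(1 / 8) : ℝ) * ‖autFactor (p.lift * δ) z‖ ^ (-((k : ℝ) + 1 / 4)) := by
  have hx := norm_pos_iff.2 (autFactor_ne_zero (p.lift * δ) z)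
  have hy := z.im_pos
  rw [norm_weightTranslate, norm_poincareTerm, ← mul_assoc,
    ← Real.mul_rpow (norm_nonneg _) (norm_nonneg _), mul_comm ‖autFactor δ z‖, ← norm_mul,
    ← autFactor_mul, ← mul_smul, im_smul_eq]
  set x := ‖autFactor (p.lift * δ) z‖
  have hn' : (1 : ℝ) ≤ n := by exact_mod_cast hn
  have ht : 0 < z.im / x ^ 2 := by positivity
  have h1 : Real.exp (-(2 * Real.pi * n * (z.im / x ^ 2))) ≤ Real.exp (-(z.im / x ^ 2)) := by
    refine Real.exp_le_exp.2 (neg_le_neg ?_)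
    refine le_mul_of_one_le_left ht.le ?_
    nlinarith [Real.pi_gt_three]
  have h2 : x ^ (-((k : ℝ) + 1 / 2)) * (z.im / x ^ 2) ^ (-(1 / 8) : ℝ) =
      z.im ^ (-(1 / 8) : ℝ) * x ^ (-((k : ℝ) + 1 / 4)) := by
    rw [Real.div_rpow hy.le (by positivity), ← Real.rpow_natCast, ← Real.rpow_mul hx.le,
      div_eq_mul_inv (z.im ^ _), ← Real.rpow_neg hx.le, mul_left_comm, ← Real.rpow_add hx]
    congr 2
    push_cast
    ring
  rw [← h2]
  exact mul_le_mul_of_nonneg_left (h1.trans (exp_neg_le_rpow ht)) (by positivity)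

lemma vecMul_injective (δ : SL(2, ℤ)) :
    Function.Injective fun r : Fin 2 → ℤ => Matrix.vecMul r (δ : Matrix (Fin 2) (Fin 2) ℤ) := by
  intro r s h
  have h2 := congrArg (fun r : Fin 2 → ℤ =>
    Matrix.vecMul r ((δ⁻¹ : SL(2, ℤ)) : Matrix (Fin 2) (Fin 2) ℤ)) h
  simpa only [Matrix.vecMul_vecMul, ← Matrix.SpecialLinearGroup.coe_mul, mul_inv_cancel,
    Matrix.SpecialLinearGroup.coe_one, Matrix.vecMul_one] using h2

/-- Translation by δ moves the rows injectively within ℤ², so at every cusp the series is at most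
y^(-1/8) times a full lattice sum, which is bounded for y ≥ 1. No Fourier expansion at the cusp is
computed. -/
lemma isZeroAtImInfty_poincare {k : ℕ} (hk : 2 ≤ k) {n : ℕ} (hn : 1 ≤ n) (δ : SL(2, ℤ)) :
    IsZeroAtImInfty (weightTranslate ((k : ℝ) + 1 / 2) (poincare k n) δ) := by
  have hk' : (2 : ℝ) ≤ k := by exact_mod_cast hk
  have hs : 2 < (k : ℝ) + 1 / 4 := by linarith
  obtain ⟨C, hC⟩ := exists_lattice_bound hs
  have hbound : ∀ z : ℍ, 1 ≤ z.im →
      ‖weightTranslate ((k : ℝ) + 1 / 2) (poincare k n) δ z‖ ≤ z.im ^ (-(1 / 8) : ℝ) * C := by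
    intro z hz
    have h1 : HasSum (fun p => weightTranslate ((k : ℝ) + 1 / 2) (poincareTerm k n p) δ z)
        (weightTranslate ((k : ℝ) + 1 / 2) (poincare k n) δ z) :=
      (hasSum_poincare hk n (δ • z)).mul_left _
    rw [← h1.tsum_eq]
    have hinj : Function.Injective fun p : Gamma0Row => Matrix.vecMul p.1
        (δ : Matrix (Fin 2) (Fin 2) ℤ) := (vecMul_injective δ).comp Subtype.val_injective
    have h2 := (summable_lattice hs z).comp_injective hinj
    have h3 := tsum_of_norm_bounded (h2.mul_left (z.im ^ (-(1 / 8) : ℝ))).hasSum (fun p => by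
      refine (norm_weightTranslate_poincareTerm_le k hn p δ z).trans_eq ?_
      rw [autFactor_eq_bottomRow, bottomRow_mul, p.bottomRow_lift]
      rfl)
    refine h3.trans ?_
    rw [tsum_mul_left]
    refine mul_le_mul_of_nonneg_left ?_ (by have := z.im_pos; positivity)
    refine le_trans ?_ (hC z hz)
    exact tsum_comp_le_tsum_of_inj (summable_lattice hs z) (fun r => by positivity) hinj
  have hlim : Filter.Tendsto (fun y : ℝ => y ^ (-(1 / 8) : ℝ) * C) Filter.atTop (nhds 0) := by
    simpa using (tendsto_rpow_neg_atTop (by norm_num : (0 : ℝ) < 1 / 8)).mul_const C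
  refine squeeze_zero_norm' ?_ (hlim.comp Filter.tendsto_comap)
  exact (Filter.tendsto_comap (f := UpperHalfPlane.im).eventually
    (Filter.eventually_ge_atTop 1)).mono hbound

/-- Right multiplication by δ permutes the rows, and the cocycle relation, available because g ≠ 0,
matches the terms. -/
lemma poincare_mem_halfCuspForms {l : ℕ} {χ : DirichletCharacter ℂ 4} {g : ℍ → ℂ}
    (hg : g ∈ halfModularForms l χ) (hg0 : g ≠ 0) {k : ℕ} (hk : 2 ≤ k) {n : ℕ} (hn : 1 ≤ n) :
    poincare k n ∈ halfCuspForms k 1 := by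
  refine ⟨(locallyMajorized_poincareTerm hk n).mdifferentiable_tsum, fun δ hδ => ?_, fun δ => ?_⟩
  · rw [character_one_apply hδ, one_smul]
    ext z
    rw [halfSlash_apply]
    have h1 := (hasSum_poincare hk n (δ • z)).mul_left (halfSlash k 1 δ z)
    refine h1.unique ?_
    refine ((Gamma0Row.mulRight hδ).hasSum_iff.2 (hasSum_poincare hk n z)).congr_fun ?_
    intro p
    rw [Function.comp_apply, ← halfSlash_apply, poincareTerm, halfSlash_mul hg hg0 k _ p.lift_mem hδ]
    refine congrFun (halfSlash_eq_of_bottomRow_eq k (fun z => by rw [qOf_T_smul]) ?_) z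
    rw [Gamma0Row.bottomRow_lift]
    rfl
  · rw [cuspTranslate_eq]
    exact isZeroAtImInfty_poincare hk hn δ

end

section

open MeasureTheory Set CongruenceSubgroup

/-! ### Unfolding -/

lemma heightMeasure_absolutelyContinuous : heightMeasure ≪ volume :=
  (withDensity_absolutelyContinuous _ _).trans Measure.restrict_le_self.absolutelyContinuous

/-- By Fubini: for x ≠ ±1/2 the vertical line over x meets the boundary only at y = √(1-x²). -/
lemma volume_fd_diff_fdo : volume (ModularGroup.fd \ ModularGroup.fdo) = 0 := by
  have hm : MeasurableSet (ModularGroup.fd \ ModularGroup.fdo) :=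
    ModularGroup.isClosed_fd.measurableSet.diff ModularGroup.isOpen_fdo.measurableSet
  rw [← measurePreserving_pt.measure_preimage hm.nullMeasurableSet,
    Measure.measure_prod_null (measurable_pt hm)]
  have hfin : ({1 / 2, -1 / 2} : Set ℝ).Finite := by simp
  filter_upwards [compl_mem_ae_iff.2 (hfin.measure_zero volume)] with x hx
  refine measure_mono_null (t := Iic 0 ∪ {y | y = √(1 - x ^ 2)}) ?_ ?_
  · intro y hy
    by_contra hy'
    simp only [mem_union, mem_Iic, mem_ofPred_eq, not_or, not_le] at hy'
    obtain ⟨hy0, hy1⟩ := hy'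
    obtain ⟨⟨h1, h2⟩, h3⟩ := hy
    refine h3 ⟨lt_of_le_of_ne h1 fun h => hy1 ?_, lt_of_le_of_ne h2 fun h => hx ?_⟩
    · rw [coe_pt hy0, Complex.normSq_add_mul_I] at h
      rw [eq_comm, Real.sqrt_eq_iff_eq_sq (by nlinarith) hy0.le]
      linarith
    · rw [re_pt hy0] at h
      rcases abs_choice x with h' | h'
      · left; rw [← h, h']
      · right; rw [mem_singleton_iff]; linarith
  · refine measure_union_null ?_ ?_
    · rw [heightMeasure]
      refine withDensity_absolutelyContinuous _ _ ?_
      rw [Measure.restrict_apply measurableSet_Iic, inter_comm, Ioi_inter_Iic, Ioc_self,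
        measure_empty]
    · exact heightMeasure_absolutelyContinuous (by simp)

lemma measurePreserving_SL_smul (γ : SL(2, ℤ)) :
    MeasurePreserving (fun z : ℍ => γ • z) volume volume :=
  measurePreserving_smul (γ : GL (Fin 2) ℝ) volume

instance : Countable SL(2, ℤ) := by
  refine Function.Injective.countable (f := fun γ : SL(2, ℤ) => fun i j : Fin 2 => γ i j) ?_
  intro γ δ h
  ext i j
  exact congrFun (congrFun h i) j

/-- Almost every w avoids the countably many translates of the boundary. It is then carried into the
open domain by some γ₀, and -γ₀ is the only other matrix that carries it into the closed one. -/
lemma ae_tsum_indicator_fd : ∀ᵐ w : ℍ,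
    ∑' γ : SL(2, ℤ), (ModularGroup.fd.indicator 1 (γ • w) : ENNReal) = 2 := by
  have h : ∀ᵐ w : ℍ, ∀ γ : SL(2, ℤ), γ • w ∉ ModularGroup.fd \ ModularGroup.fdo := by
    refine ae_all_iff.2 fun γ => ?_
    have h0 : volume ((fun z : ℍ => γ • z) ⁻¹' (ModularGroup.fd \ ModularGroup.fdo)) = 0 :=
      (measurePreserving_SL_smul γ).quasiMeasurePreserving.preimage_null volume_fd_diff_fdo
    exact measure_eq_zero_iff_ae_notMem.1 h0
  filter_upwards [h] with w hw
  obtain ⟨γ₀, h0⟩ := ModularGroup.exists_smul_mem_fd w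
  have h1 : γ₀ • w ∈ ModularGroup.fdo := by
    by_contra h
    exact hw γ₀ ⟨h0, h⟩
  have hne : γ₀ ≠ -γ₀ := by
    intro h
    have h10 : γ₀ 1 0 = -γ₀ 1 0 := congrArg (fun γ : SL(2, ℤ) => γ 1 0) h
    have h11 : γ₀ 1 1 = -γ₀ 1 1 := congrArg (fun γ : SL(2, ℤ) => γ 1 1) h
    have h10' : γ₀ 1 0 = 0 := by omega
    have h11' : γ₀ 1 1 = 0 := by omega
    have := isCoprime_bottom_row γ₀
    rw [h10', h11'] at this
    exact not_isCoprime_zero_zero this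
  rw [tsum_eq_sum (s := {γ₀, -γ₀}), Finset.sum_pair hne]
  · rw [ModularGroup.SL_neg_smul, indicator_of_mem h0, Pi.one_apply, one_add_one_eq_two]
  · intro γ hγ
    refine indicator_of_notMem (fun h2 => hγ ?_) _
    have h3 : (γ * γ₀⁻¹) • (γ₀ • w) ∈ ModularGroup.fd := by
      rwa [← mul_smul, inv_mul_cancel_right]
    rcases ModularGroup.eq_one_or_neg_one_of_mem_fdo_mem_fd h1 h3 with h4 | h4
    · rw [mul_inv_eq_one] at h4
      simp [h4]
    · rw [mul_inv_eq_iff_eq_mul, neg_one_mul] at h4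
      simp [h4]

/-- The translates of the standard fundamental domain cover `ℍ` twice (by `γ` and `-γ`). -/
lemma sum_map_restrict_fd : Measure.sum (fun γ : SL(2, ℤ) =>
    ((volume : Measure ℍ).restrict ModularGroup.fd).map fun z => γ • z) = (2 : ENNReal) • volume := by
  have hfd : MeasurableSet ModularGroup.fd := ModularGroup.isClosed_fd.measurableSet
  ext s hs
  rw [Measure.sum_apply _ hs, Measure.smul_apply, smul_eq_mul]
  have h1 : ∀ γ : SL(2, ℤ), (((volume : Measure ℍ).restrict ModularGroup.fd).map
      fun z => γ • z) s = ∫⁻ w in s, ModularGroup.fd.indicator 1 (γ⁻¹ • w) := by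
    intro γ
    have hm := (measurePreserving_SL_smul γ).measurable
    rw [Measure.map_apply hm hs, Measure.restrict_apply (hm hs)]
    have h2 : (fun z : ℍ => γ⁻¹ • z) ⁻¹' ((fun z : ℍ => γ • z) ⁻¹' s ∩ ModularGroup.fd) =
        s ∩ (fun z : ℍ => γ⁻¹ • z) ⁻¹' ModularGroup.fd := by
      ext w; simp
    have hm' := (measurePreserving_SL_smul γ⁻¹).measurable
    rw [← (measurePreserving_SL_smul γ⁻¹).measure_preimage ((hm hs).inter hfd).nullMeasurableSet, h2,
      inter_comm, ← Measure.restrict_apply (hm' hfd), ← lintegral_indicator_one (hm' hfd)]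
    rfl
  simp_rw [h1]
  rw [← lintegral_tsum]
  · have h2 : ∀ w : ℍ, ∑' γ : SL(2, ℤ), (ModularGroup.fd.indicator 1 (γ⁻¹ • w) : ENNReal) =
        ∑' γ : SL(2, ℤ), (ModularGroup.fd.indicator 1 (γ • w) : ENNReal) := fun w =>
      (Equiv.inv SL(2, ℤ)).tsum_eq
        fun γ : SL(2, ℤ) => (ModularGroup.fd.indicator 1 (γ • w) : ENNReal)
    simp_rw [h2]
    rw [lintegral_congr_ae (ae_restrict_of_ae ae_tsum_indicator_fd), setLIntegral_const]
  · intro γ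
    exact ((measurable_one.indicator hfd).comp
      (measurePreserving_SL_smul γ⁻¹).measurable).aemeasurable

/-- Representatives of `ℍ` modulo integer translations. -/
def unitStrip : Set ℍ := {z | z.re ∈ Ioc (0 : ℝ) 1}

lemma measurableSet_unitStrip : MeasurableSet unitStrip :=
  measurableSet_Ioc.preimage continuous_re.measurable

/-- The decomposition of `SL₂(ℤ)` into right cosets of `Γ₀(4)`. -/
def rightCosetEquiv : (SL(2, ℤ) ⧸ Gamma0 4) × Gamma0 4 ≃ SL(2, ℤ) := by
  refine Equiv.ofBijective (fun x => (x.2 : SL(2, ℤ)) * x.1.out⁻¹) ⟨?_, ?_⟩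
  · rintro ⟨q, γ⟩ ⟨q', γ'⟩ h
    have h1 : (γ : SL(2, ℤ)) * q.out⁻¹ = γ' * q'.out⁻¹ := h
    have h2 := congrArg (fun δ : SL(2, ℤ) => ((δ⁻¹ : SL(2, ℤ)) : SL(2, ℤ) ⧸ Gamma0 4)) h1
    simp only [mul_inv_rev, inv_inv] at h2
    rw [QuotientGroup.mk_mul_of_mem _ (inv_mem γ.2), QuotientGroup.mk_mul_of_mem _ (inv_mem γ'.2),
      QuotientGroup.out_eq', QuotientGroup.out_eq'] at h2
    subst h2
    exact Prod.ext rfl (Subtype.ext (mul_right_cancel h1))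
  · intro δ
    obtain ⟨ε, hε⟩ := QuotientGroup.mk_out_eq_mul (Gamma0 4) δ⁻¹
    refine ⟨(((δ⁻¹ : SL(2, ℤ)) : SL(2, ℤ) ⧸ Gamma0 4), ε), ?_⟩
    simp only [hε]
    group

lemma tsum_indicator_unitStrip {F : ℍ → ℂ} (hT : ∀ z, F (ModularGroup.T • z) = F z) (w : ℍ) :
    ∑' x : ℤ × Gamma0Row, unitStrip.indicator F ((gamma0Equiv x : SL(2, ℤ)) • w) =
      ∑' p : Gamma0Row, F (p.lift • w) := by
  -- The unique integer translation that brings the point into the half-open strip 0 < x ≤ 1.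
  set m : Gamma0Row → ℤ := fun p => 1 - ⌈(p.lift • w).re⌉ with hm
  have hg : Function.Injective fun p : Gamma0Row => (m p, p) := fun p p' h => congrArg Prod.snd h
  have hval : ∀ x : ℤ × Gamma0Row, (gamma0Equiv x : SL(2, ℤ)) • w =
      ModularGroup.T ^ x.1 • x.2.lift • w := fun x => by rw [← mul_smul]; rfl
  have hiff : ∀ (j : ℤ) (z : ℍ), ModularGroup.T ^ j • z ∈ unitStrip ↔ j = 1 - ⌈z.re⌉ := by
    intro j z
    rw [unitStrip, mem_ofPred_eq, ModularGroup.re_T_zpow_smul, mem_Ioc]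
    constructor
    · rintro ⟨h1, h2⟩
      have : ⌈z.re⌉ = 1 - j := by
        rw [Int.ceil_eq_iff]
        push_cast
        constructor <;> linarith
      omega
    · rintro rfl
      have h1 := Int.le_ceil z.re
      have h2 := Int.ceil_lt_add_one z.re
      push_cast
      constructor <;> linarith
  rw [← hg.tsum_eq]
  · refine tsum_congr fun p => ?_
    rw [hval, indicator_of_mem ((hiff _ _).2 rfl), apply_T_zpow_smul hT]
  · intro x hx
    rw [Function.mem_support, hval] at hx
    have hx' := mem_of_indicator_ne_zero hx
    exact ⟨x.2, Prod.ext ((hiff _ _).1 hx').symm rfl⟩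

/-- The unfolding of the sum over `Γ∞\Γ₀(4)`, rows being counted with both signs. -/
theorem unfolding {F : ℍ → ℂ} (hF : Continuous F) (hT : ∀ z, F (ModularGroup.T • z) = F z)
    (hint : IntegrableOn F unitStrip) :
    ∑ q : SL(2, ℤ) ⧸ Gamma0 4, ∫ z in ModularGroup.fd, ∑' p : Gamma0Row,
      F (p.lift • (q.out⁻¹ • z)) = 2 * ∫ z in unitStrip, F z := by
  set G : ℍ → ℂ := unitStrip.indicator F with hG
  have hGm : StronglyMeasurable G := hF.stronglyMeasurable.indicator measurableSet_unitStrip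
  have hGi : Integrable G ((2 : ENNReal) • (volume : Measure ℍ)) :=
    ((integrable_indicator_iff measurableSet_unitStrip).2 hint).smul_measure (by simp)
  have hGs : ∀ γ : SL(2, ℤ), ∫ z, G z ∂(((volume : Measure ℍ).restrict ModularGroup.fd).map
      fun z => γ • z) = ∫ z in ModularGroup.fd, G (γ • z) := fun γ =>
    integral_map (measurePreserving_SL_smul γ).measurable.aemeasurable hGm.aestronglyMeasurable
  have hGl : ∀ γ : SL(2, ℤ), ∫⁻ z, ‖G z‖ₑ ∂(((volume : Measure ℍ).restrict ModularGroup.fd).map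
      fun z => γ • z) = ∫⁻ z in ModularGroup.fd, ‖G (γ • z)‖ₑ := fun γ =>
    lintegral_map hGm.measurable.enorm (measurePreserving_SL_smul γ).measurable
  -- The strip integral is spread over all SL₂(ℤ)-translates of the fundamental domain; these cover
  -- ℍ twice, whence the 2.
  have h1 : HasSum (fun γ : SL(2, ℤ) => ∫ z in ModularGroup.fd, G (γ • z))
      (2 * ∫ z in unitStrip, F z) := by
    rw [← sum_map_restrict_fd] at hGi
    have h := hasSum_integral_measure hGi
    rw [sum_map_restrict_fd, integral_smul_measure] at h
    simp_rw [hGs] at h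
    rw [hG, integral_indicator measurableSet_unitStrip] at h
    simpa using h
  -- The absolute version, which justifies taking the sum over Γ₀(4) back inside the integral.
  have h2 : ∑' γ : SL(2, ℤ), ∫⁻ z in ModularGroup.fd, ‖G (γ • z)‖ₑ ≠ ⊤ := by
    have h := hGi.2
    rw [HasFiniteIntegral, ← sum_map_restrict_fd, lintegral_sum_measure] at h
    simp_rw [hGl] at h
    exact h.ne
  have h3 := (rightCosetEquiv.hasSum_iff.2 h1)
  have h4 := h3.summable.tsum_prod
  rw [h3.tsum_eq, tsum_fintype] at h4
  rw [h4]
  refine Finset.sum_congr rfl fun q _ => ?_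
  rw [← gamma0Equiv.tsum_eq]
  have hinj : Function.Injective fun x : ℤ × Gamma0Row => rightCosetEquiv (q, gamma0Equiv x) :=
    fun x y h => gamma0Equiv.injective (congrArg Prod.snd (rightCosetEquiv.injective h))
  have h5 := integral_tsum (μ := (volume : Measure ℍ).restrict ModularGroup.fd)
    (f := fun (x : ℤ × Gamma0Row) z => G (rightCosetEquiv (q, gamma0Equiv x) • z))
    (fun x => (hGm.comp_measurable (measurePreserving_SL_smul _).measurable).aestronglyMeasurable)
    (ne_top_of_le_ne_top h2 (ENNReal.tsum_comp_le_tsum_of_injective hinj _))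
  rw [Function.comp_def, ← h5]
  refine integral_congr_ae (Filter.Eventually.of_forall fun z => ?_)
  simp only
  rw [← tsum_indicator_unitStrip hT]
  refine tsum_congr fun x => ?_
  rw [← mul_smul]
  rfl

end

section

open MeasureTheory Set CongruenceSubgroup

/-! ### Integrals over the unit strip -/

lemma ae_heightMeasure_pos : ∀ᵐ y ∂heightMeasure, 0 < y :=
  (withDensity_absolutelyContinuous _ _).ae_le (ae_restrict_mem measurableSet_Ioi)

lemma measurePreserving_pt_unitStrip : MeasurePreserving (fun p : ℝ × ℝ => pt p.1 p.2)
    (((volume : Measure ℝ).restrict (Ioc 0 1)).prod heightMeasure)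
    ((volume : Measure ℍ).restrict unitStrip) := by
  have h := measurePreserving_pt.restrict_preimage measurableSet_unitStrip
  have h1 : ((volume : Measure ℝ).restrict (Ioc 0 1)).prod heightMeasure =
      ((volume : Measure ℝ).prod heightMeasure).restrict (Ioc 0 1 ×ˢ univ) := by
    rw [← Measure.prod_restrict, Measure.restrict_univ]
  have h2 : ∀ᵐ p ∂((volume : Measure ℝ).prod heightMeasure), 0 < p.2 :=
    Measure.quasiMeasurePreserving_snd.ae ae_heightMeasure_pos
  rw [h1, Measure.restrict_congr_set (t := (fun p : ℝ × ℝ => pt p.1 p.2) ⁻¹' unitStrip)]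
  · exact h
  · filter_upwards [h2] with p hp
    refine propext ?_
    change p ∈ Ioc (0 : ℝ) 1 ×ˢ univ ↔ (pt p.1 p.2).re ∈ Ioc (0 : ℝ) 1
    rw [re_pt hp]
    simp

lemma integrable_heightMeasure_iff {φ : ℝ → ℝ} : Integrable φ heightMeasure ↔
    IntegrableOn (fun y => (y ^ 2)⁻¹ * φ y) (Ioi 0) := by
  rw [heightMeasure, integrable_withDensity_iff_integrable_smul' (by fun_prop) (by simp)]
  refine integrable_congr (Filter.Eventually.of_forall fun y => ?_)
  simp only [ENNReal.toReal_ofReal (by positivity : 0 ≤ (y ^ 2)⁻¹), smul_eq_mul]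

lemma integral_heightMeasure_real (φ : ℝ → ℝ) :
    ∫ y, φ y ∂heightMeasure = ∫ y in Ioi 0, (y ^ 2)⁻¹ * φ y := by
  rw [heightMeasure, integral_withDensity_eq_integral_toReal_smul (by fun_prop) (by simp)]
  refine integral_congr_ae (Filter.Eventually.of_forall fun y => ?_)
  simp only [ENNReal.toReal_ofReal (by positivity : 0 ≤ (y ^ 2)⁻¹), smul_eq_mul]

lemma continuous_pt {y : ℝ} (hy : 0 < y) : Continuous fun x => pt x y := by
  rw [isEmbedding_coe.continuous_iff]
  simp only [Function.comp_def, coe_pt hy]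
  fun_prop

lemma qOf_pt_pow (m : ℕ) (x : ℝ) {y : ℝ} (hy : 0 < y) : qOf (pt x y) ^ m =
    Complex.exp (2 * Real.pi * Complex.I * m * x) * (Real.exp (-(2 * Real.pi * m * y)) : ℝ) := by
  rw [qOf, coe_pt hy, ← Complex.exp_nat_mul, Complex.ofReal_exp, ← Complex.exp_add]
  congr 1
  push_cast
  ring_nf
  rw [Complex.I_sq]
  ring

lemma integral_exp_Ioc (j : ℤ) :
    ∫ x in Ioc (0 : ℝ) 1, Complex.exp (2 * Real.pi * Complex.I * j * x) = if j = 0 then 1 else 0 := by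
  split_ifs with h
  · simp [h]
  · have hc : 2 * Real.pi * Complex.I * (j : ℂ) ≠ 0 := by
      simp [Real.pi_ne_zero, h]
    rw [← intervalIntegral.integral_of_le zero_le_one, integral_exp_mul_complex hc]
    have : Complex.exp (2 * Real.pi * Complex.I * j) = 1 := by
      rw [Complex.exp_eq_one_iff]
      exact ⟨j, by ring⟩
    simp [this]

section Line

variable {f φ : ℍ → ℂ} {a c : ℕ → ℂ}

lemma summable_norm_fourier (hf : ∀ z : ℍ, HasSum (fun m : ℕ => a m * qOf z ^ m) (f z)) {y : ℝ}
    (hy : 0 < y) : Summable fun m : ℕ => ‖a m‖ * Real.exp (-(2 * Real.pi * m * y)) := by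
  have := (hf (pt 0 y)).summable.norm
  simpa only [norm_mul, norm_qOf_pow, im_pt hy] using this

lemma integrable_line (hf : Continuous f) {y : ℝ} (hy : 0 < y) :
    IntegrableOn (fun x => f (pt x y)) (Ioc 0 1) :=
  ((hf.comp (continuous_pt hy)).continuousOn.integrableOn_Icc).mono_set Ioc_subset_Icc_self

/-- Termwise integration of a Fourier series against a continuous function. -/
lemma hasSum_integral_line_mul (hf : ∀ z : ℍ, HasSum (fun m : ℕ => a m * qOf z ^ m) (f z)) {y : ℝ}
    (hy : 0 < y) {ψ : ℝ → ℂ} (hψ : Continuous ψ) :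
    HasSum (fun m : ℕ => ∫ x in Ioc (0 : ℝ) 1, a m * qOf (pt x y) ^ m * ψ x)
      (∫ x in Ioc (0 : ℝ) 1, f (pt x y) * ψ x) := by
  obtain ⟨C, hC⟩ := isCompact_Icc.exists_bound_of_continuousOn (s := Icc (0 : ℝ) 1) hψ.continuousOn
  have hcont : ∀ m : ℕ, Continuous fun x : ℝ => a m * qOf (pt x y) ^ m * ψ x := by
    intro m
    simp only [qOf_pt_pow _ _ hy]
    fun_prop
  have hint : ∀ m : ℕ, IntegrableOn (fun x : ℝ => a m * qOf (pt x y) ^ m * ψ x) (Ioc 0 1) :=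
    fun m => (hcont m).continuousOn.integrableOn_Icc.mono_set Ioc_subset_Icc_self
  have hsum : Summable fun m : ℕ => ∫ x in Ioc (0 : ℝ) 1, ‖a m * qOf (pt x y) ^ m * ψ x‖ := by
    refine Summable.of_nonneg_of_le (fun m => integral_nonneg fun x => norm_nonneg _) (fun m => ?_)
      ((summable_norm_fourier hf hy).mul_right C)
    have hle : ‖∫ x in Ioc (0 : ℝ) 1, ‖a m * qOf (pt x y) ^ m * ψ x‖‖ ≤
        ‖a m‖ * Real.exp (-(2 * Real.pi * m * y)) * C * (volume : Measure ℝ).real (Ioc 0 1) := by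
      refine norm_setIntegral_le_of_norm_le_const (by simp) fun x hx => ?_
      rw [norm_norm, norm_mul, norm_mul, norm_qOf_pow, im_pt hy]
      gcongr
      exact hC x (Ioc_subset_Icc_self hx)
    refine (Real.le_norm_self _).trans (hle.trans_eq ?_)
    simp
  have heq : ∀ x : ℝ, f (pt x y) * ψ x = ∑' m : ℕ, a m * qOf (pt x y) ^ m * ψ x := fun x => by
    rw [tsum_mul_right, (hf (pt x y)).tsum_eq]
  simp_rw [heq]
  exact hasSum_integral_of_summable_integral_norm hint hsum

lemma integral_line_mul_exp (hφ : ∀ z : ℍ, HasSum (fun m : ℕ => c m * qOf z ^ m) (φ z)) {y : ℝ}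
    (hy : 0 < y) (m : ℕ) :
    ∫ x in Ioc (0 : ℝ) 1, φ (pt x y) * Complex.exp (2 * Real.pi * Complex.I * (-m : ℤ) * x) =
      c m * (Real.exp (-(2 * Real.pi * m * y)) : ℝ) := by
  refine (hasSum_integral_line_mul hφ hy (by fun_prop)).unique ?_
  have h1 : ∀ j : ℕ, ∫ x in Ioc (0 : ℝ) 1, c j * qOf (pt x y) ^ j *
      Complex.exp (2 * Real.pi * Complex.I * (-m : ℤ) * x) =
      if j = m then c m * (Real.exp (-(2 * Real.pi * m * y)) : ℝ) else 0 := by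
    intro j
    have h2 : ∀ x : ℝ, c j * qOf (pt x y) ^ j *
        Complex.exp (2 * Real.pi * Complex.I * (-m : ℤ) * x) =
        c j * (Real.exp (-(2 * Real.pi * j * y)) : ℝ) *
          Complex.exp (2 * Real.pi * Complex.I * ((j - m : ℤ) : ℂ) * x) := by
      intro x
      have h3 : Complex.exp (2 * Real.pi * Complex.I * ((j - m : ℤ) : ℂ) * x) =
          Complex.exp (2 * Real.pi * Complex.I * j * x) *
            Complex.exp (2 * Real.pi * Complex.I * (-m : ℤ) * x) := by
        rw [← Complex.exp_add]
        congr 1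
        push_cast
        ring
      rw [h3, qOf_pt_pow _ _ hy]
      ring
    simp_rw [h2]
    rw [integral_const_mul, integral_exp_Ioc]
    rcases eq_or_ne j m with rfl | hne
    · simp
    · rw [if_neg hne, if_neg (by omega), mul_zero]
  simp_rw [h1]
  exact hasSum_ite_eq m _

/-- Parseval's formula on a horizontal line. -/
lemma hasSum_line (hf : ∀ z : ℍ, HasSum (fun m : ℕ => a m * qOf z ^ m) (f z))
    (hφ : ∀ z : ℍ, HasSum (fun m : ℕ => c m * qOf z ^ m) (φ z)) (hφc : Continuous φ) {y : ℝ}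
    (hy : 0 < y) :
    HasSum (fun m : ℕ => a m * conj (c m) * (Real.exp (-(4 * Real.pi * m * y)) : ℝ))
      (∫ x in Ioc (0 : ℝ) 1, f (pt x y) * conj (φ (pt x y))) := by
  have h := hasSum_integral_line_mul hf hy
    (Complex.continuous_conj.comp (hφc.comp (continuous_pt hy)))
  refine h.congr_fun fun m => ?_
  have h1 : ∀ x : ℝ, a m * qOf (pt x y) ^ m * conj (φ (pt x y)) =
      a m * (Real.exp (-(2 * Real.pi * m * y)) : ℝ) *
        conj (φ (pt x y) * Complex.exp (2 * Real.pi * Complex.I * (-m : ℤ) * x)) := by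
    intro x
    rw [map_mul, ← Complex.exp_conj, qOf_pt_pow _ _ hy]
    have : conj (2 * Real.pi * Complex.I * ((-m : ℤ) : ℂ) * x) = 2 * Real.pi * Complex.I * m * x := by
      simp only [map_mul, Complex.conj_ofReal, Complex.conj_I, map_ofNat, map_intCast]
      push_cast
      ring
    rw [this]
    ring
  simp only [Function.comp_apply]
  simp_rw [h1]
  rw [integral_const_mul, integral_conj, integral_line_mul_exp hφ hy, map_mul, Complex.conj_ofReal]
  have h2 : Real.exp (-(4 * Real.pi * m * y)) =
      Real.exp (-(2 * Real.pi * m * y)) * Real.exp (-(2 * Real.pi * m * y)) := by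
    rw [← Real.exp_add]
    congr 1
    ring
  rw [h2]
  push_cast
  ring

lemma hasSum_line_sq (hf : ∀ z : ℍ, HasSum (fun m : ℕ => a m * qOf z ^ m) (f z)) (hfc : Continuous f)
    {y : ℝ} (hy : 0 < y) :
    HasSum (fun m : ℕ => ‖a m‖ ^ 2 * Real.exp (-(4 * Real.pi * m * y)))
      (∫ x in Ioc (0 : ℝ) 1, ‖f (pt x y)‖ ^ 2) := by
  have h := hasSum_line hf hf hfc hy
  rw [← Complex.hasSum_ofReal, ← integral_complex_ofReal]
  simp only [Complex.mul_conj, Complex.normSq_eq_norm_sq] at h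
  refine (h.congr_fun fun m => ?_)
  push_cast
  rfl

end Line

/-- Against dy/y² this is the Gamma integral of y^(κ-2), which converges at 0 because κ > 1. -/
lemma integral_heightMeasure_exp {κ : ℝ} (hκ : 1 < κ) {m : ℕ} (hm : m ≠ 0) :
    Integrable (fun y => Real.exp (-(4 * Real.pi * m * y)) * y ^ κ) heightMeasure ∧
    ∫ y, Real.exp (-(4 * Real.pi * m * y)) * y ^ κ ∂heightMeasure =
      Real.Gamma (κ - 1) / (4 * Real.pi * m) ^ (κ - 1) := by
  have hm' : 0 < 4 * Real.pi * m := by positivity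
  have heq : EqOn (fun y : ℝ => (y ^ 2)⁻¹ * (Real.exp (-(4 * Real.pi * m * y)) * y ^ κ))
      (fun y => y ^ (κ - 1 - 1) * Real.exp (-(4 * Real.pi * m * y))) (Ioi 0) := by
    intro y hy
    have hy' : (0 : ℝ) < y := hy
    simp only
    have : y ^ (κ - 1 - 1) = (y ^ 2)⁻¹ * y ^ κ := by
      rw [← Real.rpow_natCast, ← Real.rpow_neg hy'.le, ← Real.rpow_add hy']
      congr 1
      push_cast
      ring
    rw [this]
    ring
  constructor
  · rw [integrable_heightMeasure_iff, integrableOn_congr_fun heq measurableSet_Ioi]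
    have := Real.GammaIntegral_convergent (by linarith : 0 < κ - 1)
    have h2 := (integrableOn_Ioi_comp_mul_left_iff (fun y : ℝ => Real.exp (-y) * y ^ (κ - 1 - 1)) 0
      hm').2 (by rwa [mul_zero])
    refine IntegrableOn.congr_fun (h2.const_mul ((4 * Real.pi * m) ^ (κ - 1 - 1))⁻¹) ?_
      measurableSet_Ioi
    intro y hy
    have hy' : (0 : ℝ) < y := hy
    simp only
    rw [Real.mul_rpow hm'.le hy'.le]
    have : (4 * Real.pi * m) ^ (κ - 1 - 1) ≠ 0 := (Real.rpow_pos_of_pos hm' _).ne'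
    generalize (4 * Real.pi * m) ^ (κ - 1 - 1) = t at *
    field_simp
  · rw [integral_heightMeasure_real, setIntegral_congr_fun measurableSet_Ioi heq,
      Real.integral_rpow_mul_exp_neg_mul_Ioi (by linarith) hm', one_div,
      Real.inv_rpow hm'.le]
    ring

end

/-! ### The Petersson integral over the strip by Parseval -/

section

open MeasureTheory Set CongruenceSubgroup

/-- A substitute for Cauchy–Schwarz: if the mean squares of u and v are at most A² and B², the
weights B/A and A/B balance the two terms and the mean of uv is at most AB. It works alike for
integrals over x and for sums of coefficients. -/
lemma mul_le_weighted_sq {u v A B : ℝ} (hA : 0 < A) (hB : 0 < B) :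
    u * v ≤ (B / A * u ^ 2 + A / B * v ^ 2) / 2 := by
  have h : 0 ≤ (B * u - A * v) ^ 2 / (A * B) := by positivity
  have h2 : (B * u - A * v) ^ 2 / (A * B) = B / A * u ^ 2 + A / B * v ^ 2 - 2 * (u * v) := by
    field_simp
    ring
  linarith

lemma weighted_sq_le {u v A B : ℝ} (hA : 0 < A) (hB : 0 < B) (hu : u ≤ A ^ 2) (hv : v ≤ B ^ 2) :
    (B / A * u + A / B * v) / 2 ≤ A * B := by
  have h1 : B / A * u ≤ B / A * A ^ 2 := by gcongr
  have h2 : A / B * v ≤ A / B * B ^ 2 := by gcongr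
  have h3 : B / A * A ^ 2 = A * B := by field_simp
  have h4 : A / B * B ^ 2 = A * B := by field_simp
  linarith

section Strip

variable {f φ : ℍ → ℂ} {a c : ℕ → ℂ} {A B : ℝ → ℝ}

lemma integral_line_sq_le (hfc : Continuous f) (hfA : ∀ z : ℍ, ‖f z‖ ≤ A z.im) {y : ℝ} (hy : 0 < y) :
    ∫ x in Ioc (0 : ℝ) 1, ‖f (pt x y)‖ ^ 2 ≤ A y ^ 2 := by
  have h1 : Continuous fun x => ‖f (pt x y)‖ ^ 2 := (hfc.comp (continuous_pt hy)).norm.pow 2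
  calc _ ≤ ∫ x in Ioc (0 : ℝ) 1, A y ^ 2 := by
        refine setIntegral_mono (h1.continuousOn.integrableOn_Icc.mono_set Ioc_subset_Icc_self)
          (by simp) fun x => ?_
        have := hfA (pt x y)
        rw [im_pt hy] at this
        dsimp only
        gcongr
    _ = A y ^ 2 := by simp

lemma integral_line_mul_le (hfc : Continuous f) (hφc : Continuous φ)
    (hA : ∀ y, 0 < y → 0 < A y) (hB : ∀ y, 0 < y → 0 < B y)
    (hfA : ∀ y, 0 < y → ∫ x in Ioc (0 : ℝ) 1, ‖f (pt x y)‖ ^ 2 ≤ A y ^ 2)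
    (hφB : ∀ y, 0 < y → ∫ x in Ioc (0 : ℝ) 1, ‖φ (pt x y)‖ ^ 2 ≤ B y ^ 2) {y : ℝ} (hy : 0 < y) :
    ∫ x in Ioc (0 : ℝ) 1, ‖f (pt x y)‖ * ‖φ (pt x y)‖ ≤ A y * B y := by
  have hf1 : Continuous fun x => ‖f (pt x y)‖ := (hfc.comp (continuous_pt hy)).norm
  have hφ1 : Continuous fun x => ‖φ (pt x y)‖ := (hφc.comp (continuous_pt hy)).norm
  have hint : ∀ {ψ : ℝ → ℝ}, Continuous ψ → IntegrableOn ψ (Ioc 0 1) := fun hψ =>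
    hψ.continuousOn.integrableOn_Icc.mono_set Ioc_subset_Icc_self
  calc _ ≤ ∫ x in Ioc (0 : ℝ) 1, (B y / A y * ‖f (pt x y)‖ ^ 2 + A y / B y * ‖φ (pt x y)‖ ^ 2) / 2 :=
        setIntegral_mono (hint (by fun_prop)) (hint (by fun_prop)) fun x =>
          mul_le_weighted_sq (hA y hy) (hB y hy)
    _ = (B y / A y * (∫ x in Ioc (0 : ℝ) 1, ‖f (pt x y)‖ ^ 2) +
          A y / B y * ∫ x in Ioc (0 : ℝ) 1, ‖φ (pt x y)‖ ^ 2) / 2 := by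
        rw [integral_div, integral_add (hint (by fun_prop)) (hint (by fun_prop)),
          integral_const_mul, integral_const_mul]
    _ ≤ A y * B y := weighted_sq_le (hA y hy) (hB y hy) (hfA y hy) (hφB y hy)

lemma sum_coeff_mul_le (hf : ∀ z : ℍ, HasSum (fun m : ℕ => a m * qOf z ^ m) (f z))
    (hφ : ∀ z : ℍ, HasSum (fun m : ℕ => c m * qOf z ^ m) (φ z))
    (hfc : Continuous f) (hφc : Continuous φ)
    (hA : ∀ y, 0 < y → 0 < A y) (hB : ∀ y, 0 < y → 0 < B y)
    (hfA : ∀ y, 0 < y → ∫ x in Ioc (0 : ℝ) 1, ‖f (pt x y)‖ ^ 2 ≤ A y ^ 2)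
    (hφB : ∀ y, 0 < y → ∫ x in Ioc (0 : ℝ) 1, ‖φ (pt x y)‖ ^ 2 ≤ B y ^ 2) {y : ℝ} (hy : 0 < y)
    (s : Finset ℕ) :
    ∑ m ∈ s, ‖a m * conj (c m)‖ * Real.exp (-(4 * Real.pi * m * y)) ≤ A y * B y := by
  have hA0 := hA y hy
  have hB0 := hB y hy
  have ha := hasSum_line_sq hf hfc hy
  have hc := hasSum_line_sq hφ hφc hy
  calc _ ≤ ∑ m ∈ s, (B y / A y * (‖a m‖ ^ 2 * Real.exp (-(4 * Real.pi * m * y))) +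
          A y / B y * (‖c m‖ ^ 2 * Real.exp (-(4 * Real.pi * m * y)))) / 2 := by
        refine Finset.sum_le_sum fun m _ => ?_
        rw [norm_mul, RCLike.norm_conj]
        have := mul_le_mul_of_nonneg_right (mul_le_weighted_sq (u := ‖a m‖) (v := ‖c m‖) hA0 hB0)
          (Real.exp_pos (-(4 * Real.pi * m * y))).le
        linarith
    _ = (B y / A y * (∑ m ∈ s, ‖a m‖ ^ 2 * Real.exp (-(4 * Real.pi * m * y))) +
          A y / B y * ∑ m ∈ s, ‖c m‖ ^ 2 * Real.exp (-(4 * Real.pi * m * y))) / 2 := by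
        rw [Finset.mul_sum, Finset.mul_sum, ← Finset.sum_add_distrib, Finset.sum_div]
    _ ≤ A y * B y := weighted_sq_le hA0 hB0
        ((sum_le_hasSum s (fun m _ => by positivity) ha).trans (hfA y hy))
        ((sum_le_hasSum s (fun m _ => by positivity) hc).trans (hφB y hy))

lemma integrable_heightMeasure_of_rpow {κ : ℝ} {h : ℝ → ℝ}
    (hh : IntegrableOn (fun y => h y * y ^ (κ - 2)) (Ioi 0)) :
    Integrable (fun y => h y * y ^ κ) heightMeasure := by
  rw [integrable_heightMeasure_iff]
  refine hh.congr_fun (fun y hy => ?_) measurableSet_Ioi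
  have hy' : (0 : ℝ) < y := hy
  simp only
  rw [Real.rpow_sub hy', Real.rpow_ofNat]
  ring

/-- The integral of `f conj(φ) y^κ` over the strip in terms of the Fourier coefficients. -/
theorem strip_integral {κ : ℝ} (hκ : 1 < κ)
    (hf : ∀ z : ℍ, HasSum (fun m : ℕ => a m * qOf z ^ m) (f z))
    (hφ : ∀ z : ℍ, HasSum (fun m : ℕ => c m * qOf z ^ m) (φ z))
    (hfc : Continuous f) (hφc : Continuous φ) (ha0 : a 0 = 0)
    (hA : ∀ y, 0 < y → 0 < A y) (hB : ∀ y, 0 < y → 0 < B y)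
    (hfA : ∀ y, 0 < y → ∫ x in Ioc (0 : ℝ) 1, ‖f (pt x y)‖ ^ 2 ≤ A y ^ 2)
    (hφB : ∀ y, 0 < y → ∫ x in Ioc (0 : ℝ) 1, ‖φ (pt x y)‖ ^ 2 ≤ B y ^ 2)
    (hAB : IntegrableOn (fun y => A y * B y * y ^ (κ - 2)) (Ioi 0)) :
    IntegrableOn (peterssonDensity κ f φ) unitStrip ∧
    HasSum (fun m : ℕ => a m * conj (c m) *
      ((Real.Gamma (κ - 1) / (4 * Real.pi * m) ^ (κ - 1) : ℝ) : ℂ))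
      (∫ z in unitStrip, peterssonDensity κ f φ z) := by
  have hABκ : Integrable (fun y => A y * B y * y ^ κ) heightMeasure :=
    integrable_heightMeasure_of_rpow hAB
  have hdc : Continuous (peterssonDensity κ f φ) := continuous_peterssonDensity hfc hφc
  have hdm : StronglyMeasurable fun p : ℝ × ℝ => peterssonDensity κ f φ (pt p.1 p.2) :=
    hdc.stronglyMeasurable.comp_measurable measurable_pt
  have hint : Integrable (fun p : ℝ × ℝ => peterssonDensity κ f φ (pt p.1 p.2))
      (((volume : Measure ℝ).restrict (Ioc 0 1)).prod heightMeasure) := by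
    rw [integrable_prod_iff' hdm.aestronglyMeasurable]
    constructor
    · filter_upwards [ae_heightMeasure_pos] with y hy
      exact integrable_line hdc hy
    · refine hABκ.mono' hdm.norm.integral_prod_left'.aestronglyMeasurable ?_
      filter_upwards [ae_heightMeasure_pos] with y hy
      rw [Real.norm_of_nonneg (integral_nonneg fun x => norm_nonneg _)]
      simp only [norm_peterssonDensity, im_pt hy]
      rw [integral_mul_const]
      gcongr
      exact integral_line_mul_le hfc hφc hA hB hfA hφB hy
  refine ⟨(measurePreserving_pt_unitStrip.integrable_comp
    hdc.stronglyMeasurable.aestronglyMeasurable).1 hint, ?_⟩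
  set F : ℕ → ℝ → ℂ := fun m y =>
    a m * conj (c m) * ((Real.exp (-(4 * Real.pi * m * y)) * y ^ κ : ℝ) : ℂ) with hF
  have hFi : ∀ m, Integrable (F m) heightMeasure := by
    intro m
    rcases eq_or_ne m 0 with rfl | hm
    -- For m = 0 there is no exponential decay; the term is harmless only because f has no constant
    -- coefficient.
    · simp [hF, ha0]
    · exact ((integral_heightMeasure_exp hκ hm).1.ofReal).const_mul _
  have hFv : ∀ m, ∫ y, F m y ∂heightMeasure = a m * conj (c m) *
      ((Real.Gamma (κ - 1) / (4 * Real.pi * m) ^ (κ - 1) : ℝ) : ℂ) := by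
    intro m
    rcases eq_or_ne m 0 with rfl | hm
    · simp [hF, ha0]
    · simp only [hF]
      rw [integral_const_mul, integral_complex_ofReal, (integral_heightMeasure_exp hκ hm).2]
  -- At each height every partial sum is at most A(y) B(y) y^κ. Integrating this gives a bound
  -- independent of the partial sum, hence the absolute convergence of the Dirichlet series.
  have hFs : Summable fun m => ∫ y, ‖F m y‖ ∂heightMeasure := by
    refine summable_of_sum_le (c := ∫ y, A y * B y * y ^ κ ∂heightMeasure)
      (fun m => integral_nonneg fun y => norm_nonneg _) fun s => ?_
    rw [← integral_finsetSum _ fun m _ => (hFi m).norm]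
    refine integral_mono_ae (integrable_finsetSum _ fun m _ => (hFi m).norm) hABκ ?_
    filter_upwards [ae_heightMeasure_pos] with y hy
    have h := sum_coeff_mul_le hf hφ hfc hφc hA hB hfA hφB hy s
    refine le_trans (le_of_eq ?_) (mul_le_mul_of_nonneg_right h (by positivity : 0 ≤ y ^ κ))
    rw [Finset.sum_mul]
    refine Finset.sum_congr rfl fun m _ => ?_
    simp only [hF]
    rw [norm_mul, Complex.norm_real, Real.norm_of_nonneg (by positivity)]
    ring
  have h := hasSum_integral_of_summable_integral_norm hFi hFs
  simp_rw [hFv] at h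
  have heq : ∫ z in unitStrip, peterssonDensity κ f φ z = ∫ y, ∑' m, F m y ∂heightMeasure := by
    rw [← measurePreserving_pt_unitStrip.map_eq,
      integral_map measurable_pt.aemeasurable hdc.stronglyMeasurable.aestronglyMeasurable,
      integral_prod_symm _ hint]
    refine integral_congr_ae ?_
    filter_upwards [ae_heightMeasure_pos] with y hy
    simp only [peterssonDensity, im_pt hy]
    rw [integral_mul_const, ← (hasSum_line hf hφ hφc hy).tsum_eq, ← tsum_mul_right]
    refine tsum_congr fun m => ?_
    simp only [hF]
    push_cast
    ring
  rw [heq]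
  exact h

end Strip

end

section

open MeasureTheory Set CongruenceSubgroup

/-! ### Mean square bounds on horizontal lines -/

section MeanSquare

variable {κ : ℝ} {f : ℍ → ℂ}

/-- Up to a factor of modulus one a translate depends only on the right coset Γ₀(4)γ. There are
finitely many of these, and each translate is continuous and bounded at i∞. -/
lemma IsForm.exists_fd_bound (hf : IsForm κ f) :
    ∃ C, 0 ≤ C ∧ ∀ γ : SL(2, ℤ), ∀ w ∈ ModularGroup.fd, ‖weightTranslate κ f γ w‖ ≤ C := by
  have h1 : ∀ q : SL(2, ℤ) ⧸ Gamma0 4, ∃ C, ∀ w ∈ ModularGroup.fd,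
      ‖weightTranslate κ f q.out⁻¹ w‖ ≤ C := by
    intro q
    obtain ⟨C, hC⟩ := ModularGroup.exists_bound_fundamental_domain_of_isBigO (t := 0)
      (mdifferentiable_weightTranslate κ hf.mdiff q.out⁻¹).continuous (by
        refine (hf.bdd q.out⁻¹).congr_right fun z => ?_
        simp)
    exact ⟨C, fun w hw => by simpa using hC w hw⟩
  choose C hC using h1
  refine ⟨∑ q, |C q|, Finset.sum_nonneg fun q _ => abs_nonneg _, fun γ w hw => ?_⟩
  obtain ⟨⟨q, ε⟩, rfl⟩ := rightCosetEquiv.surjective γ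
  have h2 : ‖weightTranslate κ f (rightCosetEquiv (q, ε)) w‖ = ‖weightTranslate κ f q.out⁻¹ w‖ := by
    obtain ⟨u, hu, h⟩ := hf.inv ε ε.2
    have h3 := congrArg norm (congrFun h (q.out⁻¹ • w))
    rw [norm_weightTranslate, Pi.smul_apply, norm_smul, norm_of_pow_four hu, one_mul] at h3
    change ‖weightTranslate κ f ((ε : SL(2, ℤ)) * q.out⁻¹) w‖ = _
    rw [norm_weightTranslate, norm_weightTranslate, autFactor_mul, norm_mul,
      Real.mul_rpow (norm_nonneg _) (norm_nonneg _), mul_smul, ← h3]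
    ring
  rw [h2]
  calc _ ≤ C q := hC q w hw
    _ ≤ |C q| := le_abs_self _
    _ ≤ ∑ q, |C q| := Finset.single_le_sum (f := fun q => |C q|) (fun q _ => abs_nonneg _)
        (Finset.mem_univ q)

/-- The quantity |f|² y^κ is carried along when z is moved into the fundamental domain, where the
corresponding translate of f is bounded. The size of f at z is thus governed by the height of the
image. -/
lemma IsForm.exists_height_bound (hf : IsForm κ f) :
    ∃ C, 0 ≤ C ∧ ∀ z : ℍ, ∃ γ : SL(2, ℤ),
      ‖f z‖ ^ 2 * z.im ^ κ ≤ C * (γ • z).im ^ κ := by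
  obtain ⟨C, hC0, hC⟩ := hf.exists_fd_bound
  refine ⟨C ^ 2, by positivity, fun z => ?_⟩
  obtain ⟨γ, hγ⟩ := ModularGroup.exists_smul_mem_fd z
  refine ⟨γ, ?_⟩
  have h1 := norm_weightTranslate_mul_im κ f γ⁻¹ (γ • z)
  rw [inv_smul_smul] at h1
  have h2 := hC γ⁻¹ _ hγ
  have h3 : ∀ w : ℍ, w.im ^ κ = (w.im ^ (κ / 2)) ^ 2 := fun w => by
    rw [← Real.rpow_natCast, ← Real.rpow_mul w.im_pos.le]
    congr 1
    push_cast
    ring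
  rw [h3, h3, ← mul_pow, ← mul_pow, ← h1]
  have := (γ • z).im_pos
  gcongr

/-- The points of a horizontal line close to the rationals `-d/c` with `1 ≤ c ≤ N`. -/
def majorArcs (N : ℕ) (ρ : ℝ) : Set ℝ :=
  ⋃ c ∈ Finset.Icc 1 N, ⋃ d ∈ Finset.Icc (-(2 * c : ℤ)) (2 * c), {x : ℝ | |c * x + d| ≤ ρ}

lemma measurableSet_majorArcs (N : ℕ) (ρ : ℝ) : MeasurableSet (majorArcs N ρ) := by
  refine Finset.measurableSet_biUnion _ fun c _ => Finset.measurableSet_biUnion _ fun d _ => ?_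
  exact measurableSet_le (by fun_prop) measurable_const

/-- For each c there are 4c+1 ≤ 5c intervals of length 2ρ/c, so at most 10ρ in total. -/
lemma volume_majorArcs_le (N : ℕ) {ρ : ℝ} (hρ : 0 ≤ ρ) :
    volume (majorArcs N ρ) ≤ ENNReal.ofReal (10 * N * ρ) := by
  have h1 : ∀ c ∈ Finset.Icc 1 N, ∀ d : ℤ,
      volume {x : ℝ | |c * x + d| ≤ ρ} ≤ ENNReal.ofReal (2 * ρ / c) := by
    intro c hc d
    have hc1 : 1 ≤ c := (Finset.mem_Icc.1 hc).1
    have hc0 : (0 : ℝ) < c := by exact_mod_cast hc1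
    have : {x : ℝ | |c * x + d| ≤ ρ} ⊆ Icc ((-ρ - d) / c) ((ρ - d) / c) := by
      intro x hx
      have hx' := abs_le.1 (show |c * x + d| ≤ ρ from hx)
      constructor
      · rw [div_le_iff₀ hc0]; linarith
      · rw [le_div_iff₀ hc0]; linarith
    refine (measure_mono this).trans ?_
    rw [Real.volume_Icc]
    refine ENNReal.ofReal_le_ofReal (le_of_eq ?_)
    ring
  calc volume (majorArcs N ρ)
      ≤ ∑ c ∈ Finset.Icc 1 N, ∑ d ∈ Finset.Icc (-(2 * c : ℤ)) (2 * c),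
          volume {x : ℝ | |c * x + d| ≤ ρ} :=
        (measure_biUnion_finset_le _ _).trans (Finset.sum_le_sum fun c _ =>
          measure_biUnion_finset_le _ _)
    _ ≤ ∑ c ∈ Finset.Icc 1 N, ENNReal.ofReal (10 * ρ) := by
        refine Finset.sum_le_sum fun c hc => ?_
        have hc1 : 1 ≤ c := (Finset.mem_Icc.1 hc).1
        have hc0 : (1 : ℝ) ≤ c := by exact_mod_cast hc1
        refine (Finset.sum_le_sum fun d _ => h1 c hc d).trans ?_
        rw [Finset.sum_const, Int.card_Icc, nsmul_eq_mul, ← ENNReal.ofReal_natCast,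
          ← ENNReal.ofReal_mul (by positivity)]
        refine ENNReal.ofReal_le_ofReal ?_
        have : (((2 * (c : ℤ) + 1 - -(2 * (c : ℤ))).toNat : ℕ) : ℝ) = 4 * c + 1 := by
          have : (2 * (c : ℤ) + 1 - -(2 * (c : ℤ))).toNat = 4 * c + 1 := by omega
          rw [this]
          push_cast
          ring
        rw [this, mul_div_assoc', div_le_iff₀ (by linarith)]
        nlinarith
    _ = ENNReal.ofReal (10 * N * ρ) := by
        rw [Finset.sum_const, Nat.card_Icc, nsmul_eq_mul, ← ENNReal.ofReal_natCast,
          ← ENNReal.ofReal_mul (by positivity)]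
        congr 1
        push_cast [Nat.add_sub_cancel]
        ring

lemma sq_norm_autFactor_pt (γ : SL(2, ℤ)) (x : ℝ) {y : ℝ} (hy : 0 < y) :
    ‖autFactor γ (pt x y)‖ ^ 2 = ((γ 1 0 : ℝ) * x + γ 1 1) ^ 2 + ((γ 1 0 : ℝ) * y) ^ 2 := by
  rw [autFactor, coe_pt hy, ← Complex.normSq_eq_norm_sq, Complex.normSq_apply]
  simp
  ring

/-- Points of large height lie over the major arcs. -/
lemma height_dichotomy {x y : ℝ} (hx : x ∈ Ioc (0 : ℝ) 1) (hy : 0 < y) (hy1 : y < 1)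
    (γ : SL(2, ℤ)) : (γ • pt x y).im ≤ y ^ (-(1 / 2) : ℝ) ∨
      (γ • pt x y).im ≤ y⁻¹ ∧ x ∈ majorArcs ⌊y ^ (-(1 / 4) : ℝ)⌋₊ (y ^ (3 / 4 : ℝ)) := by
  rw [or_iff_not_imp_left, not_le]
  intro h
  have hj := norm_pos_iff.2 (autFactor_ne_zero γ (pt x y))
  rw [im_smul_eq, im_pt hy] at h ⊢
  have hJ := sq_norm_autFactor_pt γ x hy
  set J := ‖autFactor γ (pt x y)‖ ^ 2 with hJd
  have hJ0 : 0 < J := by positivity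
  have hT : 1 ≤ y ^ (-(1 / 2) : ℝ) :=
    Real.one_le_rpow_of_pos_of_le_one_of_nonpos hy hy1.le (by norm_num)
  -- The height is y/J with J = (cx+d)² + (cy)². Height above y^(-1/2) thus forces |cx+d| ≤ y^(3/4)
  -- and |c| ≤ y^(-1/4), which are the parameters of the arcs.
  have hJ1 : J ≤ y ^ (3 / 2 : ℝ) := by
    rw [lt_div_iff₀ hJ0] at h
    have h2 : y ^ (3 / 2 : ℝ) * y ^ (-(1 / 2) : ℝ) = y := by
      rw [← Real.rpow_add hy]; norm_num
    nlinarith [Real.rpow_pos_of_pos hy (-(1 / 2) : ℝ)]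
  -- For c = 0 the height is y itself, which is less than 1 and hence not large.
  have hc0 : γ 1 0 ≠ 0 := by
    intro hc
    have hd : IsUnit (γ 1 1) := by
      have := isCoprime_bottom_row γ
      rwa [hc, isCoprime_zero_left] at this
    have hd2 : ((γ 1 1 : ℤ) : ℝ) ^ 2 = 1 := by
      rcases Int.isUnit_iff.1 hd with hd | hd <;> rw [hd] <;> norm_num
    rw [hc] at hJ
    have : J = 1 := by rw [hJ]; push_cast; nlinarith
    rw [this, div_one] at h
    linarith
  have hc1 : (1 : ℝ) ≤ |(γ 1 0 : ℝ)| := by exact_mod_cast Int.one_le_abs hc0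
  have h1 : |(γ 1 0 : ℝ) * x + γ 1 1| ≤ y ^ (3 / 4 : ℝ) := by
    refine abs_le_of_sq_le_sq ?_ (by positivity)
    rw [← Real.rpow_natCast (y ^ _), ← Real.rpow_mul hy.le]
    norm_num
    nlinarith [sq_nonneg ((γ 1 0 : ℝ) * y)]
  have h2 : |(γ 1 0 : ℝ)| ≤ y ^ (-(1 / 4) : ℝ) := by
    have h3 : |(γ 1 0 : ℝ) * y| ≤ y ^ (3 / 4 : ℝ) := by
      refine abs_le_of_sq_le_sq ?_ (by positivity)
      rw [← Real.rpow_natCast (y ^ _), ← Real.rpow_mul hy.le]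
      norm_num
      nlinarith [sq_nonneg ((γ 1 0 : ℝ) * x + γ 1 1)]
    rw [abs_mul, abs_of_pos hy] at h3
    have h4 : y ^ (3 / 4 : ℝ) = y ^ (-(1 / 4) : ℝ) * y := by
      nth_rewrite 3 [← Real.rpow_one y]
      rw [← Real.rpow_add hy]; norm_num
    rw [h4] at h3
    exact le_of_mul_le_mul_right h3 hy
  have hρ1 : y ^ (3 / 4 : ℝ) ≤ 1 := Real.rpow_le_one hy.le hy1.le (by norm_num)
  have hdc : |(γ 1 1 : ℝ)| ≤ 2 * |(γ 1 0 : ℝ)| := by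
    have h3 := abs_sub ((γ 1 0 : ℝ) * x + γ 1 1) ((γ 1 0 : ℝ) * x)
    rw [add_sub_cancel_left, abs_mul, abs_of_pos hx.1] at h3
    nlinarith [hx.2]
  refine ⟨?_, ?_⟩
  · rw [div_le_iff₀ hJ0, hJ]
    have h5 : 1 ≤ (γ 1 0 : ℝ) ^ 2 := by
      rw [← sq_abs]; nlinarith
    have h6 : y⁻¹ * (((γ 1 0 : ℝ) * x + γ 1 1) ^ 2 + ((γ 1 0 : ℝ) * y) ^ 2) =
        y⁻¹ * ((γ 1 0 : ℝ) * x + γ 1 1) ^ 2 + (γ 1 0 : ℝ) ^ 2 * y := by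
      field_simp
    rw [h6]
    have : 0 ≤ y⁻¹ * ((γ 1 0 : ℝ) * x + γ 1 1) ^ 2 := by positivity
    nlinarith
  · have hc1' : 1 ≤ (γ 1 0).natAbs := Int.natAbs_pos.2 hc0
    have hcast : (((γ 1 0).natAbs : ℕ) : ℝ) = |(γ 1 0 : ℝ)| := by
      rw [Nat.cast_natAbs]; push_cast; rfl
    have hdc' : |γ 1 1| ≤ 2 * ((γ 1 0).natAbs : ℤ) := by
      rw [← Int.abs_eq_natAbs]
      exact_mod_cast hdc
    simp only [majorArcs, mem_iUnion]
    rcases abs_choice (γ 1 0) with hs | hs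
    · refine ⟨(γ 1 0).natAbs, Finset.mem_Icc.2 ⟨hc1', Nat.le_floor (hcast.trans_le h2)⟩, γ 1 1,
        Finset.mem_Icc.2 (abs_le.1 hdc'), ?_⟩
      have : (((γ 1 0).natAbs : ℕ) : ℝ) = γ 1 0 := by
        rw [Nat.cast_natAbs, hs]
      change |(((γ 1 0).natAbs : ℕ) : ℝ) * x + γ 1 1| ≤ _
      rwa [this]
    · refine ⟨(γ 1 0).natAbs, Finset.mem_Icc.2 ⟨hc1', Nat.le_floor (hcast.trans_le h2)⟩, -γ 1 1,
        Finset.mem_Icc.2 (abs_le.1 (by rwa [abs_neg])), ?_⟩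
      have : (((γ 1 0).natAbs : ℕ) : ℝ) = -γ 1 0 := by
        rw [Nat.cast_natAbs, hs]; push_cast; ring
      change |(((γ 1 0).natAbs : ℕ) : ℝ) * x + ((-γ 1 1 : ℤ) : ℝ)| ≤ _
      rw [this, ← abs_neg]
      push_cast
      rwa [show -(-(γ 1 0 : ℝ) * x + -(γ 1 1 : ℝ)) = (γ 1 0 : ℝ) * x + γ 1 1 by ring]

/-- Off the major arcs |f|² is O(y^(-3κ/2)); on them it is O(y^(-2κ)), but their measure is
O(y^(1/2)). For κ ≥ 1/2 both contributions are O(y^(-(2κ-1/4))), a saving of 1/4 over the pointwise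
bound. -/
lemma IsForm.exists_meanSquare_bound (hf : IsForm κ f) (hκ : 1 / 2 ≤ κ) :
    ∃ C, 0 ≤ C ∧ ∀ y : ℝ, 0 < y → y < 1 →
      ∫ x in Ioc (0 : ℝ) 1, ‖f (pt x y)‖ ^ 2 ≤ C * y ^ (-(2 * κ - 1 / 4)) := by
  obtain ⟨C, hC0, hC⟩ := hf.exists_height_bound
  refine ⟨11 * C, by positivity, fun y hy hy1 => ?_⟩
  set E := majorArcs ⌊y ^ (-(1 / 4) : ℝ)⌋₊ (y ^ (3 / 4 : ℝ)) with hE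
  have hEm : MeasurableSet E := measurableSet_majorArcs _ _
  have hEv : volume.real E ≤ 10 * y ^ (1 / 2 : ℝ) := by
    rw [Measure.real]
    refine ENNReal.toReal_le_of_le_ofReal (by positivity)
      ((volume_majorArcs_le _ (by positivity)).trans (ENNReal.ofReal_le_ofReal ?_))
    have h1 := Nat.floor_le (by positivity : 0 ≤ y ^ (-(1 / 4) : ℝ))
    have h2 : y ^ (1 / 2 : ℝ) = y ^ (-(1 / 4) : ℝ) * y ^ (3 / 4 : ℝ) := by
      rw [← Real.rpow_add hy]; norm_num
    rw [h2, mul_assoc]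
    gcongr
  have hpt : ∀ x ∈ Ioc (0 : ℝ) 1, ‖f (pt x y)‖ ^ 2 ≤
      C * y ^ (-(3 / 2 * κ)) + E.indicator (fun _ => C * y ^ (-(2 * κ))) x := by
    intro x hx
    obtain ⟨γ, hγ⟩ := hC (pt x y)
    rw [im_pt hy, ← le_div_iff₀ (by positivity), div_eq_mul_inv, ← Real.rpow_neg hy.le] at hγ
    have hind : 0 ≤ E.indicator (fun _ => C * y ^ (-(2 * κ))) x :=
      indicator_nonneg (fun _ _ => by positivity) _
    have him := (γ • pt x y).im_pos
    rcases height_dichotomy hx hy hy1 γ with h | ⟨h, hxE⟩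
    · calc _ ≤ C * (y ^ (-(1 / 2) : ℝ)) ^ κ * y ^ (-κ) := hγ.trans (by gcongr)
        _ = C * y ^ (-(3 / 2 * κ)) := by
          rw [← Real.rpow_mul hy.le, mul_assoc, ← Real.rpow_add hy]
          congr 2
          ring
        _ ≤ _ := by linarith
    · rw [indicator_of_mem hxE]
      calc _ ≤ C * (y⁻¹) ^ κ * y ^ (-κ) := hγ.trans (by gcongr)
        _ = C * y ^ (-(2 * κ)) := by
          rw [Real.inv_rpow hy.le, ← Real.rpow_neg hy.le, mul_assoc, ← Real.rpow_add hy]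
          congr 2
          ring
        _ ≤ _ := by have : 0 ≤ C * y ^ (-(3 / 2 * κ)) := by positivity
                    linarith
  have hint1 : IntegrableOn (fun x => ‖f (pt x y)‖ ^ 2) (Ioc 0 1) :=
    (((hf.mdiff.continuous.comp (continuous_pt hy)).norm.pow 2).continuousOn.integrableOn_Icc).mono_set
      Ioc_subset_Icc_self
  have hint2 : IntegrableOn (E.indicator fun _ => C * y ^ (-(2 * κ))) (Ioc (0 : ℝ) 1) :=
    (integrableOn_const (by simp)).indicator hEm
  calc _ ≤ ∫ x in Ioc (0 : ℝ) 1, (C * y ^ (-(3 / 2 * κ)) +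
          E.indicator (fun _ => C * y ^ (-(2 * κ))) x) :=
        setIntegral_mono_on hint1 ((integrableOn_const (by simp)).add hint2) measurableSet_Ioc hpt
    _ = C * y ^ (-(3 / 2 * κ)) + volume.real (Ioc 0 1 ∩ E) * (C * y ^ (-(2 * κ))) := by
        have hconst : Integrable (fun _ : ℝ => C * y ^ (-(3 / 2 * κ)))
            (volume.restrict (Ioc (0 : ℝ) 1)) := integrable_const _
        rw [integral_add hconst hint2, setIntegral_indicator hEm]
        simp
    _ ≤ C * y ^ (-(2 * κ - 1 / 4)) + 10 * y ^ (1 / 2 : ℝ) * (C * y ^ (-(2 * κ))) := by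
        have h1 : y ^ (-(3 / 2 * κ)) ≤ y ^ (-(2 * κ - 1 / 4)) :=
          Real.rpow_le_rpow_of_exponent_ge hy hy1.le (by linarith)
        have h2 : volume.real (Ioc 0 1 ∩ E) ≤ 10 * y ^ (1 / 2 : ℝ) := by
          refine le_trans (measureReal_mono inter_subset_right ?_) hEv
          exact ((volume_majorArcs_le _ (by positivity)).trans_lt ENNReal.ofReal_lt_top).ne
        gcongr
    _ ≤ C * y ^ (-(2 * κ - 1 / 4)) + 10 * C * y ^ (-(2 * κ - 1 / 4)) := by
        have h1 : y ^ (1 / 2 : ℝ) * y ^ (-(2 * κ)) ≤ y ^ (-(2 * κ - 1 / 4)) := by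
          rw [← Real.rpow_add hy]
          exact Real.rpow_le_rpow_of_exponent_ge hy hy1.le (by linarith)
        have := mul_le_mul_of_nonneg_left h1 (by positivity : 0 ≤ 10 * C)
        linarith
    _ = 11 * C * y ^ (-(2 * κ - 1 / 4)) := by ring

/-- The mean square decreases with the height. -/
lemma meanSquare_antitone {b : ℕ → ℂ} (hb : ∀ z : ℍ, HasSum (fun m : ℕ => b m * qOf z ^ m) (f z))
    (hfc : Continuous f) {y y' : ℝ} (hy : 0 < y) (hyy' : y ≤ y') :
    ∫ x in Ioc (0 : ℝ) 1, ‖f (pt x y')‖ ^ 2 ≤ ∫ x in Ioc (0 : ℝ) 1, ‖f (pt x y)‖ ^ 2 := by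
  refine hasSum_le (fun m => ?_) (hasSum_line_sq hb hfc (hy.trans_le hyy')) (hasSum_line_sq hb hfc hy)
  gcongr

end MeanSquare

end

section

open MeasureTheory Set CongruenceSubgroup Derivative

/-! ### The Fourier expansion of `[qⁿ, g]_ν` -/

lemma normalizedDeriv_const_mul_qOf_pow (c : ℂ) (m : ℕ) :
    normalizedDerivOfComplex (fun z : ℍ => c * qOf z ^ m) = fun z => (m * c) * qOf z ^ m := by
  ext z
  have hev : ((fun z : ℍ => c * qOf z ^ m) ∘ ofComplex) =ᶠ[nhds (z : ℂ)]
      fun w : ℂ => c * Complex.exp (m * (2 * Real.pi * Complex.I) * w) := by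
    filter_upwards [isOpen_upperHalfPlaneSet.mem_nhds z.im_pos] with w hw
    simp only [Function.comp_apply, qOf]
    rw [ofComplex_apply_of_im_pos hw, ← Complex.exp_nat_mul, ← mul_assoc]
  have h1 : HasDerivAt (fun w : ℂ => c * Complex.exp (m * (2 * Real.pi * Complex.I) * w))
      (c * (Complex.exp (m * (2 * Real.pi * Complex.I) * z) * (m * (2 * Real.pi * Complex.I)))) z := by
    have h2 : HasDerivAt (fun w : ℂ => m * (2 * Real.pi * Complex.I) * w)
        (m * (2 * Real.pi * Complex.I)) z := by
      simpa using (hasDerivAt_id (z : ℂ)).const_mul ((m : ℂ) * (2 * Real.pi * Complex.I))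
    exact h2.cexp.const_mul c
  rw [normalizedDerivOfComplex, (h1.congr_of_eventuallyEq hev).deriv, qOf, ← Complex.exp_nat_mul,
    ← mul_assoc]
  have : (2 * Real.pi * Complex.I : ℂ) ≠ 0 := by simp [Real.pi_ne_zero]
  field_simp

lemma iterate_const_mul_qOf_pow (c : ℂ) (m r : ℕ) :
    normalizedDerivOfComplex^[r] (fun z : ℍ => c * qOf z ^ m) =
      fun z => ((m : ℂ) ^ r * c) * qOf z ^ m := by
  induction r with
  | zero => simp
  | succ r ih =>
    rw [Function.iterate_succ_apply', ih, normalizedDeriv_const_mul_qOf_pow]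
    ext z
    ring

section

variable {g : ℍ → ℂ} {b : ℕ → ℂ}

lemma locallyMajorized_fourier (hb : ∀ z : ℍ, HasSum (fun m : ℕ => b m * qOf z ^ m) (g z)) :
    LocallyMajorized fun (m : ℕ) (z : ℍ) => b m * qOf z ^ m where
  mdiff m := mdifferentiable_const.mul (mdifferentiable_qOf_pow m)
  major z₀ := by
    have hy : 0 < z₀.im / 2 := by have := z₀.im_pos; positivity
    refine ⟨z₀.im / 2, hy, _, summable_norm_fourier hb hy, fun m z hz => ?_⟩
    rw [dist_eq_norm] at hz
    have h2 := (Complex.abs_im_le_norm _).trans hz.le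
    rw [Complex.sub_im, coe_im, coe_im] at h2
    have h3 := (abs_le.1 h2).1
    rw [norm_mul, norm_qOf_pow]
    gcongr
    linarith

lemma hasSum_iterate_fourier (hb : ∀ z : ℍ, HasSum (fun m : ℕ => b m * qOf z ^ m) (g z)) (r : ℕ)
    (z : ℍ) : HasSum (fun m : ℕ => ((m : ℂ) ^ r * b m) * qOf z ^ m)
      (normalizedDerivOfComplex^[r] g z) := by
  have h := (locallyMajorized_fourier hb).hasSum_iterate r z
  have hg : (fun z => ∑' m : ℕ, b m * qOf z ^ m) = g := funext fun z => (hb z).tsum_eq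
  simp only [hg, iterate_const_mul_qOf_pow] at h
  exact h

lemma hasSum_rankinCohen_qOf_pow (κ lam : ℝ) (ν n : ℕ)
    (hb : ∀ z : ℍ, HasSum (fun m : ℕ => b m * qOf z ^ m) (g z)) (z : ℍ) :
    HasSum (fun m : ℕ => (rcAlpha κ lam ν n m * b m) * qOf z ^ (n + m))
      (rankinCohen κ lam ν (fun z => qOf z ^ n) g z) := by
  have h : HasSum (fun m : ℕ => ∑ r ∈ Finset.range (ν + 1), (rcCoeff κ lam ν r : ℂ) *
      ((n : ℂ) ^ r * qOf z ^ n) * (((m : ℂ) ^ (ν - r) * b m) * qOf z ^ m))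
      (rankinCohen κ lam ν (fun z => qOf z ^ n) g z) := by
    have h1 : ∀ r, normalizedDerivOfComplex^[r] (fun z : ℍ => qOf z ^ n) z =
        (n : ℂ) ^ r * qOf z ^ n := fun r => by
      have := congrFun (iterate_const_mul_qOf_pow 1 n r) z
      simpa using this
    rw [rankinCohen]
    refine hasSum_sum fun r _ => ?_
    rw [h1]
    exact (hasSum_iterate_fourier hb (ν - r) z).mul_left _
  refine h.congr_fun fun m => ?_
  rw [rcAlpha]
  push_cast
  rw [Finset.sum_mul, Finset.sum_mul]
  refine Finset.sum_congr rfl fun r _ => ?_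
  ring

/-- The Fourier coefficients of `[qⁿ, g]_ν`. -/
def bracketCoeff (κ lam : ℝ) (ν n : ℕ) (b : ℕ → ℂ) (j : ℕ) : ℂ :=
  if n ≤ j then rcAlpha κ lam ν n (j - n) * b (j - n) else 0

lemma bracketCoeff_add (κ lam : ℝ) (ν n : ℕ) (b : ℕ → ℂ) (m : ℕ) :
    bracketCoeff κ lam ν n b (n + m) = rcAlpha κ lam ν n m * b m := by
  simp [bracketCoeff]

lemma bracketCoeff_of_notMem_range (κ lam : ℝ) (ν n : ℕ) (b : ℕ → ℂ) {j : ℕ}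
    (hj : j ∉ range fun m => n + m) : bracketCoeff κ lam ν n b j = 0 := by
  refine if_neg fun h => hj ⟨j - n, ?_⟩
  simp only
  omega

lemma hasSum_bracketCoeff (κ lam : ℝ) (ν n : ℕ)
    (hb : ∀ z : ℍ, HasSum (fun m : ℕ => b m * qOf z ^ m) (g z)) (z : ℍ) :
    HasSum (fun j : ℕ => bracketCoeff κ lam ν n b j * qOf z ^ j)
      (rankinCohen κ lam ν (fun z => qOf z ^ n) g z) := by
  rw [← (add_right_injective n).hasSum_iff]
  · refine (hasSum_rankinCohen_qOf_pow κ lam ν n hb z).congr_fun fun m => ?_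
    rw [Function.comp_apply, bracketCoeff_add]
  · intro j hj
    rw [bracketCoeff_of_notMem_range κ lam ν n b hj, zero_mul]

lemma exists_rcAlpha_bound (κ lam : ℝ) (ν n : ℕ) :
    ∃ M, 0 ≤ M ∧ ∀ m : ℕ, |rcAlpha κ lam ν n m| ≤ M * (1 + m : ℝ) ^ ν := by
  refine ⟨∑ r ∈ Finset.range (ν + 1), |rcCoeff κ lam ν r| * (n : ℝ) ^ r,
    Finset.sum_nonneg fun r _ => by positivity, fun m => ?_⟩
  rw [rcAlpha, Finset.sum_mul]
  refine (Finset.abs_sum_le_sum_abs _ _).trans (Finset.sum_le_sum fun r _ => ?_)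
  rw [abs_mul, abs_mul, abs_of_nonneg (by positivity : (0 : ℝ) ≤ (n : ℝ) ^ r),
    abs_of_nonneg (by positivity : (0 : ℝ) ≤ (m : ℝ) ^ (ν - r))]
  refine mul_le_mul_of_nonneg_left ?_ (by positivity)
  calc (m : ℝ) ^ (ν - r) ≤ (1 + m : ℝ) ^ (ν - r) := by gcongr; linarith
    _ ≤ (1 + m : ℝ) ^ ν := pow_le_pow_right₀ (by linarith [(m.cast_nonneg : (0 : ℝ) ≤ m)])
      (Nat.sub_le _ _)

/-- For y ≤ 1 apply X^N/N! ≤ e^X with X = y + 2πmy ≥ (1+m)y, and bound the extra e^y by e. For y ≥ 1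
compare with y = 1. -/
lemma pow_mul_exp_le (N m : ℕ) {y : ℝ} (hy : 0 < y) :
    (1 + m : ℝ) ^ N * Real.exp (-(2 * Real.pi * m * y)) ≤
      N.factorial * Real.exp 1 * (1 + y ^ (-(N : ℝ))) := by
  have key : ∀ t : ℝ, 0 < t → t ≤ 1 → (1 + m : ℝ) ^ N * Real.exp (-(2 * Real.pi * m * t)) ≤
      N.factorial * Real.exp 1 * t ^ (-(N : ℝ)) := by
    intro t ht ht1
    have h1 := Real.pow_div_factorial_le_exp (t + 2 * Real.pi * m * t) (by positivity) N
    rw [div_le_iff₀ (by positivity), Real.exp_add] at h1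
    have h2 : ((1 + m : ℝ) * t) ^ N ≤ (t + 2 * Real.pi * m * t) ^ N := by
      have : (m : ℝ) * t ≤ 2 * Real.pi * (m * t) :=
        le_mul_of_one_le_left (by positivity) (by linarith [Real.pi_gt_three])
      gcongr
      linarith
    have h3 : Real.exp t ≤ Real.exp 1 := Real.exp_le_exp.2 ht1
    rw [Real.rpow_neg ht.le, Real.rpow_natCast, Real.exp_neg, ← div_eq_mul_inv, ← div_eq_mul_inv,
      div_le_div_iff₀ (by positivity) (by positivity), ← mul_pow]
    calc _ ≤ _ := h2.trans h1
      _ ≤ Real.exp 1 * Real.exp (2 * Real.pi * m * t) * N.factorial := by gcongr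
      _ = _ := by ring
  rcases le_total y 1 with h | h
  · refine (key y hy h).trans ?_
    gcongr
    linarith
  · have h1 : Real.exp (-(2 * Real.pi * m * y)) ≤ Real.exp (-(2 * Real.pi * m * 1)) := by
      gcongr
    have h2 := key 1 one_pos le_rfl
    rw [Real.one_rpow] at h2
    calc _ ≤ (1 + m : ℝ) ^ N * Real.exp (-(2 * Real.pi * m * 1)) := by gcongr
      _ ≤ N.factorial * Real.exp 1 * 1 := h2
      _ ≤ _ := by gcongr; linarith [Real.rpow_pos_of_pos hy (-(N : ℝ))]

lemma one_add_rpow_mul_le {y s t : ℝ} (hy : 0 < y) (hs : 0 ≤ s) (ht : 0 ≤ t) :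
    (1 + y ^ (-s)) * (1 + y ^ (-t)) ≤ (2 * (1 + y ^ (-((s + t) / 2)))) ^ 2 := by
  have hσ : 0 < y ^ (-((s + t) / 2)) := by positivity
  have hs' : 0 < y ^ (-s) := by positivity
  have ht' : 0 < y ^ (-t) := by positivity
  rcases le_total y 1 with h | h
  · have h1 : 1 ≤ y ^ (-s) := Real.one_le_rpow_of_pos_of_le_one_of_nonpos hy h (by linarith)
    have h2 : 1 ≤ y ^ (-t) := Real.one_le_rpow_of_pos_of_le_one_of_nonpos hy h (by linarith)
    have h3 : y ^ (-s) * y ^ (-t) = (y ^ (-((s + t) / 2))) ^ 2 := by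
      rw [← Real.rpow_add hy, ← Real.rpow_mul_natCast hy.le]
      congr 1
      push_cast
      ring
    have h4 : y ^ (-t) ≤ y ^ (-s) * y ^ (-t) := le_mul_of_one_le_left ht'.le h1
    have h5 : y ^ (-s) ≤ y ^ (-s) * y ^ (-t) := le_mul_of_one_le_right hs'.le h2
    rw [h3] at h4 h5
    nlinarith
  · have h1 : y ^ (-s) ≤ 1 := Real.rpow_le_one_of_one_le_of_nonpos h (by linarith)
    have h2 : y ^ (-t) ≤ 1 := Real.rpow_le_one_of_one_le_of_nonpos h (by linarith)
    nlinarith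

/-- In Parseval's sum the weight e^(-4πmy) is split into halves. One half absorbs α(n,m)² =
O((1+m)^(2ν)) at the cost of 1 + y^(-2ν); the other is the Parseval weight of g at height y/2. A
square root turns the exponents 2ν and e into ν + e/2. -/
lemma exists_bracket_bound (κ lam : ℝ) (ν n : ℕ) (hgm : MDiff g)
    (hb : ∀ z : ℍ, HasSum (fun m : ℕ => b m * qOf z ^ m) (g z)) {C e : ℝ} (hC : 0 ≤ C) (he : 0 ≤ e)
    (hg : ∀ y : ℝ, 0 < y → ∫ x in Ioc (0 : ℝ) 1, ‖g (pt x y)‖ ^ 2 ≤ C * (1 + y ^ (-e))) :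
    ∃ M, 0 < M ∧ ∀ y : ℝ, 0 < y →
      ∫ x in Ioc (0 : ℝ) 1, ‖rankinCohen κ lam ν (fun z => qOf z ^ n) g (pt x y)‖ ^ 2 ≤
        (M * (Real.exp (-(2 * Real.pi * n * y)) * (1 + y ^ (-(ν + e / 2))))) ^ 2 := by
  obtain ⟨α, hα0, hα⟩ := exists_rcAlpha_bound κ lam ν n
  set P : ℝ := (2 * ν).factorial * Real.exp 1 with hP
  set W : ℝ := α ^ 2 * P * (C * 2 ^ e) * 4 with hW
  have hW0 : 0 ≤ W := by positivity
  -- W may be zero; the added 1 keeps the constant positive.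
  refine ⟨√W + 1, by positivity, fun y hy => ?_⟩
  have hrc := hasSum_line_sq (hasSum_bracketCoeff κ lam ν n hb)
    (mdifferentiable_rankinCohen ν (mdifferentiable_qOf_pow n) hgm).continuous hy
  rw [← (add_right_injective n).hasSum_iff (fun j hj => by
    rw [bracketCoeff_of_notMem_range κ lam ν n b hj]; simp)] at hrc
  have hgs := hasSum_line_sq hb hgm.continuous (half_pos hy)
  have hE : Real.exp (-(4 * Real.pi * n * y)) = Real.exp (-(2 * Real.pi * n * y)) ^ 2 := by
    rw [← Real.exp_nat_mul]
    congr 1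
    push_cast
    ring
  have h1 : ∫ x in Ioc (0 : ℝ) 1, ‖rankinCohen κ lam ν (fun z => qOf z ^ n) g (pt x y)‖ ^ 2 ≤
      Real.exp (-(2 * Real.pi * n * y)) ^ 2 * (α ^ 2 * (P * (1 + y ^ (-((2 * ν : ℕ) : ℝ))))) *
        ∫ x in Ioc (0 : ℝ) 1, ‖g (pt x (y / 2))‖ ^ 2 := by
    refine hasSum_le (fun m => ?_) hrc (hgs.mul_left _)
    rw [Function.comp_apply, bracketCoeff_add, norm_mul, mul_pow, Complex.norm_real, Real.norm_eq_abs]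
    have h2 : Real.exp (-(4 * Real.pi * ((n + m : ℕ) : ℝ) * y)) =
        Real.exp (-(2 * Real.pi * n * y)) ^ 2 * (Real.exp (-(2 * Real.pi * m * y)) *
          Real.exp (-(4 * Real.pi * m * (y / 2)))) := by
      rw [← hE, ← Real.exp_add, ← Real.exp_add]
      congr 1
      push_cast
      ring
    have h3 : |rcAlpha κ lam ν n m| ^ 2 * Real.exp (-(2 * Real.pi * m * y)) ≤
        α ^ 2 * (P * (1 + y ^ (-((2 * ν : ℕ) : ℝ)))) := by
      calc _ ≤ (α * (1 + m : ℝ) ^ ν) ^ 2 * Real.exp (-(2 * Real.pi * m * y)) := by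
            gcongr
            exact hα m
        _ = α ^ 2 * ((1 + m : ℝ) ^ (2 * ν) * Real.exp (-(2 * Real.pi * m * y))) := by
            rw [mul_pow, ← pow_mul, mul_comm ν 2]; ring
        _ ≤ _ := by
            exact mul_le_mul_of_nonneg_left (pow_mul_exp_le (2 * ν) m hy) (sq_nonneg α)
    rw [h2]
    calc _ = (Real.exp (-(2 * Real.pi * n * y)) ^ 2 * (‖b m‖ ^ 2 *
          Real.exp (-(4 * Real.pi * m * (y / 2))))) *
          (|rcAlpha κ lam ν n m| ^ 2 * Real.exp (-(2 * Real.pi * m * y))) := by ring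
      _ ≤ (Real.exp (-(2 * Real.pi * n * y)) ^ 2 * (‖b m‖ ^ 2 *
          Real.exp (-(4 * Real.pi * m * (y / 2))))) *
          (α ^ 2 * (P * (1 + y ^ (-((2 * ν : ℕ) : ℝ))))) := by gcongr
      _ = _ := by ring
  have h4 : ∫ x in Ioc (0 : ℝ) 1, ‖g (pt x (y / 2))‖ ^ 2 ≤ C * 2 ^ e * (1 + y ^ (-e)) := by
    refine (hg _ (half_pos hy)).trans ?_
    rw [Real.div_rpow hy.le zero_le_two, Real.rpow_neg zero_le_two, div_inv_eq_mul, mul_assoc]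
    have h5 : (1 : ℝ) ≤ 2 ^ e := Real.one_le_rpow one_le_two he
    have h6 : 0 < y ^ (-e) := by positivity
    refine mul_le_mul_of_nonneg_left ?_ hC
    nlinarith
  have h7 := one_add_rpow_mul_le hy (by positivity : (0 : ℝ) ≤ ((2 * ν : ℕ) : ℝ)) he
  have h8 : (((2 * ν : ℕ) : ℝ) + e) / 2 = ν + e / 2 := by push_cast; ring
  rw [h8] at h7
  set Y := 1 + y ^ (-((ν : ℝ) + e / 2)) with hY
  calc _ ≤ _ := h1
    _ ≤ Real.exp (-(2 * Real.pi * n * y)) ^ 2 * (α ^ 2 * (P * (1 + y ^ (-((2 * ν : ℕ) : ℝ))))) *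
        (C * 2 ^ e * (1 + y ^ (-e))) := by gcongr
    _ = Real.exp (-(2 * Real.pi * n * y)) ^ 2 * (α ^ 2 * P * (C * 2 ^ e)) *
        ((1 + y ^ (-((2 * ν : ℕ) : ℝ))) * (1 + y ^ (-e))) := by ring
    _ ≤ Real.exp (-(2 * Real.pi * n * y)) ^ 2 * (α ^ 2 * P * (C * 2 ^ e)) * (2 * Y) ^ 2 := by
        gcongr
    _ = W * (Real.exp (-(2 * Real.pi * n * y)) * Y) ^ 2 := by rw [hW]; ring
    _ ≤ (√W + 1) ^ 2 * (Real.exp (-(2 * Real.pi * n * y)) * Y) ^ 2 := by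
        gcongr
        nlinarith [Real.sq_sqrt hW0, Real.sqrt_nonneg W]
    _ = _ := by ring

end

end

/-! ### Convergence of the strip integral for cusp forms -/

section

open MeasureTheory Set CongruenceSubgroup

section

variable {κ : ℝ} {f : ℍ → ℂ} {a : ℕ → ℂ}

lemma IsForm.exists_line_bound (hf : IsForm κ f) (hκ : 1 / 2 ≤ κ)
    (ha : ∀ z : ℍ, HasSum (fun m : ℕ => a m * qOf z ^ m) (f z)) :
    ∃ C, 0 ≤ C ∧ ∀ y : ℝ, 0 < y →
      ∫ x in Ioc (0 : ℝ) 1, ‖f (pt x y)‖ ^ 2 ≤ C * (1 + y ^ (-(2 * κ - 1 / 4))) := by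
  obtain ⟨C, hC0, hC⟩ := hf.exists_meanSquare_bound hκ
  set N := ∫ x in Ioc (0 : ℝ) 1, ‖f (pt x (1 / 2))‖ ^ 2
  have hN : 0 ≤ N := integral_nonneg fun x => by positivity
  refine ⟨C + N, by positivity, fun y hy => ?_⟩
  have hy' : 0 < y ^ (-(2 * κ - 1 / 4)) := by positivity
  rcases lt_or_ge y 1 with h | h
  · refine (hC y hy h).trans ?_
    nlinarith [mul_nonneg hN hy'.le]
  · refine (meanSquare_antitone ha hf.mdiff.continuous (y := 1 / 2) (by norm_num) (by linarith)).trans ?_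
    change N ≤ _
    nlinarith [mul_nonneg hN hy'.le, mul_nonneg hC0 hy'.le]

lemma IsCuspidal.exists_line_bound {w : ℕ} (hw : 4 * κ = w) (hf : IsCuspidal κ f) :
    ∃ C, 0 ≤ C ∧ ∀ y : ℝ, 0 < y →
      ∫ x in Ioc (0 : ℝ) 1, ‖f (pt x y)‖ ^ 2 ≤ C * (1 + y ^ (-κ)) := by
  obtain ⟨C, hC0, hC⟩ := hf.exists_bound hw
  refine ⟨C ^ 2, by positivity, fun y hy => ?_⟩
  refine (integral_line_sq_le (A := fun y => C * y ^ (-(κ / 2))) hf.mdiff.continuous hC hy).trans ?_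
  have h1 : (y ^ (-(κ / 2))) ^ 2 = y ^ (-κ) := by
    rw [← Real.rpow_mul_natCast hy.le]
    congr 1
    push_cast
    ring
  rw [mul_pow, h1]
  gcongr
  linarith

lemma integrableOn_exp_mul_rpow {s : ℝ} (hs : -1 < s) {n : ℕ} (hn : 1 ≤ n) :
    IntegrableOn (fun y : ℝ => y ^ s * Real.exp (-(2 * Real.pi * n * y))) (Ioi 0) := by
  have hn' : (0 : ℝ) < n := by exact_mod_cast hn
  have := integrableOn_rpow_mul_exp_neg_mul_rpow hs one_pos
    (by positivity : 0 < 2 * Real.pi * n)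
  simpa only [Real.rpow_one, neg_mul] using this

/-- The integral over the strip of a cusp form against a function with a suitable mean square
bound. -/
theorem IsCuspidal.strip_integral {w : ℕ} (hw : 4 * κ = w) (hf : IsCuspidal κ f) (hκ : 2 < κ)
    (ha : ∀ z : ℍ, HasSum (fun m : ℕ => a m * qOf z ^ m) (f z)) (ha0 : a 0 = 0)
    {φ : ℍ → ℂ} {c : ℕ → ℂ} (hφ : ∀ z : ℍ, HasSum (fun m : ℕ => c m * qOf z ^ m) (φ z))
    (hφc : Continuous φ) {M σ : ℝ} (hM : 0 < M) (hσ : σ < κ / 2 - 1) {n : ℕ} (hn : 1 ≤ n)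
    (hφB : ∀ y : ℝ, 0 < y → ∫ x in Ioc (0 : ℝ) 1, ‖φ (pt x y)‖ ^ 2 ≤
      (M * (Real.exp (-(2 * Real.pi * n * y)) * (1 + y ^ (-σ)))) ^ 2) :
    IntegrableOn (peterssonDensity κ f φ) unitStrip ∧
    HasSum (fun m : ℕ => a m * conj (c m) *
      ((Real.Gamma (κ - 1) / (4 * Real.pi * m) ^ (κ - 1) : ℝ) : ℂ))
      (∫ z in unitStrip, peterssonDensity κ f φ z) := by
  obtain ⟨C, hC0, hC⟩ := hf.exists_bound hw
  have hfc := hf.mdiff.continuous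
  refine HalfIntegralWeight.strip_integral (A := fun y => (C + 1) * y ^ (-(κ / 2)))
    (B := fun y => M * (Real.exp (-(2 * Real.pi * n * y)) * (1 + y ^ (-σ)))) (by linarith) ha hφ
    hfc hφc ha0 (fun y hy => by positivity) (fun y hy => by positivity) (fun y hy => ?_) hφB ?_
  · refine integral_line_sq_le (A := fun y => (C + 1) * y ^ (-(κ / 2))) hfc (fun z => ?_) hy
    refine (hC z).trans ?_
    have := z.im_pos
    gcongr
    linarith
  -- The majorant behaves like y^(κ/2-2) + y^(κ/2-2-σ) near 0. The second exponent exceeds -1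
  -- exactly when σ < κ/2 - 1; at infinity n ≥ 1 gives exponential decay.
  · have h1 := ((integrableOn_exp_mul_rpow (s := κ / 2 - 2) (by linarith) hn).add
      (integrableOn_exp_mul_rpow (s := κ / 2 - 2 - σ) (by linarith) hn)).const_mul ((C + 1) * M)
    refine IntegrableOn.congr_fun h1 (fun y hy => ?_) measurableSet_Ioi
    have hy' : (0 : ℝ) < y := hy
    have e1 : y ^ (κ / 2 - 2) = y ^ (-(κ / 2)) * y ^ (κ - 2) := by
      rw [← Real.rpow_add hy']
      congr 1
      ring
    have e2 : y ^ (κ / 2 - 2 - σ) = y ^ (-(κ / 2)) * y ^ (κ - 2) * y ^ (-σ) := by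
      rw [← Real.rpow_add hy', ← Real.rpow_add hy']
      congr 1
      ring
    simp only [Pi.add_apply, e1, e2]
    ring

end

/-! ### Unfolding Petersson products with Poincaré series -/

lemma peterssonDensity_smul (κ : ℝ) (f h : ℍ → ℂ) {c : ℂ} (hc : ‖c‖ = 1) (z : ℍ) :
    peterssonDensity κ (c • f) (c • h) z = peterssonDensity κ f h z := by
  have h1 : c * conj c = 1 := by
    rw [Complex.mul_conj, Complex.normSq_eq_norm_sq, hc]
    simp
  simp only [peterssonDensity, Pi.smul_apply, smul_eq_mul, map_mul]
  linear_combination f z * conj (h z) * ((z.im ^ κ : ℝ) : ℂ) * h1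

lemma peterssonDensity_weightTranslate (κ : ℝ) (f h : ℍ → ℂ) (γ : SL(2, ℤ)) (z : ℍ) :
    peterssonDensity κ (weightTranslate κ f γ) (weightTranslate κ h γ) z =
      peterssonDensity κ f h (γ • z) := by
  have hx := norm_pos_iff.2 (autFactor_ne_zero γ z)
  have h1 : autFactor γ z ^ (-(κ : ℂ)) * conj (autFactor γ z ^ (-(κ : ℂ))) *
      ((z.im ^ κ : ℝ) : ℂ) = (((γ • z).im ^ κ : ℝ) : ℂ) := by
    rw [Complex.mul_conj, Complex.normSq_eq_norm_sq, ← Complex.ofReal_neg, Complex.norm_cpow_real,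
      ← Complex.ofReal_mul, im_smul_eq, Real.div_rpow z.im_pos.le (by positivity),
      Real.rpow_neg hx.le, inv_pow, div_eq_inv_mul, ← Real.rpow_natCast, ← Real.rpow_natCast,
      ← Real.rpow_mul hx.le, ← Real.rpow_mul hx.le, mul_comm κ]
  simp only [peterssonDensity, weightTranslate, map_mul]
  rw [← h1]
  ring

/-- Unfolding of the Petersson product with a series over the rows of `Γ₀(4)`. -/
lemma peterssonProduct_unfold {κ : ℝ} {f φ P : ℍ → ℂ} {G : Gamma0Row → ℍ → ℂ}
    (hfc : Continuous f) (hφc : Continuous φ) (hfT : ∀ z, f (ModularGroup.T • z) = f z)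
    (hφT : ∀ z, φ (ModularGroup.T • z) = φ z) (hP : ∀ z, HasSum (fun p => G p z) (P z))
    (hG : ∀ p : Gamma0Row, ∃ c : ℂ, ‖c‖ = 1 ∧ weightTranslate κ f p.lift = c • f ∧
      weightTranslate κ φ p.lift = c • G p)
    (hint : IntegrableOn (peterssonDensity κ f φ) unitStrip) :
    peterssonProduct κ f P = 2 * ∫ z in unitStrip, peterssonDensity κ f φ z := by
  rw [peterssonProduct_eq_sum, ← unfolding (continuous_peterssonDensity hfc hφc) (fun z => by
    have h := ModularGroup.im_T_zpow_smul z 1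
    rw [zpow_one] at h
    rw [peterssonDensity, peterssonDensity, hfT, hφT, h]) hint]
  refine Finset.sum_congr rfl fun q _ => integral_congr_ae (Filter.Eventually.of_forall fun z => ?_)
  simp only
  generalize q.out⁻¹ • z = w
  have h1 : ∀ p : Gamma0Row, peterssonDensity κ f φ (p.lift • w) =
      f w * conj (G p w) * ((w.im ^ κ : ℝ) : ℂ) := by
    intro p
    obtain ⟨c, hc, e1, e2⟩ := hG p
    rw [← peterssonDensity_weightTranslate, e1, e2, peterssonDensity_smul κ f _ hc]
    rfl
  simp_rw [h1]
  rw [tsum_mul_right, tsum_mul_left]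
  have h2 : ∑' p, conj (G p w) = conj (P w) :=
    ((hP w).map (starRingEnd ℂ) Complex.continuous_conj).tsum_eq
  rw [h2]
  rfl

end

section

open MeasureTheory Set CongruenceSubgroup Derivative

/-! ### The Fourier coefficients of the adjoint -/

lemma hasSum_pnat_iff {a : ℕ → ℂ} (ha0 : a 0 = 0) {z : ℍ} {S : ℂ} :
    HasSum (fun m : ℕ+ => a m * qOf z ^ (m : ℕ)) S ↔ HasSum (fun m : ℕ => a m * qOf z ^ m) S := by
  rw [← PNat.coe_injective.hasSum_iff (f := fun m : ℕ => a m * qOf z ^ m)]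
  · rfl
  · intro m hm
    have : m = 0 := by
      by_contra h
      exact hm ⟨⟨m, Nat.pos_of_ne_zero h⟩, rfl⟩
    rw [this, ha0, zero_mul]

lemma IsCuspidal.qExpansion_coeff_zero {κ : ℝ} {f : ℍ → ℂ} (hf : IsCuspidal κ f) :
    (qExpansion 1 f).coeff 0 = 0 := by
  simp [qExpansion_coeff, hf.zero_one.cuspFunction_apply_zero one_pos]

lemma hasSum_rankinCohen_poincareTerm (κ lam : ℝ) (ν : ℕ) {k : ℕ} (hk : 2 ≤ k) (n : ℕ) (g : ℍ → ℂ)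
    (z : ℍ) : HasSum (fun p => rankinCohen κ lam ν (poincareTerm k n p) g z)
      (rankinCohen κ lam ν (poincare k n) g z) :=
  hasSum_sum fun r _ =>
    (((locallyMajorized_poincareTerm hk n).hasSum_iterate r z).mul_left _).mul_right _

lemma hasSum_qOf_pow (n : ℕ) (z : ℍ) :
    HasSum (fun j : ℕ => (if j = n then (1 : ℂ) else 0) * qOf z ^ j) (qOf z ^ n) := by
  have := hasSum_ite_eq n (qOf z ^ n)
  refine this.congr_fun fun j => ?_
  split_ifs with h
  · rw [h, one_mul]
  · rw [zero_mul]

/-- The Petersson product with a Poincaré series is a Fourier coefficient. -/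
lemma peterssonProduct_poincare {k : ℕ} (hk : 2 ≤ k) {n : ℕ} (hn : 1 ≤ n) {u : ℍ → ℂ}
    (hu : u ∈ halfCuspForms k 1) :
    peterssonProduct ((k : ℝ) + 1 / 2) u (poincare k n) = 2 * ((qExpansion 1 u).coeff n *
      ((Real.Gamma ((k : ℝ) - 1 / 2) / (4 * Real.pi * n) ^ ((k : ℝ) - 1 / 2) : ℝ) : ℂ)) := by
  have hk' : (2 : ℝ) ≤ k := by exact_mod_cast hk
  have hc := isCuspidal_of_mem_halfCuspForms hu
  have hT := T_smul_of_halfSlash hu.2.1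
  have hφc : Continuous fun z : ℍ => qOf z ^ n := (mdifferentiable_qOf_pow n).continuous
  obtain ⟨hint, hsum⟩ := hc.strip_integral (four_mul_weight k) (by linarith)
    (hasSum_fourier hu.1 hT hc.toIsForm.bdd_one) hc.qExpansion_coeff_zero (hasSum_qOf_pow n) hφc
    -- For q^n itself no power of y is needed; σ = 0 turns the factor 1 + y^(-σ) into a harmless 2.
    one_pos (σ := 0) (by linarith) hn (fun y hy => by
      refine (integral_line_sq_le (A := fun y => Real.exp (-(2 * Real.pi * n * y))) hφc
        (fun z => (norm_qOf_pow n z).le) hy).trans ?_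
      rw [neg_zero, Real.rpow_zero, one_mul]
      have := Real.exp_pos (-(2 * Real.pi * n * y))
      gcongr
      linarith)
  rw [peterssonProduct_unfold (φ := fun z => qOf z ^ n) (G := poincareTerm k n) hu.1.continuous hφc hT
    (fun z => by simp only [qOf_T_smul]) (hasSum_poincare hk n) (fun p => ?_) hint]
  · congr 1
    refine hsum.unique ?_
    have := hasSum_ite_eq n ((qExpansion 1 u).coeff n *
      ((Real.Gamma ((k : ℝ) - 1 / 2) / (4 * Real.pi * n) ^ ((k : ℝ) - 1 / 2) : ℝ) : ℂ))
    refine this.congr_fun fun j => ?_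
    have e : (k : ℝ) + 1 / 2 - 1 = (k : ℝ) - 1 / 2 := by ring
    rw [e]
    split_ifs with h
    · rw [h, map_one, mul_one]
    · rw [map_zero, mul_zero, zero_mul]
  · have h4 := thetaMultiplier_pow_four k p.lift_mem
    have h0 := ne_zero_of_pow_four h4
    refine ⟨(thetaMultiplier k p.lift)⁻¹, by rw [norm_inv, norm_of_pow_four h4, inv_one], ?_, ?_⟩
    · have h := hu.2.1 _ p.lift_mem
      rw [character_one_apply p.lift_mem, one_smul, halfSlash_eq] at h
      rw [eq_inv_smul_iff₀ h0, h]
    · rw [poincareTerm, halfSlash_eq, smul_smul, inv_mul_cancel₀ h0, one_smul]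

/-- The Petersson product with the bracket of a Poincaré series and `g`. -/
lemma peterssonProduct_rankinCohen_poincare {k l ν : ℕ} {χ : DirichletCharacter ℂ 4} (hk : 2 ≤ k)
    {n : ℕ} (hn : 1 ≤ n) {g : ℍ → ℂ} (hg : g ∈ halfModularForms l χ) {b : ℕ → ℂ}
    (hb : ∀ z : ℍ, HasSum (fun m : ℕ => b m * qOf z ^ m) (g z)) {C e : ℝ} (hC : 0 ≤ C) (he : 0 ≤ e)
    (hek : e < (k : ℝ) + l - 1)
    (hgb : ∀ y : ℝ, 0 < y → ∫ x in Ioc (0 : ℝ) 1, ‖g (pt x y)‖ ^ 2 ≤ C * (1 + y ^ (-e)))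
    {f : ℍ → ℂ} (hf : f ∈ integralCuspForms (k + l + 2 * ν + 1) (χ * chiNegFour ^ (k + l + 1)))
    {a : ℕ → ℂ} (ha : ∀ z : ℍ, HasSum (fun m : ℕ => a m * qOf z ^ m) (f z)) (ha0 : a 0 = 0) :
    HasSum (fun m : ℕ => 2 * (a (n + m) *
      conj ((rcAlpha ((k : ℝ) + 1 / 2) ((l : ℝ) + 1 / 2) ν n m : ℂ) * b m) *
      ((Real.Gamma ((k : ℝ) + l + 2 * ν) /
        (4 * Real.pi * (n + m : ℕ)) ^ ((k : ℝ) + l + 2 * ν) : ℝ) : ℂ)))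
      (peterssonProduct ((k + l + 2 * ν + 1 : ℕ) : ℝ) f
        (rankinCohen ((k : ℝ) + 1 / 2) ((l : ℝ) + 1 / 2) ν (poincare k n) g)) := by
  set K := k + l + 2 * ν + 1 with hK
  have hKr : (K : ℝ) = k + l + 2 * ν + 1 := by rw [hK]; push_cast; ring
  have hk' : (2 : ℝ) ≤ k := by exact_mod_cast hk
  have hl0 : (0 : ℝ) ≤ l := l.cast_nonneg
  have hc := isCuspidal_of_mem_integralCuspForms hf
  have hfT := T_smul_of_slash hf.2.1
  set φ := rankinCohen ((k : ℝ) + 1 / 2) ((l : ℝ) + 1 / 2) ν (fun z => qOf z ^ n) g with hφ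
  have hφs := hasSum_bracketCoeff ((k : ℝ) + 1 / 2) ((l : ℝ) + 1 / 2) ν n hb
  have hφc : Continuous φ := (mdifferentiable_rankinCohen ν (mdifferentiable_qOf_pow n) hg.1).continuous
  have hφT : ∀ z, φ (ModularGroup.T • z) = φ z := fun z => by
    have h := hφs (ModularGroup.T • z)
    simp only [qOf_T_smul] at h
    exact h.unique (hφs z)
  obtain ⟨M, hM, hMb⟩ := exists_bracket_bound ((k : ℝ) + 1 / 2) ((l : ℝ) + 1 / 2) ν n hg.1 hb hC he hgb
  -- With σ = ν + e/2 and weight K = k+l+2ν+1, the requirement σ < K/2 - 1 is e < k+l-1.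
  obtain ⟨hint, hsum⟩ := hc.strip_integral (four_mul_natCast K) (by rw [hKr]; linarith) ha ha0 hφs hφc
    hM (by rw [hKr]; linarith) hn hMb
  rw [peterssonProduct_unfold (φ := φ)
    (G := fun p => rankinCohen ((k : ℝ) + 1 / 2) ((l : ℝ) + 1 / 2) ν (poincareTerm k n p) g)
    hf.1.continuous hφc hfT hφT (hasSum_rankinCohen_poincareTerm _ _ ν hk n g) (fun p => ?_) hint]
  · refine HasSum.mul_left 2 ?_
    rw [← (add_right_injective n).hasSum_iff (fun j hj => by
      rw [bracketCoeff_of_notMem_range _ _ ν n b hj]; simp)] at hsum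
    refine hsum.congr_fun fun m => ?_
    rw [Function.comp_apply, bracketCoeff_add, hKr, add_sub_cancel_right]
  · refine ⟨(χ * chiNegFour ^ (k + l + 1)) ((p.lift 1 1 : ℤ) : ZMod 4),
      norm_of_pow_four (character_pow_four _ p.lift_mem), ?_, ?_⟩
    · rw [← slash_eq_weightTranslate]
      exact hf.2.1 _ p.lift_mem
    · exact (rankinCohen_halfSlash k ν (mdifferentiable_qOf_pow n) hg p.lift_mem).symm

/-- Since n ≥ 1, only indices n+m ≥ 1 occur, so the value of the coefficient sequence at 0 is
irrelevant. -/
lemma shiftedLTerm_eq {k l ν n : ℕ} (hn : 1 ≤ n) {a a' : ℕ → ℂ} (haa : ∀ m, m ≠ 0 → a' m = a m)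
    (b : ℕ → ℂ) (m : ℕ) :
    a' (n + m) * conj ((rcAlpha ((k : ℝ) + 1 / 2) ((l : ℝ) + 1 / 2) ν n m : ℂ) * b m) *
      ((Real.Gamma ((k : ℝ) + l + 2 * ν) /
        (4 * Real.pi * (n + m : ℕ)) ^ ((k : ℝ) + l + 2 * ν) : ℝ) : ℂ) =
    ((Real.Gamma ((k : ℝ) + l + 2 * ν) / (4 * Real.pi) ^ ((k : ℝ) + l + 2 * ν) : ℝ) : ℂ) *
      shiftedLTerm ((k : ℝ) + 1 / 2) ((l : ℝ) + 1 / 2) ν a b n ((k : ℂ) + l + 2 * ν) m := by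
  have hnm : (0 : ℝ) ≤ ((n + m : ℕ) : ℝ) := Nat.cast_nonneg _
  have h1 : ((n + m : ℕ) : ℂ) ^ ((k : ℂ) + l + 2 * ν) =
      ((((n + m : ℕ) : ℝ) ^ ((k : ℝ) + l + 2 * ν) : ℝ) : ℂ) := by
    rw [Complex.ofReal_cpow hnm]
    push_cast
    rfl
  rw [haa _ (by omega), shiftedLTerm, h1, map_mul, Complex.conj_ofReal,
    Real.mul_rpow (by positivity) hnm]
  push_cast
  ring

lemma beta_eq {k l ν n : ℕ} (hk : 2 ≤ k) (hn : 1 ≤ n) {c L : ℂ}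
    (h : c * ((Real.Gamma ((k : ℝ) - 1 / 2) / (4 * Real.pi * n) ^ ((k : ℝ) - 1 / 2) : ℝ) : ℂ) =
      ((Real.Gamma ((k : ℝ) + l + 2 * ν) / (4 * Real.pi) ^ ((k : ℝ) + l + 2 * ν) : ℝ) : ℂ) * L) :
    c = (beta k l ν n : ℂ) * L := by
  have hk' : (2 : ℝ) ≤ k := by exact_mod_cast hk
  have hG : 0 < Real.Gamma ((k : ℝ) - 1 / 2) := Real.Gamma_pos_of_pos (by linarith)
  have hn' : (0 : ℝ) < n := by exact_mod_cast hn
  have hp : (0 : ℝ) < 4 * Real.pi := by positivity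
  have h1 : beta k l ν n * (Real.Gamma ((k : ℝ) - 1 / 2) / (4 * Real.pi * n) ^ ((k : ℝ) - 1 / 2)) =
      Real.Gamma ((k : ℝ) + l + 2 * ν) / (4 * Real.pi) ^ ((k : ℝ) + l + 2 * ν) := by
    have e1 : (4 * Real.pi) ^ ((k : ℝ) + l + 2 * ν) =
        (4 * Real.pi) ^ ((l : ℝ) + 2 * ν + 1 / 2) * (4 * Real.pi) ^ ((k : ℝ) - 1 / 2) := by
      rw [← Real.rpow_add hp]
      congr 1
      ring
    rw [beta, Real.mul_rpow hp.le hn'.le, e1]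
    have p1 := Real.rpow_pos_of_pos hp ((l : ℝ) + 2 * ν + 1 / 2)
    have p2 := Real.rpow_pos_of_pos hp ((k : ℝ) - 1 / 2)
    have p3 := Real.rpow_pos_of_pos hn' ((k : ℝ) - 1 / 2)
    generalize (4 * Real.pi) ^ ((l : ℝ) + 2 * ν + 1 / 2) = x at *
    generalize (4 * Real.pi) ^ ((k : ℝ) - 1 / 2) = y at *
    generalize (n : ℝ) ^ ((k : ℝ) - 1 / 2) = t at *
    generalize Real.Gamma ((k : ℝ) - 1 / 2) = u at *
    generalize Real.Gamma ((k : ℝ) + l + 2 * ν) = v at *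
    field_simp
  have h2 : ((Real.Gamma ((k : ℝ) - 1 / 2) / (4 * Real.pi * n) ^ ((k : ℝ) - 1 / 2) : ℝ) : ℂ) ≠ 0 := by
    rw [Complex.ofReal_ne_zero]
    positivity
  refine mul_right_cancel₀ h2 ?_
  rw [h, ← h1]
  push_cast
  ring

/-- For cuspidal g, e = l+1/2 is below k+l-1. Otherwise e = 2l+3/4, which requires l < k-7/4; as l
and k are integers, l < k-3/2 means l ≤ k-2, and that is enough. -/
lemma exists_line_bound_of_cases {k l : ℕ} {χ : DirichletCharacter ℂ 4} {g : ℍ → ℂ}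
    (hg : g ∈ halfModularForms l χ) {b : ℕ → ℂ}
    (hb : ∀ z : ℍ, HasSum (fun m : ℕ => b m * qOf z ^ m) (g z))
    (hcase : (g ∈ halfCuspForms l χ ∧ 2 < k) ∨
      (g ∉ halfCuspForms l χ ∧ (l : ℝ) < (k : ℝ) - 3 / 2)) :
    ∃ C e : ℝ, 0 ≤ C ∧ 0 ≤ e ∧ e < (k : ℝ) + l - 1 ∧
      ∀ y : ℝ, 0 < y → ∫ x in Ioc (0 : ℝ) 1, ‖g (pt x y)‖ ^ 2 ≤ C * (1 + y ^ (-e)) := by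
  have hl0 : (0 : ℝ) ≤ l := l.cast_nonneg
  rcases hcase with ⟨hgc, hk⟩ | ⟨-, hlk⟩
  · have hk' : (2 : ℝ) < k := by exact_mod_cast hk
    obtain ⟨C, hC, h⟩ := (isCuspidal_of_mem_halfCuspForms hgc).exists_line_bound (four_mul_weight l)
    exact ⟨C, (l : ℝ) + 1 / 2, hC, by positivity, by linarith, h⟩
  · have hlk2 : l + 2 ≤ k := by
      by_contra h
      have : (k : ℝ) ≤ l + 1 := by exact_mod_cast (by omega : k ≤ l + 1)
      linarith
    have hlk3 : (l : ℝ) + 2 ≤ k := by exact_mod_cast hlk2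
    obtain ⟨C, hC, h⟩ := (isForm_of_mem_halfModularForms hg).exists_line_bound (by linarith) hb
    exact ⟨C, 2 * ((l : ℝ) + 1 / 2) - 1 / 4, hC, by linarith, by linarith, h⟩

lemma two_le_of_cases {k l : ℕ} {p q : Prop}
    (hcase : (p ∧ 2 < k) ∨ (q ∧ (l : ℝ) < (k : ℝ) - 3 / 2)) : 2 ≤ k := by
  rcases hcase with ⟨-, hk⟩ | ⟨-, hlk⟩
  · exact hk.le
  · by_contra h
    have : (k : ℝ) ≤ 1 := by exact_mod_cast (by omega : k ≤ 1)
    linarith [(l.cast_nonneg : (0 : ℝ) ≤ l)]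

/-- The Fourier coefficients of the adjoint of `h ↦ [h, g]_ν`. -/
theorem adjoint_coeff {k l ν : ℕ} {χ : DirichletCharacter ℂ 4} {g : ℍ → ℂ}
    (hg : g ∈ halfModularForms l χ) {b : ℕ → ℂ}
    (hb : ∀ z : ℍ, HasSum (fun m : ℕ => b m * qOf z ^ m) (g z))
    (hcase : (g ∈ halfCuspForms l χ ∧ 2 < k) ∨
      (g ∉ halfCuspForms l χ ∧ (l : ℝ) < (k : ℝ) - 3 / 2))
    {U : integralCuspForms (k + l + 2 * ν + 1) (χ * chiNegFour ^ (k + l + 1)) →ₗ[ℂ] halfCuspForms k 1}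
    (hU : IsPeterssonAdjoint ((k : ℝ) + 1 / 2) ((k + l + 2 * ν + 1 : ℕ) : ℝ) (rankinCohenMap k ν hg) U)
    (f : integralCuspForms (k + l + 2 * ν + 1) (χ * chiNegFour ^ (k + l + 1))) {a a' : ℕ → ℂ}
    (ha : ∀ z : ℍ, HasSum (fun m : ℕ => a' m * qOf z ^ m) ((f : ℍ → ℂ) z)) (ha0 : a' 0 = 0)
    (haa : ∀ m, m ≠ 0 → a' m = a m) {n : ℕ} (hn : 1 ≤ n) :
    Summable (shiftedLTerm ((k : ℝ) + 1 / 2) ((l : ℝ) + 1 / 2) ν a b n ((k : ℂ) + l + 2 * ν)) ∧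
      (qExpansion 1 (U f : ℍ → ℂ)).coeff n = (beta k l ν n : ℂ) *
        shiftedL ((k : ℝ) + 1 / 2) ((l : ℝ) + 1 / 2) ν a b n ((k : ℂ) + l + 2 * ν) := by
  have hk := two_le_of_cases hcase
  have hk' : (2 : ℝ) ≤ k := by exact_mod_cast hk
  -- With g = 0 the cocycle relation cannot be read off from g, but then T and its adjoint vanish
  -- and so do all b(m).
  by_cases hg0 : g = 0
  · have hgf := isForm_of_mem_halfModularForms hg
    have hb0 : ∀ m, b m = 0 := fun m => by
      rw [fourier_coeff_unique hg.1 (T_smul_of_halfSlash hg.2.1) hgf.bdd_one hb m,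
        ← fourier_coeff_unique hg.1 (T_smul_of_halfSlash hg.2.1) hgf.bdd_one (c := fun _ => 0)
          (fun z => by simp [hg0]) m]
    have ht : shiftedLTerm ((k : ℝ) + 1 / 2) ((l : ℝ) + 1 / 2) ν a b n ((k : ℂ) + l + 2 * ν) =
        fun _ => 0 := by
      ext m
      simp [shiftedLTerm, hb0]
    have hU0 : (U f : ℍ → ℂ) = 0 := by
      refine eq_zero_of_peterssonProduct_self (four_mul_weight k)
        (isCuspidal_of_mem_halfCuspForms (U f).2) ?_
      rw [← hU f (U f)]
      have h0 := rankinCohen_smul (κ := (k : ℝ) + 1 / 2) (lam := (l : ℝ) + 1 / 2) ν (U f).2.1 hg.1 1 0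
      rw [mul_zero, zero_smul, one_smul, zero_smul, ← hg0] at h0
      change peterssonProduct _ _ (rankinCohen _ _ ν (U f : ℍ → ℂ) g) = 0
      rw [h0]
      simp [peterssonProduct, hg0]
    rw [ht, shiftedL, ht, tsum_zero, mul_zero, hU0]
    refine ⟨summable_zero, ?_⟩
    have h1 := fourier_coeff_unique (f := (0 : ℍ → ℂ)) mdifferentiable_const (fun _ => rfl)
      (Filter.const_boundedAtFilter atImInfty (0 : ℂ)) (c := fun _ => 0)
      (fun z => by simp) n
    exact h1.symm
  · obtain ⟨C, e, hC, he, hek, hgb⟩ := exists_line_bound_of_cases hg hb hcase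
    have h1 := peterssonProduct_rankinCohen_poincare (ν := ν) hk hn hg hb hC he hek hgb f.2 ha ha0
    have h2 := hU f ⟨poincare k n, poincare_mem_halfCuspForms hg hg0 hk hn⟩
    change peterssonProduct _ _ (rankinCohen _ _ ν (poincare k n) g) = _ at h2
    rw [h2, peterssonProduct_poincare hk hn (U f).2] at h1
    simp_rw [shiftedLTerm_eq hn haa] at h1
    have h3 := (hasSum_mul_left_iff (two_ne_zero' ℂ)).1 h1
    have hne : ((Real.Gamma ((k : ℝ) + l + 2 * ν) /
        (4 * Real.pi) ^ ((k : ℝ) + l + 2 * ν) : ℝ) : ℂ) ≠ 0 := by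
      rw [Complex.ofReal_ne_zero]
      have : 0 < Real.Gamma ((k : ℝ) + l + 2 * ν) := Real.Gamma_pos_of_pos (by positivity)
      positivity
    have h4 := (summable_mul_left_iff hne).1 h3.summable
    refine ⟨h4, beta_eq hk hn ?_⟩
    rw [← h3.tsum_eq, tsum_mul_left, shiftedL]

end

end HalfIntegralWeight

end

/-! ### The theorem -/

theorem mainTheorem1 (k l ν : ℕ) (χ₂ : DirichletCharacter ℂ 4)
    (g : ℍ → ℂ) (hg : g ∈ HalfIntegralWeight.halfModularForms l χ₂)
    (b : ℕ → ℂ)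
    (hb : ∀ z : ℍ, HasSum (fun m : ℕ => b m * HalfIntegralWeight.qOf z ^ m) (g z))
    (hcase : (g ∈ HalfIntegralWeight.halfCuspForms l χ₂ ∧ 2 < k) ∨
      (g ∉ HalfIntegralWeight.halfCuspForms l χ₂ ∧ (l : ℝ) < (k : ℝ) - 3 / 2)) :
    ∃ (T : HalfIntegralWeight.halfCuspForms k 1 →ₗ[ℂ]
          HalfIntegralWeight.integralCuspForms (k + l + 2 * ν + 1)
            (χ₂ * HalfIntegralWeight.chiNegFour ^ (k + l + 1)))
      (Tstar : HalfIntegralWeight.integralCuspForms (k + l + 2 * ν + 1)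
            (χ₂ * HalfIntegralWeight.chiNegFour ^ (k + l + 1)) →ₗ[ℂ]
          HalfIntegralWeight.halfCuspForms k 1),
      -- `T` is the map `h ↦ [h, g]_ν`
      (∀ h : HalfIntegralWeight.halfCuspForms k 1,
        (T h : ℍ → ℂ) =
          HalfIntegralWeight.rankinCohen ((k : ℝ) + 1 / 2) ((l : ℝ) + 1 / 2) ν (h : ℍ → ℂ) g) ∧
      -- `Tstar` is its unique adjoint
      HalfIntegralWeight.IsPeterssonAdjoint ((k : ℝ) + 1 / 2)
        ((k : ℝ) + l + 2 * ν + 1) T Tstar ∧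
      (∀ U, HalfIntegralWeight.IsPeterssonAdjoint ((k : ℝ) + 1 / 2)
        ((k : ℝ) + l + 2 * ν + 1) T U → U = Tstar) ∧
      -- Fourier expansion of `Tstar f`
      ∀ (f : HalfIntegralWeight.integralCuspForms (k + l + 2 * ν + 1)
            (χ₂ * HalfIntegralWeight.chiNegFour ^ (k + l + 1))) (a : ℕ → ℂ),
        (∀ z : ℍ, HasSum (fun m : ℕ+ => a m * HalfIntegralWeight.qOf z ^ (m : ℕ))
          ((f : ℍ → ℂ) z)) →
        (∀ n : ℕ+, Summable (HalfIntegralWeight.shiftedLTerm ((k : ℝ) + 1 / 2) ((l : ℝ) + 1 / 2)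
          ν a b n ((k : ℂ) + l + 2 * ν))) ∧
        ∀ z : ℍ, HasSum (fun n : ℕ+ =>
          ((HalfIntegralWeight.beta k l ν n : ℂ) *
            HalfIntegralWeight.shiftedL ((k : ℝ) + 1 / 2) ((l : ℝ) + 1 / 2) ν a b n
              ((k : ℂ) + l + 2 * ν)) * HalfIntegralWeight.qOf z ^ (n : ℕ))
          ((Tstar f : ℍ → ℂ) z) := by
  open HalfIntegralWeight in
  have hK : ((k + l + 2 * ν + 1 : ℕ) : ℝ) = (k : ℝ) + l + 2 * ν + 1 := by push_cast; ring
  obtain ⟨U, hU, huniq⟩ := existsUnique_adjoint (rankinCohenMap k ν hg)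
  rw [← hK]
  refine ⟨rankinCohenMap k ν hg, U, fun _ => rfl, hU, huniq, fun f a ha => ?_⟩
  -- The expansion of f runs over m ≥ 1 and leaves a(0) arbitrary, so it is replaced by 0.
  have ha' : ∀ z : ℍ, HasSum (fun m : ℕ => (if m = 0 then 0 else a m) * qOf z ^ m)
      ((f : ℍ → ℂ) z) := fun z =>
    (hasSum_pnat_iff (a := fun m => if m = 0 then 0 else a m) (if_pos rfl)).1
      ((ha z).congr_fun fun m => by rw [if_neg m.ne_zero])
  have hcoeff := fun n : ℕ+ => adjoint_coeff hg hb hcase hU f ha' (if_pos rfl)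
    (fun m hm => if_neg hm) n.pos
  have hc := isCuspidal_of_mem_halfCuspForms (U f).2
  refine ⟨fun n => (hcoeff n).1, fun z => ?_⟩
  exact ((hasSum_pnat_iff hc.qExpansion_coeff_zero).2 (hasSum_fourier (U f).2.1
    (T_smul_of_halfSlash (U f).2.2.1) hc.toIsForm.bdd_one z)).congr_fun fun n => by
      exact congrArg (· * qOf z ^ (n : ℕ)) (hcoeff n).2.symm
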